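/- Let $\{p(\cdot\,|\,\theta):\theta\in\Theta\}$, $\Theta\subset\mathbb R^m$, be a family of probability densities with respect to a measure $\mu$ on a measurable space $\mathcal Z$, let $P_\theta$ be the law with density $p(\cdot\,|\,\theta)$, and let $z_1,\dots,z_n$ be i.i.d. from $P_\theta$. Let $\theta_0\in\operatorname{int}(\Theta)$. Suppose that the model is differentiable in quadratic mean at $\theta_0$, i.e. there is a score function $s:\mathcal Z\to\mathbb R^m$ with $$\int\Big[\sqrt{p(z|\theta_0+h)}-\sqrt{p(z|\theta_0)}-\tfrac12 h's(z)\sqrt{p(z|\theta_0)}\Big]^2d\mu(z)=o(\|h\|^2)\quad\text{as }h\to0,$$ and that the Fisher information matrix $J_0=E_{\theta_0}[ss']$ is nonsingular. Let $I_1,I_2\subset[0,1]$ (possibly overlapping) and put $N_1=I_1\cap I_2^c$, $N_2=I_2\cap I_1^c$, $N_{12}=I_1\cap I_2$. Suppose that $\frac1n\#\{i\le n:\frac in\in N_1\}\to\lambda_1>0$, $\frac1n\#\{i\le n:\frac in\in N_2\}\to\lambda_2>0$ and $\frac1n\#\{i\le n:\frac in\in N_{12}\}\to\lambda_{12}>0$.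 For each $n$ let $S_{1,n},S_{2,n}$ be real-valued statistics of $z_1,\dots,z_n$ such that $S_{k,n}$ depends only on the observations $z_i$ with $\frac in\in I_k$, $k=1,2$. Suppose that for every $h\in\mathbb R^m$ the pair $(S_{1,n},S_{2,n})$ converges in distribution, under the sequence of parameters $\theta_0+h/\sqrt n$, to a probability law $\mathcal L_h$ on $\mathbb R^2$. Then there are measurable functions $T_1,T_2:\mathbb R^m\times\mathbb R^m\times[0,1]\to\mathbb R$, not depending on $h$, such that for every $h\in\mathbb R^m$: if $Z_1\sim N(h,(\lambda_1J_0)^{-1})$, $Z_2\sim N(h,(\lambda_2J_0)^{-1})$, $Z_{12}\sim N(h,(\lambda_{12}J_0)^{-1})$ and $U\sim\mathrm{Unif}[0,1]$ are independent, then $$\big(T_1(Z_1,Z_{12},U),\;T_2(Z_2,Z_{12},U)\big)\sim\mathcal L_h .$$ -/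

import Mathlib

open MeasureTheory ProbabilityTheory Filter Topology

noncomputable section

/-- `p θ`, for `θ ∈ Θ`, are probability densities on `Z` with respect to the dominating
measure `μ`. Nothing is required of `p θ` for `θ ∉ Θ`. -/
structure IsDensityFamily {Z : Type*} [MeasurableSpace Z] {m : ℕ} (μ : Measure Z)
    (Θ : Set (EuclideanSpace ℝ (Fin m))) (p : EuclideanSpace ℝ (Fin m) → Z → ℝ) : Prop where
  measurable : ∀ θ ∈ Θ, Measurable (p θ)
  nonneg : ∀ θ ∈ Θ, ∀ z, 0 ≤ p θ z
  lintegral_eq_one : ∀ θ ∈ Θ, ∫⁻ z, ENNReal.ofReal (p θ z) ∂μ = 1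

/-- The law `P_θ` of a single observation: the measure with density `p θ` with respect to `μ`. -/
def obsLaw {Z : Type*} [MeasurableSpace Z] {m : ℕ} (μ : Measure Z)
    (p : EuclideanSpace ℝ (Fin m) → Z → ℝ) (θ : EuclideanSpace ℝ (Fin m)) : Measure Z :=
  μ.withDensity fun z => ENNReal.ofReal (p θ z)

/-- The law of an i.i.d. sample `(z_1, …, z_n)` from `P_θ`. -/
def sampleLaw {Z : Type*} [MeasurableSpace Z] {m : ℕ} (μ : Measure Z)
    (p : EuclideanSpace ℝ (Fin m) → Z → ℝ) (n : ℕ) (θ : EuclideanSpace ℝ (Fin m)) :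
    Measure (Fin n → Z) :=
  Measure.pi fun _ => obsLaw μ p θ

/-- Differentiability in quadratic mean of the model at `θ₀` with score function `s`:
`∫ (√p_{θ₀+h} - √p_{θ₀} - (1/2) h's √p_{θ₀})² dμ = o(‖h‖²)` as `h → 0`. The integral is the
`[0, ∞]`-valued one, so that its finiteness for small `h` is part of the condition. -/
def IsDQM {Z : Type*} [MeasurableSpace Z] {m : ℕ} (μ : Measure Z)
    (p : EuclideanSpace ℝ (Fin m) → Z → ℝ) (θ₀ : EuclideanSpace ℝ (Fin m))
    (s : Z → EuclideanSpace ℝ (Fin m)) : Prop :=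
  Measurable s ∧
  ∀ ε : ℝ, 0 < ε → ∀ᶠ h in 𝓝 (0 : EuclideanSpace ℝ (Fin m)),
    ∫⁻ z, ENNReal.ofReal
      ((√(p (θ₀ + h) z) - √(p θ₀ z) - 1 / 2 * inner ℝ h (s z) * √(p θ₀ z)) ^ 2) ∂μ
      ≤ ENNReal.ofReal (ε * ‖h‖ ^ 2)

/-- The Fisher information matrix `E_{θ₀}[s s']`. -/
def fisherInfo {Z : Type*} [MeasurableSpace Z] {m : ℕ} (μ : Measure Z)
    (p : EuclideanSpace ℝ (Fin m) → Z → ℝ) (θ₀ : EuclideanSpace ℝ (Fin m))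
    (s : Z → EuclideanSpace ℝ (Fin m)) : Matrix (Fin m) (Fin m) ℝ :=
  Matrix.of fun i j => ∫ z, s z i * s z j ∂(obsLaw μ p θ₀)

/-- The observations of a sample of size `n` whose position lies in `I`: the index `i : Fin n`
stands for the observation number `i + 1`, whose position is `(i + 1) / n`. -/
def infoIndices (I : Set ℝ) (n : ℕ) : Set (Fin n) :=
  {i | ((i : ℝ) + 1) / n ∈ I}

/-- The proportion of the observations whose position lies in `N` tends to `lam`. -/
def HasAsymptoticShare (N : Set ℝ) (lam : ℝ) : Prop :=
  Tendsto (fun n : ℕ => ((infoIndices N n).ncard : ℝ) / n) atTop (𝓝 lam)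

/-- The local parameter sequence `θ₀ + h / √n`. -/
def localParam {m : ℕ} (θ₀ h : EuclideanSpace ℝ (Fin m)) (n : ℕ) : EuclideanSpace ℝ (Fin m) :=
  θ₀ + (√(n : ℝ))⁻¹ • h

/-- Weak convergence, as `n → ∞`, of the laws of the pair `(S₁ n, S₂ n)` under the probability
measures `ν n` to `L`, through bounded continuous test functions. -/
def PairConvergesInLaw {Z : Type*} [MeasurableSpace Z] (ν : ∀ n : ℕ, Measure (Fin n → Z))
    (S₁ S₂ : ∀ n : ℕ, (Fin n → Z) → ℝ) (L : Measure (ℝ × ℝ)) : Prop :=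
  ∀ f : BoundedContinuousFunction (ℝ × ℝ) ℝ,
    Tendsto (fun n => ∫ x, f (S₁ n x, S₂ n x) ∂(ν n)) atTop (𝓝 (∫ y, f y ∂L))

/-- The law of `(Z₁, Z₂, Z₁₂, U)` for independent `Z₁ ∼ N(h, (lam₁ J)⁻¹)`,
`Z₂ ∼ N(h, (lam₂ J)⁻¹)`, `Z₁₂ ∼ N(h, (lam₁₂ J)⁻¹)` and `U ∼ Unif[0,1]`. -/
def limitExperiment {m : ℕ} (J : Matrix (Fin m) (Fin m) ℝ) (lam₁ lam₂ lam₁₂ : ℝ)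
    (h : EuclideanSpace ℝ (Fin m)) :
    Measure (EuclideanSpace ℝ (Fin m) × EuclideanSpace ℝ (Fin m) ×
      EuclideanSpace ℝ (Fin m) × ℝ) :=
  (multivariateGaussian h (lam₁ • J)⁻¹).prod
    ((multivariateGaussian h (lam₂ • J)⁻¹).prod
      ((multivariateGaussian h (lam₁₂ • J)⁻¹).prod
        (volume.restrict (Set.Icc (0 : ℝ) 1))))

end

/-! Everything is done under the single parameter θ₀, and the parameter h enters only through an
exponential weight. Differentiability in quadratic mean makes the n-fold law at θ₀ + h/√n
asymptotically indistinguishable, for bounded statistics, from the law with density proportional to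
exp(h'Δₙ), where Δₙ is the scaled sum of centred truncated scores (`IsDQM.eventually_hellinger_le`,
`IsDQM.tendsto_lintegral_tiltDensity`). Only the observations used by the statistics matter, and
there Δₙ = Δ₁ + Δ₂ + Δ₀, one sum for each of the disjoint blocks N₁, N₂, N₁₂.

Given the common block, (Δ₁, S₁) and (Δ₂, S₂) are independent. Their conditional laws κ₁, κ₂ are
random probability measures whose first marginals are deterministic, because Δ₁ and Δ₂ do not
involve the common block. The law Gₙ of (κ₁, κ₂, Δ₀) therefore records all that is needed: every
weighted mean of f₁(S₁) f₂(S₂) is an integral against Gₙ (`exists_law_of_pairs`). Working in the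
extended reals makes the space of such triples compact, so Gₙ has a limit point G₀. Conditional
independence given the common block, with first marginals not depending on it, is built into the
form of this space and survives the limit, whereas it could be lost in a limit of joint laws of (S₁,
S₂, Δ). The central limit theorem with bounded exponential moments identifies the marginals as N(0,
λJ₀) and allows the unbounded weights to pass to the limit (`exists_limit_tiltedMean`).

G₀ is then realised by sampling: one part of U draws (κ₁, κ₂) given Δ₀, two further independent
parts draw the k-th statistic from κₖ given Δₖ (`exists_sampler_of_random_laws`). This gives
functions of (Δ₁, Δ₀, U) and (Δ₂, Δ₀, U) which do not depend on h. Finally the weight exp(h'd) turns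
N(0, λJ₀) into a multiple of N(λJ₀h, λJ₀), the image of N(h, (λJ₀)⁻¹) under λJ₀, and the statistics
become Tₖ evaluated at λJ₀z (`exists_statistics_of_tilted_limit`). -/

noncomputable section

/-! ### Probability measures on a compact metrizable space: Borel structure and limits. -/

section ProbabilityMeasureSpace

theorem polishSpace_of_compact_metrizable (A : Type*) [TopologicalSpace A] [CompactSpace A]
    [TopologicalSpace.MetrizableSpace A] : PolishSpace A := by
  let _ : MetricSpace A := TopologicalSpace.metrizableSpaceMetric A
  infer_instance

open scoped NNReal ENNReal BoundedContinuousFunction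

variable {K : Type*} [TopologicalSpace K] [MeasurableSpace K] [BorelSpace K]

/-- Integration of a continuous function is measurable for the Giry `σ`-algebra. -/
theorem measurable_integral_probabilityMeasure (f : C(K, ℝ)) :
    Measurable fun κ : ProbabilityMeasure K => ∫ x, f x ∂(κ : Measure K) := by
  let η : Kernel (ProbabilityMeasure K) K := ⟨fun κ => (κ : Measure K), measurable_subtype_coe⟩
  have : IsMarkovKernel η := ⟨fun κ => by change IsProbabilityMeasure (κ : Measure K); infer_instance⟩
  have h : StronglyMeasurable (fun κ : ProbabilityMeasure K => ∫ x, f x ∂(η κ)) :=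
    StronglyMeasurable.integral_kernel f.continuous.measurable.stronglyMeasurable
  exact h.measurable

variable [TopologicalSpace.MetrizableSpace K]

/-- The mass of a closed set is a pointwise limit of integrals of bounded continuous functions,
which are weakly continuous, and closed sets form a generating π-system. -/
theorem giry_le_borel_probabilityMeasure :
    (inferInstance : MeasurableSpace (ProbabilityMeasure K)) ≤ borel (ProbabilityMeasure K) := by
  have hm : @Measurable _ _ (borel (ProbabilityMeasure K)) _
      (fun κ : ProbabilityMeasure K => (κ : Measure K)) := by
    let _ : MeasurableSpace (ProbabilityMeasure K) := borel _
    have : BorelSpace (ProbabilityMeasure K) := ⟨rfl⟩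
    refine Measurable.measure_of_isPiSystem_of_isProbabilityMeasure
      (S := {s | IsClosed s})
      (by rw [← borel_eq_generateFrom_isClosed]; exact BorelSpace.measurable_eq)
      isPiSystem_isClosed fun F hF => ?_
    refine measurable_of_tendsto_metrizable
      (f := fun n (κ : ProbabilityMeasure K) => ∫⁻ x, hF.apprSeq n x ∂(κ : Measure K))
      (fun n => ?_) ?_
    · exact (ProbabilityMeasure.continuous_lintegral_boundedContinuousFunction
        (hF.apprSeq n)).measurable
    · rw [tendsto_pi_nhds]
      intro κ
      exact HasOuterApproxClosed.tendsto_lintegral_apprSeq hF κ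
  intro s hs
  obtain ⟨t, ht, rfl⟩ := hs
  exact hm ht

variable [CompactSpace K]

/-- Weak limits use the topology, disintegration uses the Giry `σ`-algebra; this reconciles them.
Integrals of a dense sequence of continuous functions embed the compact space of laws into `ℕ → ℝ`,
so its Borel sets are pulled back along Giry-measurable coordinates. -/
instance borelSpace_probabilityMeasure : BorelSpace (ProbabilityMeasure K) := by
  refine ⟨le_antisymm giry_le_borel_probabilityMeasure ?_⟩
  let Φ : ProbabilityMeasure K → (ℕ → ℝ) := fun κ q =>
    ∫ x, TopologicalSpace.denseSeq C(K, ℝ) q x ∂(κ : Measure K)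
  have hΦc : Continuous Φ := continuous_pi fun q =>
    ProbabilityMeasure.continuous_integral_continuousMap _
  have hΦi : Function.Injective Φ := by
    intro κ κ' h
    have key : ∀ f : C(K, ℝ), ∫ x, f x ∂(κ : Measure K) = ∫ x, f x ∂(κ' : Measure K) := by
      have hcl : IsClosed {f : C(K, ℝ) | ∫ x, f x ∂(κ : Measure K) = ∫ x, f x ∂(κ' : Measure K)} := by
        have (ν : ProbabilityMeasure K) : Continuous fun f : C(K, ℝ) => ∫ x, f x ∂(ν : Measure K) := by
          refine LipschitzWith.continuous (K := 1) (LipschitzWith.of_dist_le_mul fun f g => ?_)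
          have hi (f : C(K, ℝ)) : Integrable (fun x => f x) (ν : Measure K) :=
            (BoundedContinuousFunction.mkOfCompact f).integrable _
          rw [dist_eq_norm, ← integral_sub (hi f) (hi g), dist_eq_norm]
          have := norm_integral_le_of_norm_le_const (μ := (ν : Measure K))
            (f := fun x => f x - g x) (C := ‖f - g‖)
            (ae_of_all _ fun x => (f - g).norm_coe_le_norm x)
          simpa using this
        exact isClosed_eq (this κ) (this κ')
      intro f
      have := (TopologicalSpace.denseRange_denseSeq C(K, ℝ)).closure_range
      have hsub : closure (Set.range (TopologicalSpace.denseSeq C(K, ℝ))) ⊆ _ :=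
        hcl.closure_subset_iff.2 (by rintro _ ⟨q, rfl⟩; exact congrFun h q)
      exact hsub (by rw [this]; trivial)
    apply ProbabilityMeasure.toMeasure_injective
    exact ext_of_forall_integral_eq_of_IsFiniteMeasure fun f => key f.toContinuousMap
  have hemb : IsClosedEmbedding Φ := hΦc.isClosedEmbedding hΦi
  have hind : borel (ProbabilityMeasure K) = MeasurableSpace.comap Φ (borel (ℕ → ℝ)) := by
    rw [← borel_comap, ← hemb.isInducing.eq_induced]
  rw [hind, ← BorelSpace.measurable_eq (α := ℕ → ℝ)]
  exact (measurable_pi_lambda _ fun q => measurable_integral_probabilityMeasure _).comap_le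

instance secondCountableTopology_probabilityMeasure :
    SecondCountableTopology (ProbabilityMeasure K) :=
  have := polishSpace_of_compact_metrizable K
  have := polishSpace_of_compact_metrizable (ProbabilityMeasure K)
  inferInstance

/-- A sequence of probability measures on a compact metrizable space converges along a
nonprincipal ultrafilter. -/
theorem exists_tendsto_hyperfilter (G : ℕ → ProbabilityMeasure K) :
    ∃ G₀ : ProbabilityMeasure K, Tendsto G (hyperfilter ℕ : Filter ℕ) (𝓝 G₀) := by
  obtain ⟨x, -, hx⟩ := (isCompact_univ (X := ProbabilityMeasure K)).ultrafilter_le_nhds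
    ((hyperfilter ℕ).map G) (by simp)
  exact ⟨x, hx⟩

/-- A continuous map which is almost surely constant along a weakly convergent net of laws is
almost surely constant under the limit. -/
theorem ae_eq_of_tendsto_of_ae_eq {Y ι : Type*} [TopologicalSpace Y] [CompactSpace Y]
    [TopologicalSpace.MetrizableSpace Y] {F : Filter ι} [F.NeBot] {G : ι → ProbabilityMeasure K}
    {G₀ : ProbabilityMeasure K} (hG : Tendsto G F (𝓝 G₀)) {g : K → Y} (hg : Continuous g)
    {y : ι → Y} {y₀ : Y} (hy : Tendsto y F (𝓝 y₀)) (hae : ∀ n, ∀ᵐ x ∂(G n : Measure K), g x = y n) :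
    ∀ᵐ x ∂(G₀ : Measure K), g x = y₀ := by
  let _ : MetricSpace Y := TopologicalSpace.metrizableSpaceMetric Y
  -- The mean of this distance under `G n` is `dist (y n) y₀`, which tends to zero; so its mean
  -- under the limit vanishes.
  let φ : C(K, ℝ) := ⟨fun x => dist (g x) y₀, by fun_prop⟩
  have h1 : Tendsto (fun n => ∫ x, φ x ∂(G n : Measure K)) F (𝓝 (∫ x, φ x ∂(G₀ : Measure K))) :=
    ((ProbabilityMeasure.continuous_integral_continuousMap φ).tendsto _).comp hG
  have h2 : (fun n => ∫ x, φ x ∂(G n : Measure K)) = fun n => dist (y n) y₀ := by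
    funext n
    rw [integral_congr_ae (g := fun _ => dist (y n) y₀)]
    · simp
    · filter_upwards [hae n] with x hx
      simp [φ, hx]
  rw [h2] at h1
  have h3 : ∫ x, φ x ∂(G₀ : Measure K) = 0 :=
    tendsto_nhds_unique h1 (tendsto_iff_dist_tendsto_zero.1 hy)
  rw [integral_eq_zero_iff_of_nonneg (f := φ) (fun x => dist_nonneg)
    ((BoundedContinuousFunction.mkOfCompact φ).integrable _)] at h3
  filter_upwards [h3] with x hx
  exact dist_eq_zero.1 hx

end ProbabilityMeasureSpace

/-! ### Sampling from random laws by means of one uniform variable. -/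

section Representation

open scoped ENNReal unitInterval

variable {K S : Type*} [TopologicalSpace K] [CompactSpace K] [TopologicalSpace.MetrizableSpace K]
  [MeasurableSpace K] [BorelSpace K] [Nonempty K]
  [TopologicalSpace S] [CompactSpace S] [TopologicalSpace.MetrizableSpace S]
  [MeasurableSpace S] [BorelSpace S] [Nonempty S]

/-- The identity kernel from laws on `A` to `A`. -/
def lawKernel (A : Type*) [MeasurableSpace A] : Kernel (ProbabilityMeasure A) A :=
  ⟨fun κ => (κ : Measure A), measurable_subtype_coe⟩

instance {A : Type*} [MeasurableSpace A] : IsMarkovKernel (lawKernel A) :=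
  ⟨fun κ => by change IsProbabilityMeasure (κ : Measure A); infer_instance⟩

@[simp] theorem lawKernel_apply {A : Type*} [MeasurableSpace A] (κ : ProbabilityMeasure A) :
    lawKernel A κ = (κ : Measure A) := rfl

/-- Sampling from a random law `κ` on `K × S` whose first marginal is fixed: the second coordinate
is a measurable function of `κ`, the first coordinate and an independent uniform variable. -/
theorem exists_conditional_sampler :
    ∃ φ : ProbabilityMeasure (K × S) × K → I → S, Measurable (Function.uncurry φ) ∧
      ∀ (κ : ProbabilityMeasure (K × S)) (γ : Measure K), (κ : Measure (K × S)).map Prod.fst = γ →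
        ∀ F : K × S → ℝ≥0∞, Measurable F →
          ∫⁻ d, (∫⁻ u, F (d, φ (κ, d) u)) ∂γ = ∫⁻ y, F y ∂(κ : Measure (K × S)) := by
  have := polishSpace_of_compact_metrizable K
  have := polishSpace_of_compact_metrizable S
  -- Disintegrating the identity kernel, rather than each law separately, makes the conditional law
  -- given the first coordinate jointly measurable in `κ`.
  obtain ⟨φ, hφ, hmap⟩ :=
    Kernel.exists_measurable_map_eq_unitInterval (lawKernel (K × S)).condKernel
  refine ⟨φ, hφ, fun κ γ hκ F hF => ?_⟩
  have h := (lawKernel (K × S)).disintegrate (lawKernel (K × S)).condKernel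
  have hfst : (lawKernel (K × S)).fst κ = γ := by
    rw [Kernel.fst_apply, lawKernel_apply, hκ]
  conv_rhs => rw [← lawKernel_apply κ, ← h, Kernel.lintegral_compProd _ _ _ hF, hfst]
  refine lintegral_congr fun d => ?_
  rw [← hmap, lintegral_map (by fun_prop) (by fun_prop)]

/-- A pair of laws on `K × S` together with a point of `K`. -/
abbrev LawSpace (K S : Type*) [MeasurableSpace K] [MeasurableSpace S] : Type _ :=
  ProbabilityMeasure (K × S) × ProbabilityMeasure (K × S) × K

/-- A random pair of laws on `K × S` with fixed first marginals can be sampled from by two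
measurable functions of the respective first coordinates, a common point of `K` and a common
uniform variable. -/
theorem exists_sampler_of_random_laws
    (G : ProbabilityMeasure (LawSpace K S))
    (γ₁ γ₂ γ₀ : Measure K) [IsProbabilityMeasure γ₁] [IsProbabilityMeasure γ₂]
    [IsProbabilityMeasure γ₀]
    (h₁ : ∀ᵐ x ∂(G : Measure (LawSpace K S)), (x.1 : Measure (K × S)).map Prod.fst = γ₁)
    (h₂ : ∀ᵐ x ∂(G : Measure (LawSpace K S)), (x.2.1 : Measure (K × S)).map Prod.fst = γ₂)
    (h₀ : (G : Measure (LawSpace K S)).map (fun x => x.2.2) = γ₀) :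
    ∃ T₁ T₂ : K → K → I → S,
      Measurable (fun x : K × K × I => T₁ x.1 x.2.1 x.2.2) ∧
      Measurable (fun x : K × K × I => T₂ x.1 x.2.1 x.2.2) ∧
      ∀ F₁ F₂ : K × S → ℝ≥0∞, Measurable F₁ → Measurable F₂ → ∀ F₀ : K → ℝ≥0∞, Measurable F₀ →
        ∫⁻ ω, F₁ (ω.1, T₁ ω.1 ω.2.2.1 ω.2.2.2) * F₂ (ω.2.1, T₂ ω.2.1 ω.2.2.1 ω.2.2.2) *
            F₀ ω.2.2.1 ∂(γ₁.prod (γ₂.prod (γ₀.prod (volume : Measure I)))) =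
          ∫⁻ x, (∫⁻ y, F₁ y ∂(x.1 : Measure (K × S))) * (∫⁻ y, F₂ y ∂(x.2.1 : Measure (K × S))) *
            F₀ x.2.2 ∂(G : Measure (LawSpace K S)) := by
  have := polishSpace_of_compact_metrizable K
  have := polishSpace_of_compact_metrizable S
  have := polishSpace_of_compact_metrizable (ProbabilityMeasure (K × S))
  have : Nonempty (ProbabilityMeasure (K × S)) :=
    ⟨⟨Measure.dirac (Classical.arbitrary _), inferInstance⟩⟩
  obtain ⟨φ, hφ, hφF⟩ := exists_conditional_sampler (K := K) (S := S)
  -- The common point is put first, so that the pair of laws can be drawn conditionally on it.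
  set ρ : Measure (K × (ProbabilityMeasure (K × S) × ProbabilityMeasure (K × S))) :=
    (G : Measure (LawSpace K S)).map (fun x => (x.2.2, (x.1, x.2.1))) with hρ
  have hρm : Measurable (fun x : ProbabilityMeasure (K × S) × ProbabilityMeasure (K × S) × K =>
      (x.2.2, (x.1, x.2.1))) := by fun_prop
  have : IsProbabilityMeasure ρ := Measure.isProbabilityMeasure_map hρm.aemeasurable
  have hρfst : ρ.fst = γ₀ := by
    rw [Measure.fst, hρ, Measure.map_map measurable_fst hρm, ← h₀]
    rfl
  obtain ⟨ψ, hψ, hψmap⟩ := Kernel.exists_measurable_map_eq_unitInterval ρ.condKernel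
  -- `g` splits the uniform variable into three independent ones: one draws the pair of laws, and is
  -- shared by both functions; the two others draw the two statistics.
  obtain ⟨g, hg, hgmap⟩ := Measure.exists_measurable_map_eq
    ((volume : Measure I).prod ((volume : Measure I).prod (volume : Measure I)))
  refine ⟨fun d₁ d₀ u => φ ((ψ d₀ (g u).1).1, d₁) (g u).2.1,
    fun d₂ d₀ u => φ ((ψ d₀ (g u).1).2, d₂) (g u).2.2, by fun_prop, by fun_prop,
    fun F₁ F₂ hF₁ hF₂ F₀ hF₀ => ?_⟩
  -- the right side as an integral over the sampled pair of random laws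
  have hR : ∫⁻ x, (∫⁻ y, F₁ y ∂(x.1 : Measure (K × S))) * (∫⁻ y, F₂ y ∂(x.2.1 : Measure (K × S))) *
            F₀ x.2.2 ∂(G : Measure (LawSpace K S)) =
      ∫⁻ p, (∫⁻ d, (∫⁻ u, F₁ (d, φ ((ψ p.1 p.2).1, d) u)) ∂γ₁) *
        (∫⁻ d, (∫⁻ u, F₂ (d, φ ((ψ p.1 p.2).2, d) u)) ∂γ₂) * F₀ p.1
          ∂(γ₀.prod (volume : Measure I)) := by
    set H : K × (ProbabilityMeasure (K × S) × ProbabilityMeasure (K × S)) → ℝ≥0∞ := fun q =>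
      (∫⁻ d, (∫⁻ u, F₁ (d, φ (q.2.1, d) u)) ∂γ₁) *
        (∫⁻ d, (∫⁻ u, F₂ (d, φ (q.2.2, d) u)) ∂γ₂) * F₀ q.1 with hH
    have hHm : Measurable H := by
      have e (F : K × S → ℝ≥0∞) (hF : Measurable F) (γ : Measure K) [SFinite γ] :
          Measurable fun κ : ProbabilityMeasure (K × S) =>
            ∫⁻ d, (∫⁻ u, F (d, φ (κ, d) u)) ∂γ := by
        refine Measurable.lintegral_prod_right' (f := fun z : ProbabilityMeasure (K × S) × K =>
          ∫⁻ u, F (z.2, φ (z.1, z.2) u)) ?_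
        exact Measurable.lintegral_prod_right' (f := fun z : (ProbabilityMeasure (K × S) × K) × I =>
          F (z.1.2, φ (z.1.1, z.1.2) z.2)) (by fun_prop)
      exact (((e F₁ hF₁ γ₁).comp (by fun_prop)).mul ((e F₂ hF₂ γ₂).comp (by fun_prop))).mul
        (hF₀.comp measurable_fst)
    have hψ' (d : K) : Measurable (ψ d) := by fun_prop
    calc _ = ∫⁻ x, H (x.2.2, (x.1, x.2.1)) ∂(G : Measure (LawSpace K S)) := by
          refine lintegral_congr_ae ?_
          filter_upwards [h₁, h₂] with x hx₁ hx₂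
          simp only [hH]
          rw [hφF x.1 γ₁ hx₁ F₁ hF₁, hφF x.2.1 γ₂ hx₂ F₂ hF₂]
      _ = ∫⁻ q, H q ∂ρ := by rw [hρ, lintegral_map hHm hρm]
      _ = ∫⁻ d, ∫⁻ w, H (d, w) ∂(ρ.condKernel d) ∂γ₀ := by
          conv_lhs => rw [← ρ.disintegrate ρ.condKernel]
          rw [Measure.lintegral_compProd hHm, hρfst]
      _ = ∫⁻ d, (∫⁻ u, H (d, ψ d u)) ∂γ₀ := by
          refine lintegral_congr fun d => ?_
          rw [← hψmap, lintegral_map (by fun_prop) (hψ' d)]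
      _ = _ := by
          rw [lintegral_prod _ (by fun_prop)]
  rw [hR]
  set a : K → K × I → ℝ≥0∞ := fun d p => ∫⁻ u, F₁ (d, φ ((ψ p.1 p.2).1, d) u) with ha
  set b : K → K × I → ℝ≥0∞ := fun d p => ∫⁻ u, F₂ (d, φ ((ψ p.1 p.2).2, d) u) with hb
  have ham : Measurable (Function.uncurry a) :=
    Measurable.lintegral_prod_right' (f := fun z : (K × (K × I)) × I =>
      F₁ (z.1.1, φ ((ψ z.1.2.1 z.1.2.2).1, z.1.1) z.2)) (by fun_prop)
  have hbm : Measurable (Function.uncurry b) :=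
    Measurable.lintegral_prod_right' (f := fun z : (K × (K × I)) × I =>
      F₂ (z.1.1, φ ((ψ z.1.2.1 z.1.2.2).2, z.1.1) z.2)) (by fun_prop)
  -- Once the pair of laws is drawn, the two remaining uniforms are independent and the mean of the
  -- product factorises.
  have hinner (d₁ d₂ d₀ : K) :
      ∫⁻ u, F₁ (d₁, φ ((ψ d₀ (g u).1).1, d₁) (g u).2.1) *
        F₂ (d₂, φ ((ψ d₀ (g u).1).2, d₂) (g u).2.2) * F₀ d₀ =
      ∫⁻ u, a d₁ (d₀, u) * b d₂ (d₀, u) * F₀ d₀ := by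
    have hm : Measurable fun v : I × I × I => F₁ (d₁, φ ((ψ d₀ v.1).1, d₁) v.2.1) *
        F₂ (d₂, φ ((ψ d₀ v.1).2, d₂) v.2.2) * F₀ d₀ := by fun_prop
    rw [← lintegral_map hm hg, hgmap, lintegral_prod _ (by fun_prop)]
    refine lintegral_congr fun u => ?_
    simp only
    rw [lintegral_mul_const _ (by fun_prop)]
    congr 1
    exact lintegral_prod_mul (f := fun v => F₁ (d₁, φ ((ψ d₀ u).1, d₁) v))
      (g := fun v => F₂ (d₂, φ ((ψ d₀ u).2, d₂) v)) (by fun_prop) (by fun_prop)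
  rw [lintegral_prod _ (by fun_prop)]
  calc _ = ∫⁻ d₁, ∫⁻ d₂, ∫⁻ p, a d₁ p * b d₂ p * F₀ p.1 ∂(γ₀.prod volume) ∂γ₂ ∂γ₁ := by
        refine lintegral_congr fun d₁ => ?_
        rw [lintegral_prod _ (by fun_prop)]
        refine lintegral_congr fun d₂ => ?_
        rw [lintegral_prod _ (by fun_prop), lintegral_prod _ (by fun_prop)]
        exact lintegral_congr fun d₀ => hinner d₁ d₂ d₀
    _ = ∫⁻ d₁, ∫⁻ p, a d₁ p * ((∫⁻ d₂, b d₂ p ∂γ₂) * F₀ p.1) ∂(γ₀.prod volume) ∂γ₁ := by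
        refine lintegral_congr fun d₁ => ?_
        rw [lintegral_lintegral_swap (by fun_prop)]
        refine lintegral_congr fun p => ?_
        simp_rw [mul_assoc]
        rw [lintegral_const_mul _ (by fun_prop), lintegral_mul_const _ (by fun_prop)]
    _ = _ := by
        have hbi : Measurable fun p => ∫⁻ d₂, b d₂ p ∂γ₂ :=
          Measurable.lintegral_prod_left' (f := Function.uncurry b) hbm
        rw [lintegral_lintegral_swap (by fun_prop)]
        refine lintegral_congr fun p => ?_
        rw [lintegral_mul_const _ (by fun_prop), mul_assoc]

end Representation

/-! ### Compactified Euclidean space, exponential tilts and their bounded truncations. -/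

section Truncation

open scoped NNReal ENNReal BoundedContinuousFunction unitInterval

/-- Clamping an extended real to `[-R, R]`. -/
def clampReal (R : ℝ) (x : EReal) : ℝ := (max (-R : EReal) (min (R : EReal) x)).toReal

theorem continuous_clampReal (R : ℝ) : Continuous (clampReal R) := by
  refine EReal.continuousOn_toReal.comp_continuous (by fun_prop) fun x => ?_
  have h1 : max (-R : EReal) (min (R : EReal) x) ≠ ⊥ := by
    refine ne_of_gt (lt_of_lt_of_le ?_ (le_max_left _ _))
    rw [← EReal.coe_neg]; exact EReal.bot_lt_coe _
  have h2 : max (-R : EReal) (min (R : EReal) x) ≠ ⊤ := by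
    refine ne_of_lt (max_lt ?_ (lt_of_le_of_lt (min_le_left _ _) (EReal.coe_lt_top _)))
    rw [← EReal.coe_neg]; exact EReal.coe_lt_top _
  simp [h1, h2]

theorem clampReal_coe (R x : ℝ) : clampReal R x = max (-R) (min R x) := by
  have hmono : Monotone ((↑) : ℝ → EReal) := EReal.coe_strictMono.monotone
  rw [clampReal, ← EReal.coe_neg, ← hmono.map_min, ← hmono.map_max, EReal.toReal_coe]

variable {m : ℕ}

/-- Coordinatewise embedding of Euclidean space into a compact space. -/
def embEReal (d : EuclideanSpace ℝ (Fin m)) : Fin m → EReal := fun i => (d i : EReal)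

theorem continuous_embEReal : Continuous (embEReal (m := m)) :=
  continuous_pi fun i => continuous_coe_real_ereal.comp (by fun_prop)

/-- The exponential tilt `exp (h'd)`. -/
def tilt (h : EuclideanSpace ℝ (Fin m)) (d : Fin m → EReal) : ℝ≥0∞ :=
  ENNReal.ofReal (Real.exp (∑ i, h i * (d i).toReal))

/-- The exponential tilt with clamped coordinates. -/
def tiltTrunc (R : ℝ) (h : EuclideanSpace ℝ (Fin m)) (d : Fin m → EReal) : ℝ≥0 :=
  (Real.exp (∑ i, h i * clampReal R (d i))).toNNReal

/-- The envelope `exp (C ∑ |dᵢ|)`. -/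
def expEnvelope (C : ℝ) (d : Fin m → EReal) : ℝ≥0∞ :=
  ENNReal.ofReal (Real.exp (C * ∑ i, |(d i).toReal|))

@[fun_prop] theorem measurable_tilt (h : EuclideanSpace ℝ (Fin m)) : Measurable (tilt h) := by
  unfold tilt
  have : ∀ i, Measurable fun d : Fin m → EReal => (d i).toReal := fun i =>
    measurable_ereal_toReal.comp (measurable_pi_apply i)
  fun_prop

@[fun_prop] theorem measurable_expEnvelope (C : ℝ) : Measurable (expEnvelope (m := m) C) := by
  unfold expEnvelope
  have : ∀ i, Measurable fun d : Fin m → EReal => (d i).toReal := fun i =>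
    measurable_ereal_toReal.comp (measurable_pi_apply i)
  fun_prop

theorem continuous_tiltTrunc (R : ℝ) (h : EuclideanSpace ℝ (Fin m)) :
    Continuous (tiltTrunc R h) := by
  unfold tiltTrunc
  have : ∀ i, Continuous fun d : Fin m → EReal => clampReal R (d i) := fun i =>
    (continuous_clampReal R).comp (continuous_apply i)
  fun_prop

theorem tilt_embEReal (h d : EuclideanSpace ℝ (Fin m)) :
    tilt h (embEReal d) = ENNReal.ofReal (Real.exp (inner ℝ h d)) := by
  simp only [tilt, embEReal, EReal.toReal_coe, PiLp.inner_apply]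
  simp [mul_comm]

theorem exp_sum_le_envelope {h x y : Fin m → ℝ} {C : ℝ} (hC : ∑ i, |h i| ≤ C)
    (hxy : ∀ i, |x i| ≤ |y i|) :
    Real.exp (∑ i, h i * x i) ≤ Real.exp (C * ∑ i, |y i|) := by
  apply Real.exp_le_exp.2
  calc ∑ i, h i * x i ≤ ∑ i, |h i| * ∑ j, |y j| := by
        refine Finset.sum_le_sum fun i _ => ?_
        calc h i * x i ≤ |h i * x i| := le_abs_self _
          _ = |h i| * |x i| := abs_mul _ _
          _ ≤ |h i| * |y i| := mul_le_mul_of_nonneg_left (hxy i) (abs_nonneg _)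
          _ ≤ |h i| * ∑ j, |y j| := by
            gcongr
            exact Finset.single_le_sum (f := fun j => |y j|) (fun j _ => abs_nonneg _)
              (Finset.mem_univ i)
    _ = (∑ i, |h i|) * ∑ j, |y j| := by rw [Finset.sum_mul]
    _ ≤ C * ∑ j, |y j| := by gcongr

theorem abs_clamp_le {R : ℝ} (hR : 0 ≤ R) (x : ℝ) : |max (-R) (min R x)| ≤ |x| := by
  rw [abs_le]
  constructor
  · rcases le_total 0 x with h | h
    · have : 0 ≤ max (-R) (min R x) := le_max_of_le_right (le_min hR h)
      linarith [abs_nonneg x]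
    · rw [abs_of_nonpos h, neg_neg]
      exact le_max_of_le_right (le_min (h.trans hR) le_rfl)
  · exact max_le (by linarith [abs_nonneg x]) ((min_le_right _ _).trans (le_abs_self x))

theorem clamp_eq {R x : ℝ} (h : |x| ≤ R) : max (-R) (min R x) = x := by
  rw [abs_le] at h
  rw [min_eq_right h.2, max_eq_right h.1]

/-- The two exponents can differ only where some `|z j|` exceeds `R`; there `R ≤ ∑ |z i|`, so
raising the rate of the envelope by one pays for the factor `exp (-R)`. This is the origin of the `+
1` in `envelopeExponent`. -/
theorem exp_sum_le_add_envelope (h : Fin m → ℝ) {x x' z : Fin m → ℝ} {R : ℝ}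
    (hx : ∀ i, |x i| ≤ |z i|) (heq : (∀ i, |z i| ≤ R) → x = x') :
    Real.exp (∑ i, h i * x i) ≤ Real.exp (∑ i, h i * x' i) +
      Real.exp (-R) * Real.exp ((∑ i, |h i| + 1) * ∑ i, |z i|) := by
  by_cases hz : ∀ i, |z i| ≤ R
  · rw [heq hz]
    have := mul_pos (Real.exp_pos (-R)) (Real.exp_pos ((∑ i, |h i| + 1) * ∑ i, |z i|))
    linarith
  · push Not at hz
    obtain ⟨j, hj⟩ := hz
    have h1 := exp_sum_le_envelope (h := h) le_rfl hx
    have h2 : R ≤ ∑ i, |z i| := hj.le.trans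
      (Finset.single_le_sum (f := fun j => |z j|) (fun j _ => abs_nonneg _) (Finset.mem_univ j))
    have h3 : Real.exp ((∑ i, |h i|) * ∑ i, |z i|) ≤
        Real.exp (-R) * Real.exp ((∑ i, |h i| + 1) * ∑ i, |z i|) := by
      rw [← Real.exp_add]
      apply Real.exp_le_exp.2
      nlinarith
    have := Real.exp_pos (∑ i, h i * x' i)
    linarith

/-- The exponent of the envelope dominating the tilt by `h`. -/
def envelopeExponent (h : EuclideanSpace ℝ (Fin m)) : ℝ := ∑ i, |h i| + 1

theorem tilt_le_envelope (h d : EuclideanSpace ℝ (Fin m)) :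
    tilt h (embEReal d) ≤ expEnvelope (envelopeExponent h) (embEReal d) := by
  simp only [tilt, expEnvelope, embEReal, EReal.toReal_coe]
  exact ENNReal.ofReal_le_ofReal (exp_sum_le_envelope (by simp [envelopeExponent]) fun _ => le_rfl)

theorem tiltTrunc_le_envelope {R : ℝ} (hR : 0 ≤ R) (h d : EuclideanSpace ℝ (Fin m)) :
    (tiltTrunc R h (embEReal d) : ℝ≥0∞) ≤ expEnvelope (envelopeExponent h) (embEReal d) := by
  simp only [tiltTrunc, expEnvelope, embEReal, EReal.toReal_coe, clampReal_coe]
  exact ENNReal.ofReal_le_ofReal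
    (exp_sum_le_envelope (by simp [envelopeExponent]) fun _ => abs_clamp_le hR _)

theorem tilt_le_tiltTrunc_add (R : ℝ) (h d : EuclideanSpace ℝ (Fin m)) :
    tilt h (embEReal d) ≤ tiltTrunc R h (embEReal d) +
      ENNReal.ofReal (Real.exp (-R)) * expEnvelope (envelopeExponent h) (embEReal d) := by
  simp only [tiltTrunc, expEnvelope, tilt, embEReal, EReal.toReal_coe, clampReal_coe,
    envelopeExponent]
  rw [← ENNReal.ofReal_mul (Real.exp_nonneg _)]
  change _ ≤ ENNReal.ofReal _ + _
  rw [← ENNReal.ofReal_add (Real.exp_nonneg _) (by positivity)]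
  refine ENNReal.ofReal_le_ofReal (exp_sum_le_add_envelope _ (z := d) (fun _ => le_rfl) fun hz => ?_)
  funext i
  exact (clamp_eq (hz i)).symm

theorem tiltTrunc_le_tilt_add {R : ℝ} (hR : 0 ≤ R) (h d : EuclideanSpace ℝ (Fin m)) :
    (tiltTrunc R h (embEReal d) : ℝ≥0∞) ≤ tilt h (embEReal d) +
      ENNReal.ofReal (Real.exp (-R)) * expEnvelope (envelopeExponent h) (embEReal d) := by
  simp only [tiltTrunc, expEnvelope, tilt, embEReal, EReal.toReal_coe, clampReal_coe,
    envelopeExponent]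
  rw [← ENNReal.ofReal_mul (Real.exp_nonneg _), ← ENNReal.ofReal_add (Real.exp_nonneg _)
    (by positivity)]
  refine ENNReal.ofReal_le_ofReal (exp_sum_le_add_envelope _ (z := d) (fun _ => abs_clamp_le hR _)
    fun hz => ?_)
  funext i
  exact clamp_eq (hz i)

/-- The envelope is dominated by finitely many exponential tilts. -/
theorem expEnvelope_le_sum_tilt (C : ℝ) (d : EuclideanSpace ℝ (Fin m)) :
    expEnvelope C (embEReal d) ≤ ∑ τ : Fin m → Bool,
      tilt (WithLp.toLp 2 fun i => if τ i then C else -C) (embEReal d) := by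
  simp only [expEnvelope, embEReal, EReal.toReal_coe, tilt]
  rw [← ENNReal.ofReal_sum_of_nonneg fun _ _ => Real.exp_nonneg _]
  refine ENNReal.ofReal_le_ofReal ?_
  -- The summand whose sign pattern is that of `d` alone equals the envelope.
  refine le_trans ?_ (Finset.single_le_sum (f := fun τ : Fin m → Bool => Real.exp
    (∑ i, (if τ i then C else -C) * d i)) (fun τ _ => Real.exp_nonneg _)
    (Finset.mem_univ fun i => decide (0 ≤ d i)))
  apply Real.exp_le_exp.2
  rw [Finset.mul_sum]
  refine Finset.sum_le_sum fun i _ => ?_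
  by_cases hi : 0 ≤ d i
  · simp [hi, abs_of_nonneg hi]
  · simp [hi, abs_of_neg (not_le.1 hi)]

end Truncation

/-! ### The tilted mean as a functional of the law of the random pair, and its stability in the
weight. -/

section TiltedFunctional

open scoped NNReal ENNReal BoundedContinuousFunction unitInterval

variable {K S : Type*} [MeasurableSpace K] [MeasurableSpace S]

/-- The mean of `w d₀ · ∫ f₁(s) w(d) κ₁(dd, ds) · ∫ f₂(s) w(d) κ₂(dd, ds)`. -/
def tiltedMean (G : Measure (LawSpace K S)) (w : K → ℝ≥0∞) (f₁ f₂ : S → ℝ≥0∞) : ℝ≥0∞ :=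
  ∫⁻ x, (∫⁻ y, f₁ y.2 * w y.1 ∂(x.1 : Measure (K × S))) *
    (∫⁻ y, f₂ y.2 * w y.1 ∂(x.2.1 : Measure (K × S))) * w x.2.2 ∂G

theorem lintegral_mul_le_of_envelope {κ : Measure (K × S)} {w W : K → ℝ≥0∞} {f : S → ℝ≥0∞}
    {M B : ℝ≥0∞} (hW : Measurable W) (hf : ∀ s, f s ≤ M)
    (hw : ∀ᵐ d ∂(κ.map Prod.fst), w d ≤ W d) (hB : ∫⁻ d, W d ∂(κ.map Prod.fst) ≤ B) :
    ∫⁻ y, f y.2 * w y.1 ∂κ ≤ M * B := by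
  calc ∫⁻ y, f y.2 * w y.1 ∂κ ≤ ∫⁻ y, M * W y.1 ∂κ := by
        refine lintegral_mono_ae ?_
        filter_upwards [ae_of_ae_map measurable_fst.aemeasurable hw] with y hy
        exact mul_le_mul' (hf _) hy
    _ = M * ∫⁻ d, W d ∂(κ.map Prod.fst) := by
        rw [lintegral_const_mul _ (by fun_prop), lintegral_map hW measurable_fst]
    _ ≤ M * B := by gcongr

theorem lintegral_mul_le_add_of_envelope {κ : Measure (K × S)} {w w' W : K → ℝ≥0∞} {f : S → ℝ≥0∞}
    {M B ε : ℝ≥0∞} (hW : Measurable W) (hf : ∀ s, f s ≤ M)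
    (hw : ∀ᵐ d ∂(κ.map Prod.fst), w d ≤ w' d + ε * W d) (hB : ∫⁻ d, W d ∂(κ.map Prod.fst) ≤ B) :
    ∫⁻ y, f y.2 * w y.1 ∂κ ≤ ∫⁻ y, f y.2 * w' y.1 ∂κ + ε * (M * B) := by
  calc ∫⁻ y, f y.2 * w y.1 ∂κ ≤ ∫⁻ y, (f y.2 * w' y.1 + ε * M * W y.1) ∂κ := by
        refine lintegral_mono_ae ?_
        filter_upwards [ae_of_ae_map measurable_fst.aemeasurable hw] with y hy
        calc f y.2 * w y.1 ≤ f y.2 * (w' y.1 + ε * W y.1) := by gcongr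
          _ = f y.2 * w' y.1 + ε * (f y.2) * W y.1 := by ring
          _ ≤ f y.2 * w' y.1 + ε * M * W y.1 := by gcongr; exact hf _
    _ = ∫⁻ y, f y.2 * w' y.1 ∂κ + ε * M * ∫⁻ d, W d ∂(κ.map Prod.fst) := by
        rw [lintegral_add_right _ (by fun_prop), lintegral_const_mul _ (by fun_prop),
          lintegral_map hW measurable_fst]
    _ ≤ _ := by rw [mul_assoc]; gcongr

/-- The weight is replaced in one factor at a time. Each of the three replacements costs at most `ε
* M ^ 2 * B ^ 3`, since the other factors are controlled by the envelope. The bound sees `G` only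
through the marginals `c₁`, `c₂`, `c₀`, which makes it uniform along a sequence. -/
theorem tiltedMean_le_add {G : Measure (LawSpace K S)} [IsProbabilityMeasure G]
    {c₁ c₂ c₀ : Measure K} {w w' W : K → ℝ≥0∞}
    {f₁ f₂ : S → ℝ≥0∞} {M B ε : ℝ≥0∞} (hW : Measurable W)
    (hf₁ : ∀ s, f₁ s ≤ M) (hf₂ : ∀ s, f₂ s ≤ M)
    (h₁ : ∀ᵐ x ∂G, (x.1 : Measure (K × S)).map Prod.fst = c₁)
    (h₂ : ∀ᵐ x ∂G, (x.2.1 : Measure (K × S)).map Prod.fst = c₂)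
    (h₀ : G.map (fun x => x.2.2) = c₀)
    (hw : ∀ c ∈ [c₁, c₂, c₀], ∀ᵐ d ∂c, w d ≤ W d ∧ w' d ≤ W d ∧ w d ≤ w' d + ε * W d)
    (hB : ∀ c ∈ [c₁, c₂, c₀], ∫⁻ d, W d ∂c ≤ B) :
    tiltedMean G w f₁ f₂ ≤ tiltedMean G w' f₁ f₂ + 3 * ε * M ^ 2 * B ^ 3 := by
  have hm : Measurable fun x : LawSpace K S => x.2.2 := by fun_prop
  have hw₁ := hw c₁ (by simp)
  have hw₂ := hw c₂ (by simp)
  have hw₀ := hw c₀ (by simp)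
  have hB₁ := hB c₁ (by simp)
  have hB₂ := hB c₂ (by simp)
  have hB₀ := hB c₀ (by simp)
  rw [← h₀] at hw₀ hB₀
  rw [lintegral_map hW hm] at hB₀
  have hw₀' := ae_of_ae_map hm.aemeasurable hw₀
  calc tiltedMean G w f₁ f₂
      ≤ ∫⁻ x, ((∫⁻ y, f₁ y.2 * w' y.1 ∂(x.1 : Measure (K × S))) *
        (∫⁻ y, f₂ y.2 * w' y.1 ∂(x.2.1 : Measure (K × S))) * w' x.2.2 +
          3 * ε * M ^ 2 * B ^ 2 * W x.2.2) ∂G := by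
        refine lintegral_mono_ae ?_
        filter_upwards [h₁, h₂, hw₀'] with x hx₁ hx₂ hx₀
        rw [← hx₁] at hw₁ hB₁
        rw [← hx₂] at hw₂ hB₂
        have a1 := lintegral_mul_le_of_envelope (w := w') hW hf₁ (hw₁.mono fun _ h => h.2.1) hB₁
        have a1' := lintegral_mul_le_of_envelope (w := w) hW hf₁ (hw₁.mono fun _ h => h.1) hB₁
        have a2 := lintegral_mul_le_add_of_envelope hW hf₁ (hw₁.mono fun _ h => h.2.2) hB₁
        have b1 := lintegral_mul_le_of_envelope (w := w) hW hf₂ (hw₂.mono fun _ h => h.1) hB₂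
        have b2 := lintegral_mul_le_add_of_envelope hW hf₂ (hw₂.mono fun _ h => h.2.2) hB₂
        set X₁ := ∫⁻ y, f₁ y.2 * w y.1 ∂(x.1 : Measure (K × S))
        set X₁' := ∫⁻ y, f₁ y.2 * w' y.1 ∂(x.1 : Measure (K × S))
        set X₂ := ∫⁻ y, f₂ y.2 * w y.1 ∂(x.2.1 : Measure (K × S))
        set X₂' := ∫⁻ y, f₂ y.2 * w' y.1 ∂(x.2.1 : Measure (K × S))
        calc X₁ * X₂ * w x.2.2 ≤ X₁ * X₂ * (w' x.2.2 + ε * W x.2.2) := by gcongr; exact hx₀.2.2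
          _ = X₁ * X₂ * w' x.2.2 + X₁ * X₂ * ε * W x.2.2 := by ring
          _ ≤ (X₁' + ε * (M * B)) * X₂ * w' x.2.2 + (M * B) * (M * B) * ε * W x.2.2 := by
            gcongr
          _ = X₁' * X₂ * w' x.2.2 + ε * (M * B) * X₂ * w' x.2.2 +
              (M * B) * (M * B) * ε * W x.2.2 := by ring
          _ ≤ X₁' * (X₂' + ε * (M * B)) * w' x.2.2 + ε * (M * B) * (M * B) * W x.2.2 +
              (M * B) * (M * B) * ε * W x.2.2 := by
            gcongr
            exact hx₀.2.1
          _ = X₁' * X₂' * w' x.2.2 + X₁' * (ε * (M * B)) * w' x.2.2 +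
              ε * (M * B) * (M * B) * W x.2.2 + (M * B) * (M * B) * ε * W x.2.2 := by ring
          _ ≤ X₁' * X₂' * w' x.2.2 + (M * B) * (ε * (M * B)) * W x.2.2 +
              ε * (M * B) * (M * B) * W x.2.2 + (M * B) * (M * B) * ε * W x.2.2 := by
            gcongr
            exact hx₀.2.1
          _ = _ := by ring
    _ = tiltedMean G w' f₁ f₂ + 3 * ε * M ^ 2 * B ^ 2 * ∫⁻ x, W x.2.2 ∂G := by
        rw [lintegral_add_right _ (by fun_prop), lintegral_const_mul _ (by fun_prop)]
        rfl
    _ ≤ tiltedMean G w' f₁ f₂ + 3 * ε * M ^ 2 * B ^ 2 * B := by gcongr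
    _ = _ := by ring

end TiltedFunctional

/-! ### Passage to the limit by compactness, and sampling from the limit. -/

section LimitSampler

open scoped NNReal ENNReal unitInterval

section Continuity

variable {K S : Type*} [TopologicalSpace K] [CompactSpace K] [TopologicalSpace.MetrizableSpace K]
  [MeasurableSpace K] [BorelSpace K]
  [SecondCountableTopology K]
  [TopologicalSpace S] [CompactSpace S] [TopologicalSpace.MetrizableSpace S]
  [MeasurableSpace S] [BorelSpace S] [SecondCountableTopology S]

instance borelSpace_lawSpace : BorelSpace (LawSpace K S) := Prod.borelSpace

/-- For a continuous weight on a compact space the integrals over `x.1` and `x.2.1` are finite and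
weakly continuous in these laws, so the tilted mean is the integral of a continuous function. -/
theorem tendsto_tiltedMean_of_continuous {ι : Type*} {F : Filter ι}
    {G : ι → ProbabilityMeasure (LawSpace K S)} {G₀ : ProbabilityMeasure (LawSpace K S)}
    (hG : Tendsto G F (𝓝 G₀)) (w : C(K, ℝ≥0)) (f₁ f₂ : C(S, ℝ≥0)) :
    Tendsto (fun n => tiltedMean (G n : Measure (LawSpace K S)) (fun d => (w d : ℝ≥0∞))
      (fun s => (f₁ s : ℝ≥0∞)) fun s => (f₂ s : ℝ≥0∞)) F
      (𝓝 (tiltedMean (G₀ : Measure (LawSpace K S)) (fun d => (w d : ℝ≥0∞))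
        (fun s => (f₁ s : ℝ≥0∞)) fun s => (f₂ s : ℝ≥0∞))) := by
  have hne (f : C(S, ℝ≥0)) (κ : ProbabilityMeasure (K × S)) :
      ∫⁻ y, (f y.2 * w y.1 : ℝ≥0) ∂(κ : Measure (K × S)) ≠ ∞ :=
    (BoundedContinuousFunction.lintegral_lt_top_of_nnreal (κ : Measure (K × S))
      (BoundedContinuousFunction.mkOfCompact
        (⟨fun y => f y.2 * w y.1, by fun_prop⟩ : C(K × S, ℝ≥0)))).ne
  have hc (f : C(S, ℝ≥0)) : Continuous fun κ : ProbabilityMeasure (K × S) =>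
      (∫⁻ y, (f y.2 * w y.1 : ℝ≥0) ∂(κ : Measure (K × S))).toNNReal :=
    ENNReal.continuousOn_toNNReal.comp_continuous
      (ProbabilityMeasure.continuous_lintegral_continuousMap
        (⟨fun y => f y.2 * w y.1, by fun_prop⟩ : C(K × S, ℝ≥0))) (hne f)
  have h1 := hc f₁
  have h2 := hc f₂
  let Ψ : C(LawSpace K S, ℝ≥0) :=
    ⟨fun x => (∫⁻ y, (f₁ y.2 * w y.1 : ℝ≥0) ∂(x.1 : Measure (K × S))).toNNReal *
      (∫⁻ y, (f₂ y.2 * w y.1 : ℝ≥0) ∂(x.2.1 : Measure (K × S))).toNNReal * w x.2.2,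
      ((h1.comp continuous_fst).mul (h2.comp (continuous_fst.comp continuous_snd))).mul
        (by fun_prop)⟩
  have hΨ (G : ProbabilityMeasure (LawSpace K S)) :
      tiltedMean (G : Measure (LawSpace K S)) (fun d => (w d : ℝ≥0∞))
      (fun s => (f₁ s : ℝ≥0∞)) (fun s => (f₂ s : ℝ≥0∞)) = ∫⁻ x, Ψ x ∂(G : Measure (LawSpace K S)) := by
    refine lintegral_congr fun x => ?_
    change _ = (((_ * _ : ℝ≥0) * w x.2.2 : ℝ≥0) : ℝ≥0∞)
    rw [ENNReal.coe_mul, ENNReal.coe_mul, ENNReal.coe_toNNReal (hne f₁ x.1),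
      ENNReal.coe_toNNReal (hne f₂ x.2.1)]
    simp only [ENNReal.coe_mul]
  simp_rw [hΨ]
  exact ((ProbabilityMeasure.continuous_lintegral_continuousMap Ψ).tendsto _).comp hG

end Continuity

variable {m : ℕ}

/-- Weak convergence together with boundedness of all exponential moments. -/
structure TiltConvergence (c : ℕ → ProbabilityMeasure (EuclideanSpace ℝ (Fin m)))
    (γ : ProbabilityMeasure (EuclideanSpace ℝ (Fin m))) : Prop where
  tendsto : Tendsto c atTop (𝓝 γ)
  bound : ∀ h : EuclideanSpace ℝ (Fin m), ∃ B : ℝ≥0∞, B ≠ ∞ ∧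
    (∀ᶠ n in atTop, ∫⁻ d, ENNReal.ofReal (Real.exp (inner ℝ h d))
      ∂(c n : Measure (EuclideanSpace ℝ (Fin m))) ≤ B) ∧
    ∫⁻ d, ENNReal.ofReal (Real.exp (inner ℝ h d)) ∂(γ : Measure (EuclideanSpace ℝ (Fin m))) ≤ B

theorem lintegral_map_expEnvelope_le (ν : Measure (EuclideanSpace ℝ (Fin m))) (C : ℝ) :
    ∫⁻ d, expEnvelope C d ∂(ν.map embEReal) ≤ ∑ τ : Fin m → Bool,
      ∫⁻ d, ENNReal.ofReal (Real.exp
        (inner ℝ (WithLp.toLp 2 fun i => if τ i then C else -C) d)) ∂ν := by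
  rw [lintegral_map (by fun_prop) continuous_embEReal.measurable,
    ← lintegral_finsetSum _ (fun _ _ => by fun_prop)]
  refine lintegral_mono fun d => (expEnvelope_le_sum_tilt C d).trans_eq ?_
  simp_rw [tilt_embEReal]

/-- The envelope is at most the sum of the `2 ^ m` tilts with coordinates `±C`, each of which has
bounded mean. -/
theorem TiltConvergence.envelope_bound {c : ℕ → ProbabilityMeasure (EuclideanSpace ℝ (Fin m))}
    {γ : ProbabilityMeasure (EuclideanSpace ℝ (Fin m))} (hc : TiltConvergence c γ) (C : ℝ) :
    ∃ B : ℝ≥0∞, B ≠ ∞ ∧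
    (∀ᶠ n in atTop, ∫⁻ d, expEnvelope C d ∂(Measure.map embEReal
      (c n : Measure (EuclideanSpace ℝ (Fin m)))) ≤ B) ∧
    ∫⁻ d, expEnvelope C d
      ∂(Measure.map embEReal (γ : Measure (EuclideanSpace ℝ (Fin m)))) ≤ B := by
  choose B hB hn hγ using fun τ : Fin m → Bool =>
    hc.bound (WithLp.toLp 2 fun i => if τ i then C else -C)
  refine ⟨∑ τ, B τ, by simp [hB], ?_, ?_⟩
  · filter_upwards [eventually_all.2 hn] with n h
    exact (lintegral_map_expEnvelope_le _ C).trans (Finset.sum_le_sum fun τ _ => h τ)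
  · exact (lintegral_map_expEnvelope_le _ C).trans (Finset.sum_le_sum fun τ _ => hγ τ)

theorem ae_map_embEReal (ν : Measure (EuclideanSpace ℝ (Fin m))) {q : (Fin m → EReal) → Prop}
    (hq : MeasurableSet {d | q d}) (h : ∀ d, q (embEReal d)) : ∀ᵐ d ∂(ν.map embEReal), q d := by
  rw [ae_map_iff continuous_embEReal.measurable.aemeasurable hq]
  exact ae_of_all _ h

/-- If random pairs of laws have exponential tilts with converging means, there is a limiting
random pair of laws which has the limits as exponentially tilted means. -/
theorem exists_limit_tiltedMean
    {c₁ c₂ c₀ : ℕ → ProbabilityMeasure (EuclideanSpace ℝ (Fin m))}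
    {γ₁ γ₂ γ₀ : ProbabilityMeasure (EuclideanSpace ℝ (Fin m))}
    (hc₁ : TiltConvergence c₁ γ₁) (hc₂ : TiltConvergence c₂ γ₂) (hc₀ : TiltConvergence c₀ γ₀)
    (G : ℕ → ProbabilityMeasure (LawSpace (Fin m → EReal) EReal))
    (h₁ : ∀ n, ∀ᵐ x ∂(G n : Measure (LawSpace (Fin m → EReal) EReal)),
      (x.1 : Measure ((Fin m → EReal) × EReal)).map Prod.fst = Measure.map embEReal (c₁ n))
    (h₂ : ∀ n, ∀ᵐ x ∂(G n : Measure (LawSpace (Fin m → EReal) EReal)),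
      (x.2.1 : Measure ((Fin m → EReal) × EReal)).map Prod.fst = Measure.map embEReal (c₂ n))
    (h₀ : ∀ n, (G n : Measure (LawSpace (Fin m → EReal) EReal)).map (fun x => x.2.2) =
      Measure.map embEReal (c₀ n))
    (l : EuclideanSpace ℝ (Fin m) → C(EReal, ℝ≥0) → C(EReal, ℝ≥0) → ℝ≥0∞)
    (hl : ∀ h f₁ f₂, Tendsto (fun n => tiltedMean (G n : Measure (LawSpace (Fin m → EReal) EReal))
      (tilt h) (fun s => (f₁ s : ℝ≥0∞)) fun s => (f₂ s : ℝ≥0∞)) atTop (𝓝 (l h f₁ f₂))) :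
    ∃ G₀ : ProbabilityMeasure (LawSpace (Fin m → EReal) EReal),
      (∀ᵐ x ∂(G₀ : Measure (LawSpace (Fin m → EReal) EReal)),
        (x.1 : Measure ((Fin m → EReal) × EReal)).map Prod.fst = Measure.map embEReal γ₁) ∧
      (∀ᵐ x ∂(G₀ : Measure (LawSpace (Fin m → EReal) EReal)),
        (x.2.1 : Measure ((Fin m → EReal) × EReal)).map Prod.fst = Measure.map embEReal γ₂) ∧
      (G₀ : Measure (LawSpace (Fin m → EReal) EReal)).map (fun x => x.2.2) =
        Measure.map embEReal γ₀ ∧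
      ∀ h f₁ f₂, tiltedMean (G₀ : Measure (LawSpace (Fin m → EReal) EReal))
        (tilt h) (fun s => (f₁ s : ℝ≥0∞)) (fun s => (f₂ s : ℝ≥0∞)) = l h f₁ f₂ := by
  -- One limit point is fixed before `h`, `f₁` and `f₂` are chosen; this is why a single `G₀` serves
  -- all of them.
  obtain ⟨G₀, hG⟩ := exists_tendsto_hyperfilter G
  have hF : (hyperfilter ℕ : Filter ℕ) ≤ atTop := Nat.hyperfilter_le_atTop
  let pushE (c : ProbabilityMeasure (EuclideanSpace ℝ (Fin m))) :
      ProbabilityMeasure (Fin m → EReal) := c.map continuous_embEReal.measurable.aemeasurable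
  have hpush : Continuous pushE := ProbabilityMeasure.continuous_map continuous_embEReal
  let marg (κ : ProbabilityMeasure ((Fin m → EReal) × EReal)) :
      ProbabilityMeasure (Fin m → EReal) := κ.map measurable_fst.aemeasurable
  have hmarg : Continuous marg := ProbabilityMeasure.continuous_map continuous_fst
  have hpush_lim {c : ℕ → ProbabilityMeasure (EuclideanSpace ℝ (Fin m))} {γ}
      (hc : TiltConvergence c γ) :
      Tendsto (fun n => pushE (c n)) (hyperfilter ℕ : Filter ℕ) (𝓝 (pushE γ)) :=
    (hpush.tendsto _).comp (hc.tendsto.mono_left hF)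
  have hG₁ : ∀ᵐ x ∂(G₀ : Measure (LawSpace (Fin m → EReal) EReal)),
      (x.1 : Measure ((Fin m → EReal) × EReal)).map Prod.fst = Measure.map embEReal γ₁ := by
    have := ae_eq_of_tendsto_of_ae_eq hG (g := fun x => marg x.1) (by fun_prop)
      (hpush_lim hc₁) (fun n => by
        filter_upwards [h₁ n] with x hx
        exact ProbabilityMeasure.toMeasure_injective hx)
    filter_upwards [this] with x hx
    exact congrArg ProbabilityMeasure.toMeasure hx
  have hG₂ : ∀ᵐ x ∂(G₀ : Measure (LawSpace (Fin m → EReal) EReal)),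
      (x.2.1 : Measure ((Fin m → EReal) × EReal)).map Prod.fst = Measure.map embEReal γ₂ := by
    have := ae_eq_of_tendsto_of_ae_eq hG (g := fun x => marg x.2.1) (by fun_prop)
      (hpush_lim hc₂) (fun n => by
        filter_upwards [h₂ n] with x hx
        exact ProbabilityMeasure.toMeasure_injective hx)
    filter_upwards [this] with x hx
    exact congrArg ProbabilityMeasure.toMeasure hx
  have hG₀ : (G₀ : Measure (LawSpace (Fin m → EReal) EReal)).map (fun x => x.2.2) =
      Measure.map embEReal γ₀ := by
    have hcont : Continuous fun x : LawSpace (Fin m → EReal) EReal => x.2.2 := by fun_prop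
    have e1 := ProbabilityMeasure.tendsto_map_of_tendsto_of_continuous _ _ hG hcont
    have e2 : (fun n => (G n).map hcont.measurable.aemeasurable) = fun n => pushE (c₀ n) :=
      funext fun n => ProbabilityMeasure.toMeasure_injective (h₀ n)
    rw [e2] at e1
    exact congrArg ProbabilityMeasure.toMeasure (tendsto_nhds_unique e1 (hpush_lim hc₀))
  refine ⟨G₀, hG₁, hG₂, hG₀, fun h f₁ f₂ => ?_⟩
  obtain ⟨B₁, hB₁, hn₁, hγ₁⟩ := hc₁.envelope_bound (envelopeExponent h)
  obtain ⟨B₂, hB₂, hn₂, hγ₂⟩ := hc₂.envelope_bound (envelopeExponent h)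
  obtain ⟨B₀, hB₀, hn₀, hγ₀⟩ := hc₀.envelope_bound (envelopeExponent h)
  set B := B₁ + B₂ + B₀ with hB
  have hBt : B ≠ ∞ := by simp [hB, hB₁, hB₂, hB₀]
  have le₁ : B₁ ≤ B := by rw [hB, add_assoc]; exact le_self_add
  have le₂ : B₂ ≤ B := by rw [hB, add_comm B₁, add_assoc]; exact le_self_add
  have le₀ : B₀ ≤ B := by rw [hB, add_comm]; exact le_self_add
  -- A common bound of `f₁` and `f₂`, as a uniform distance from zero.
  let M : ℝ≥0 := max (nndist (0 : C(EReal, ℝ≥0)) f₁) (nndist (0 : C(EReal, ℝ≥0)) f₂)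
  have hle (f : C(EReal, ℝ≥0)) (s : EReal) : f s ≤ nndist (0 : C(EReal, ℝ≥0)) f := by
    have := ContinuousMap.dist_apply_le_dist (f := (0 : C(EReal, ℝ≥0))) (g := f) s
    rw [← NNReal.coe_le_coe, coe_nndist]
    refine le_trans (le_of_eq ?_) this
    rw [← coe_nndist, ContinuousMap.zero_apply, NNReal.nndist_zero_eq_val]
  have hM₁ (s : EReal) : (f₁ s : ℝ≥0∞) ≤ M :=
    ENNReal.coe_le_coe.2 ((hle f₁ s).trans (le_max_left _ _))
  have hM₂ (s : EReal) : (f₂ s : ℝ≥0∞) ≤ M :=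
    ENNReal.coe_le_coe.2 ((hle f₂ s).trans (le_max_right _ _))
  let w (R : ℕ) : C(Fin m → EReal, ℝ≥0) := ⟨tiltTrunc R h, continuous_tiltTrunc _ _⟩
  let ε (R : ℕ) : ℝ≥0∞ := ENNReal.ofReal (Real.exp (-(R : ℝ)))
  -- The error of `tiltedMean_le_add` when the tilt is replaced by its truncation at level `R`.
  let δ (R : ℕ) : ℝ≥0∞ := 3 * ε R * M ^ 2 * B ^ 3
  have hδ : Tendsto δ atTop (𝓝 0) := by
    have hε : Tendsto ε atTop (𝓝 0) := by
      rw [← ENNReal.ofReal_zero]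
      exact ENNReal.tendsto_ofReal (Real.tendsto_exp_neg_atTop_nhds_zero.comp
        tendsto_natCast_atTop_atTop)
    have hδε : δ = fun R => 3 * (M : ℝ≥0∞) ^ 2 * B ^ 3 * ε R := by
      funext R
      simp only [δ]
      ring
    have hC : 3 * (M : ℝ≥0∞) ^ 2 * B ^ 3 ≠ ∞ := by finiteness
    rw [hδε, ← mul_zero (3 * (M : ℝ≥0∞) ^ 2 * B ^ 3)]
    exact ENNReal.Tendsto.const_mul hε (Or.inr hC)
  have hae (ν : Measure (EuclideanSpace ℝ (Fin m))) (R : ℕ) : ∀ᵐ d ∂(ν.map embEReal),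
      (tilt h d ≤ expEnvelope (envelopeExponent h) d ∧
        (w R d : ℝ≥0∞) ≤ expEnvelope (envelopeExponent h) d ∧
        tilt h d ≤ w R d + ε R * expEnvelope (envelopeExponent h) d) ∧
      (w R d : ℝ≥0∞) ≤ tilt h d + ε R * expEnvelope (envelopeExponent h) d := by
    have hwm : Measurable fun d => (w R d : ℝ≥0∞) :=
      (w R).continuous.measurable.coe_nnreal_ennreal
    refine ae_map_embEReal ν ?_ fun d => ⟨⟨tilt_le_envelope h d,
      tiltTrunc_le_envelope (Nat.cast_nonneg R) h d, tilt_le_tiltTrunc_add _ h d⟩,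
      tiltTrunc_le_tilt_add (Nat.cast_nonneg R) h d⟩
    have hWm : Measurable (expEnvelope (m := m) (envelopeExponent h)) := by fun_prop
    exact ((measurableSet_le (measurable_tilt h) hWm).inter ((measurableSet_le hwm hWm).inter
      (measurableSet_le (measurable_tilt h) (hwm.add (hWm.const_mul _))))).inter
      (measurableSet_le hwm ((measurable_tilt h).add (hWm.const_mul _)))
  -- comparison of the tilted means with the truncated ones, in both directions
  have cmp (G' : ProbabilityMeasure (LawSpace (Fin m → EReal) EReal))
      (ν₁ ν₂ ν₀ : ProbabilityMeasure (EuclideanSpace ℝ (Fin m)))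
      (k₁ : ∀ᵐ x ∂(G' : Measure (LawSpace (Fin m → EReal) EReal)),
        (x.1 : Measure ((Fin m → EReal) × EReal)).map Prod.fst = Measure.map embEReal ν₁)
      (k₂ : ∀ᵐ x ∂(G' : Measure (LawSpace (Fin m → EReal) EReal)),
        (x.2.1 : Measure ((Fin m → EReal) × EReal)).map Prod.fst = Measure.map embEReal ν₂)
      (k₀ : (G' : Measure (LawSpace (Fin m → EReal) EReal)).map (fun x => x.2.2) =
        Measure.map embEReal ν₀)
      (b₁ : ∫⁻ d, expEnvelope (envelopeExponent h) d ∂(Measure.map embEReal (ν₁ : Measure (EuclideanSpace ℝ (Fin m)))) ≤ B₁)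
      (b₂ : ∫⁻ d, expEnvelope (envelopeExponent h) d ∂(Measure.map embEReal (ν₂ : Measure (EuclideanSpace ℝ (Fin m)))) ≤ B₂)
      (b₀ : ∫⁻ d, expEnvelope (envelopeExponent h) d ∂(Measure.map embEReal (ν₀ : Measure (EuclideanSpace ℝ (Fin m)))) ≤ B₀)
      (R : ℕ) :
      tiltedMean (G' : Measure (LawSpace (Fin m → EReal) EReal)) (tilt h)
        (fun s => (f₁ s : ℝ≥0∞)) (fun s => (f₂ s : ℝ≥0∞)) ≤
      tiltedMean (G' : Measure (LawSpace (Fin m → EReal) EReal)) (fun d => (w R d : ℝ≥0∞))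
        (fun s => (f₁ s : ℝ≥0∞)) (fun s => (f₂ s : ℝ≥0∞)) + δ R ∧
      tiltedMean (G' : Measure (LawSpace (Fin m → EReal) EReal)) (fun d => (w R d : ℝ≥0∞))
        (fun s => (f₁ s : ℝ≥0∞)) (fun s => (f₂ s : ℝ≥0∞)) ≤
      tiltedMean (G' : Measure (LawSpace (Fin m → EReal) EReal)) (tilt h)
        (fun s => (f₁ s : ℝ≥0∞)) (fun s => (f₂ s : ℝ≥0∞)) + δ R := by
    have hB' : ∀ c ∈ [Measure.map embEReal (ν₁ : Measure (EuclideanSpace ℝ (Fin m))),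
        Measure.map embEReal (ν₂ : Measure (EuclideanSpace ℝ (Fin m))),
        Measure.map embEReal (ν₀ : Measure (EuclideanSpace ℝ (Fin m)))],
        ∫⁻ d, expEnvelope (envelopeExponent h) d ∂c ≤ B := by
      simp only [List.mem_cons, List.not_mem_nil, or_false, forall_eq_or_imp, forall_eq]
      exact ⟨b₁.trans le₁, b₂.trans le₂, b₀.trans le₀⟩
    constructor
    · refine tiltedMean_le_add (by fun_prop) hM₁ hM₂ k₁ k₂ k₀ ?_ hB'
      simp only [List.mem_cons, List.not_mem_nil, or_false, forall_eq_or_imp, forall_eq]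
      exact ⟨(hae _ R).mono fun _ h => h.1, (hae _ R).mono fun _ h => h.1,
        (hae _ R).mono fun _ h => h.1⟩
    · refine tiltedMean_le_add (by fun_prop) hM₁ hM₂ k₁ k₂ k₀ ?_ hB'
      simp only [List.mem_cons, List.not_mem_nil, or_false, forall_eq_or_imp, forall_eq]
      exact ⟨(hae _ R).mono fun _ h => ⟨h.1.2.1, h.1.1, h.2⟩,
        (hae _ R).mono fun _ h => ⟨h.1.2.1, h.1.1, h.2⟩,
        (hae _ R).mono fun _ h => ⟨h.1.2.1, h.1.1, h.2⟩⟩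
  have hlim := (hl h f₁ f₂).mono_left hF
  have hev : ∀ᶠ n in (hyperfilter ℕ : Filter ℕ), _ ∧ _ ∧ _ :=
    ((hn₁.and (hn₂.and hn₀)).filter_mono hF)
  have lim₀ := cmp G₀ γ₁ γ₂ γ₀ hG₁ hG₂ hG₀ hγ₁ hγ₂ hγ₀
  have htr (R : ℕ) := tendsto_tiltedMean_of_continuous hG (w R) f₁ f₂
  -- In each direction the truncation costs `δ R` twice, along the sequence and at `G₀`; between the
  -- two, the continuous truncated functional passes to the limit. Then `R` tends to infinity.
  apply le_antisymm
  · refine ge_of_tendsto' (x := atTop) (f := fun R => l h f₁ f₂ + δ R + δ R) ?_ fun R => ?_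
    · simpa using (tendsto_const_nhds.add hδ).add hδ
    · refine (lim₀ R).1.trans ?_
      gcongr
      refine le_of_tendsto_of_tendsto (htr R) (hlim.add tendsto_const_nhds) ?_
      filter_upwards [hev] with n hn
      exact (cmp (G n) _ _ _ (h₁ n) (h₂ n) (h₀ n) hn.1 hn.2.1 hn.2.2 R).2
  · refine ge_of_tendsto' (x := atTop) (f := fun R => tiltedMean
      (G₀ : Measure (LawSpace (Fin m → EReal) EReal)) (tilt h)
        (fun s => (f₁ s : ℝ≥0∞)) (fun s => (f₂ s : ℝ≥0∞)) + δ R + δ R) ?_ fun R => ?_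
    · simpa using (tendsto_const_nhds.add hδ).add hδ
    · refine le_trans ?_ (add_le_add_left (lim₀ R).2 (δ R))
      refine le_of_tendsto_of_tendsto hlim ((htr R).add tendsto_const_nhds) ?_
      filter_upwards [hev] with n hn
      exact (cmp (G n) _ _ _ (h₁ n) (h₂ n) (h₀ n) hn.1 hn.2.1 hn.2.2 R).1

/-- The limiting random pair of laws of `exists_limit_tiltedMean`, realised by two measurable
functions of the respective coordinates, the common coordinate and a uniform variable. -/
theorem exists_limit_sampler
    {c₁ c₂ c₀ : ℕ → ProbabilityMeasure (EuclideanSpace ℝ (Fin m))}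
    {γ₁ γ₂ γ₀ : ProbabilityMeasure (EuclideanSpace ℝ (Fin m))}
    (hc₁ : TiltConvergence c₁ γ₁) (hc₂ : TiltConvergence c₂ γ₂) (hc₀ : TiltConvergence c₀ γ₀)
    (G : ℕ → ProbabilityMeasure (LawSpace (Fin m → EReal) EReal))
    (h₁ : ∀ n, ∀ᵐ x ∂(G n : Measure (LawSpace (Fin m → EReal) EReal)),
      (x.1 : Measure ((Fin m → EReal) × EReal)).map Prod.fst = Measure.map embEReal (c₁ n))
    (h₂ : ∀ n, ∀ᵐ x ∂(G n : Measure (LawSpace (Fin m → EReal) EReal)),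
      (x.2.1 : Measure ((Fin m → EReal) × EReal)).map Prod.fst = Measure.map embEReal (c₂ n))
    (h₀ : ∀ n, (G n : Measure (LawSpace (Fin m → EReal) EReal)).map (fun x => x.2.2) =
      Measure.map embEReal (c₀ n))
    (l : EuclideanSpace ℝ (Fin m) → C(EReal, ℝ≥0) → C(EReal, ℝ≥0) → ℝ≥0∞)
    (hl : ∀ h f₁ f₂, Tendsto (fun n => tiltedMean (G n : Measure (LawSpace (Fin m → EReal) EReal))
      (tilt h) (fun s => (f₁ s : ℝ≥0∞)) fun s => (f₂ s : ℝ≥0∞)) atTop (𝓝 (l h f₁ f₂))) :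
    ∃ T₁ T₂ : EuclideanSpace ℝ (Fin m) → EuclideanSpace ℝ (Fin m) → I → EReal,
      Measurable (fun x : EuclideanSpace ℝ (Fin m) × EuclideanSpace ℝ (Fin m) × I =>
        T₁ x.1 x.2.1 x.2.2) ∧
      Measurable (fun x : EuclideanSpace ℝ (Fin m) × EuclideanSpace ℝ (Fin m) × I =>
        T₂ x.1 x.2.1 x.2.2) ∧
      ∀ h, ∀ f₁ f₂ : C(EReal, ℝ≥0),
        ∫⁻ ω, (f₁ (T₁ ω.1 ω.2.2.1 ω.2.2.2) : ℝ≥0∞) * f₂ (T₂ ω.2.1 ω.2.2.1 ω.2.2.2) *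
          (ENNReal.ofReal (Real.exp (inner ℝ h ω.1)) * ENNReal.ofReal (Real.exp (inner ℝ h ω.2.1)) *
            ENNReal.ofReal (Real.exp (inner ℝ h ω.2.2.1)))
          ∂((γ₁ : Measure (EuclideanSpace ℝ (Fin m))).prod
            ((γ₂ : Measure (EuclideanSpace ℝ (Fin m))).prod
              ((γ₀ : Measure (EuclideanSpace ℝ (Fin m))).prod (volume : Measure I)))) =
          l h f₁ f₂ := by
  obtain ⟨G₀, k₁, k₂, k₀, hG₀⟩ := exists_limit_tiltedMean hc₁ hc₂ hc₀ G h₁ h₂ h₀ l hl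
  have hemb : Measurable (embEReal (m := m)) := continuous_embEReal.measurable
  have hpm (γ : ProbabilityMeasure (EuclideanSpace ℝ (Fin m))) :
      IsProbabilityMeasure (Measure.map embEReal (γ : Measure (EuclideanSpace ℝ (Fin m)))) :=
    Measure.isProbabilityMeasure_map hemb.aemeasurable
  have := hpm γ₁
  have := hpm γ₂
  have := hpm γ₀
  obtain ⟨T₁, T₂, hT₁, hT₂, hT⟩ := exists_sampler_of_random_laws G₀ _ _ _ k₁ k₂ k₀
  have m₁ : Measurable (fun x : EuclideanSpace ℝ (Fin m) × EuclideanSpace ℝ (Fin m) × I =>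
      T₁ (embEReal x.1) (embEReal x.2.1) x.2.2) :=
    hT₁.comp ((hemb.comp measurable_fst).prodMk
      ((hemb.comp (measurable_fst.comp measurable_snd)).prodMk
        (measurable_snd.comp measurable_snd)))
  have m₂ : Measurable (fun x : EuclideanSpace ℝ (Fin m) × EuclideanSpace ℝ (Fin m) × I =>
      T₂ (embEReal x.1) (embEReal x.2.1) x.2.2) :=
    hT₂.comp ((hemb.comp measurable_fst).prodMk
      ((hemb.comp (measurable_fst.comp measurable_snd)).prodMk
        (measurable_snd.comp measurable_snd)))
  refine ⟨fun d₁ d₀ u => T₁ (embEReal d₁) (embEReal d₀) u,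
    fun d₂ d₀ u => T₂ (embEReal d₂) (embEReal d₀) u, m₁, m₂, fun h f₁ f₂ => ?_⟩
  have hf₁ : Measurable fun s => (f₁ s : ℝ≥0∞) := f₁.continuous.measurable.coe_nnreal_ennreal
  have hf₂ : Measurable fun s => (f₂ s : ℝ≥0∞) := f₂.continuous.measurable.coe_nnreal_ennreal
  -- The tilts are absorbed into the test functions, so that the right side of the sampler identity
  -- is the tilted mean of `G₀`.
  have key := hT (fun y => f₁ y.2 * tilt h y.1) (fun y => f₂ y.2 * tilt h y.1)
    ((hf₁.comp measurable_snd).mul ((measurable_tilt h).comp measurable_fst))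
    ((hf₂.comp measurable_snd).mul ((measurable_tilt h).comp measurable_fst))
    (tilt h) (measurable_tilt h)
  have hmap : (Measure.map embEReal (γ₁ : Measure (EuclideanSpace ℝ (Fin m)))).prod
      ((Measure.map embEReal (γ₂ : Measure (EuclideanSpace ℝ (Fin m)))).prod
        ((Measure.map embEReal (γ₀ : Measure (EuclideanSpace ℝ (Fin m)))).prod
          (volume : Measure I))) =
      ((γ₁ : Measure (EuclideanSpace ℝ (Fin m))).prod
        ((γ₂ : Measure (EuclideanSpace ℝ (Fin m))).prod
          ((γ₀ : Measure (EuclideanSpace ℝ (Fin m))).prod (volume : Measure I)))).map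
        (Prod.map embEReal (Prod.map embEReal (Prod.map embEReal id))) := by
    rw [← Measure.map_prod_map _ _ hemb (hemb.prodMap (hemb.prodMap measurable_id)),
      ← Measure.map_prod_map _ _ hemb (hemb.prodMap measurable_id),
      ← Measure.map_prod_map _ _ hemb measurable_id, Measure.map_id]
  have n₁ : Measurable fun ω : (Fin m → EReal) × (Fin m → EReal) × (Fin m → EReal) × I =>
      T₁ ω.1 ω.2.2.1 ω.2.2.2 :=
    hT₁.comp (g := fun x : (Fin m → EReal) × (Fin m → EReal) × I => T₁ x.1 x.2.1 x.2.2)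
      (f := fun ω : (Fin m → EReal) × (Fin m → EReal) × (Fin m → EReal) × I =>
        (ω.1, ω.2.2.1, ω.2.2.2)) (by fun_prop)
  have n₂ : Measurable fun ω : (Fin m → EReal) × (Fin m → EReal) × (Fin m → EReal) × I =>
      T₂ ω.2.1 ω.2.2.1 ω.2.2.2 :=
    hT₂.comp (g := fun x : (Fin m → EReal) × (Fin m → EReal) × I => T₂ x.1 x.2.1 x.2.2)
      (f := fun ω : (Fin m → EReal) × (Fin m → EReal) × (Fin m → EReal) × I =>
        (ω.2.1, ω.2.2.1, ω.2.2.2)) (by fun_prop)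
  have g₁ := hf₁.comp n₁
  have g₂ := hf₂.comp n₂
  have mF : Measurable fun ω : (Fin m → EReal) × (Fin m → EReal) × (Fin m → EReal) × I =>
      (f₁ (T₁ ω.1 ω.2.2.1 ω.2.2.2) : ℝ≥0∞) * tilt h ω.1 *
        ((f₂ (T₂ ω.2.1 ω.2.2.1 ω.2.2.2) : ℝ≥0∞) * tilt h ω.2.1) * tilt h ω.2.2.1 :=
    ((g₁.mul (by fun_prop)).mul (g₂.mul (by fun_prop))).mul (by fun_prop)
  rw [hmap, lintegral_map mF (hemb.prodMap (hemb.prodMap (hemb.prodMap measurable_id)))] at key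
  refine Eq.trans (lintegral_congr fun ω => ?_) (key.trans (hG₀ h f₁ f₂))
  simp only [Prod.map_fst, Prod.map_snd, tilt_embEReal, id]
  ring

end LimitSampler

/-! ### Conditional independence in product measures by resampling coordinates. -/

section Resampling

open scoped ENNReal Classical

variable {Z ι : Type*} [MeasurableSpace Z] [Fintype ι]

theorem measurable_piecewise_prod (A : Set ι) :
    Measurable fun x : (ι → Z) × (ι → Z) => A.piecewise x.1 x.2 := by
  refine measurable_pi_lambda _ fun i => ?_
  by_cases hi : i ∈ A
  · simpa [hi] using! (measurable_pi_apply i).comp measurable_fst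
  · simpa [hi] using! (measurable_pi_apply i).comp measurable_snd

/-- Replacing some coordinates of an i.i.d. sample by those of an independent copy. -/
theorem map_piecewise_pi_prod (P : Measure Z) [IsProbabilityMeasure P] (A : Set ι) :
    ((Measure.pi fun _ : ι => P).prod (Measure.pi fun _ : ι => P)).map
      (fun x => A.piecewise x.1 x.2) = Measure.pi fun _ => P := by
  symm
  refine Measure.pi_eq fun s hs => ?_
  rw [Measure.map_apply (measurable_piecewise_prod A) (MeasurableSet.univ_pi hs)]
  have : (fun x : (ι → Z) × (ι → Z) => A.piecewise x.1 x.2) ⁻¹' Set.univ.pi s =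
      (Set.univ.pi fun i => if i ∈ A then s i else Set.univ) ×ˢ
        (Set.univ.pi fun i => if i ∈ A then Set.univ else s i) := by
    ext x
    simp only [Set.mem_preimage, Set.mem_univ_pi, Set.mem_prod, ← forall_and]
    refine forall_congr' fun i => ?_
    by_cases hi : i ∈ A <;> simp [hi]
  rw [this, Measure.prod_prod, Measure.pi_pi, Measure.pi_pi, ← Finset.prod_mul_distrib]
  refine Finset.prod_congr rfl fun i _ => ?_
  by_cases hi : i ∈ A <;> simp [hi]

theorem lintegral_pi_eq_piecewise (P : Measure Z) [IsProbabilityMeasure P] (A : Set ι)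
    {F : (ι → Z) → ℝ≥0∞} (hF : Measurable F) :
    ∫⁻ z, F z ∂(Measure.pi fun _ => P) =
      ∫⁻ z, ∫⁻ w, F (A.piecewise w z) ∂(Measure.pi fun _ => P) ∂(Measure.pi fun _ => P) := by
  have hm := hF.comp (measurable_piecewise_prod (Z := Z) A)
  conv_lhs => rw [← map_piecewise_pi_prod P A]
  rw [lintegral_map hF (measurable_piecewise_prod A)]
  exact lintegral_prod_symm _ hm.aemeasurable

/-- Functions of disjoint sets of coordinates are independent. -/
theorem lintegral_pi_mul_of_dependsOn (P : Measure Z) [IsProbabilityMeasure P] {A : Set ι}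
    {F G : (ι → Z) → ℝ≥0∞} (hF : Measurable F) (hG : Measurable G) (hFA : DependsOn F A)
    (hGA : DependsOn G Aᶜ) :
    ∫⁻ z, F z * G z ∂(Measure.pi fun _ => P) =
      (∫⁻ z, F z ∂(Measure.pi fun _ => P)) * ∫⁻ z, G z ∂(Measure.pi fun _ => P) := by
  rw [lintegral_pi_eq_piecewise P A (F := fun z => F z * G z) (hF.mul hG)]
  have h1 (w z : ι → Z) : F (A.piecewise w z) = F w :=
    hFA fun i hi => Set.piecewise_eq_of_mem _ _ _ hi
  have h2 (w z : ι → Z) : G (A.piecewise w z) = G z :=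
    hGA fun i hi => Set.piecewise_eq_of_notMem _ _ _ hi
  simp_rw [h1, h2]
  simp_rw [lintegral_mul_const _ hF]
  rw [lintegral_const_mul _ hG]

/-- Conditionally on the common coordinates `A₀`, functions of `A₁ ∪ A₀` and of `A₂ ∪ A₀` are
independent. -/
theorem lintegral_pi_mul_mul_eq (P : Measure Z) [IsProbabilityMeasure P] {A₁ A₂ A₀ : Set ι}
    (h₁₂ : Disjoint A₁ A₂) (h₁₀ : Disjoint A₁ A₀) (h₂₀ : Disjoint A₂ A₀)
    {F₁ F₂ F₀ : (ι → Z) → ℝ≥0∞} (hF₁ : Measurable F₁) (hF₂ : Measurable F₂) (hF₀ : Measurable F₀)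
    (d₁ : DependsOn F₁ (A₁ ∪ A₀)) (d₂ : DependsOn F₂ (A₂ ∪ A₀)) (d₀ : DependsOn F₀ A₀) :
    ∫⁻ z, F₁ z * F₂ z * F₀ z ∂(Measure.pi fun _ => P) =
      ∫⁻ z, (∫⁻ w, F₁ (A₁.piecewise w z) ∂(Measure.pi fun _ => P)) *
        (∫⁻ w, F₂ (A₂.piecewise w z) ∂(Measure.pi fun _ => P)) * F₀ z
        ∂(Measure.pi fun _ => P) := by
  -- `F₁` does not see a resampling of `A₂`, `F₂` does not see one of `A₁`, and `F₀` sees neither.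
  have e₁ (w₁ w₂ z : ι → Z) :
      F₁ (A₂.piecewise w₂ (A₁.piecewise w₁ z)) = F₁ (A₁.piecewise w₁ z) :=
    d₁ fun i hi => Set.piecewise_eq_of_notMem _ _ _ fun hi₂ => hi.elim
      (fun h => Set.disjoint_left.1 h₁₂ h hi₂) (fun h => Set.disjoint_left.1 h₂₀ hi₂ h)
  have e₂ (w₁ w₂ z : ι → Z) :
      F₂ (A₂.piecewise w₂ (A₁.piecewise w₁ z)) = F₂ (A₂.piecewise w₂ z) := by
    refine d₂ fun i hi => ?_
    by_cases hi₂ : i ∈ A₂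
    · rw [Set.piecewise_eq_of_mem _ _ _ hi₂, Set.piecewise_eq_of_mem _ _ _ hi₂]
    · rw [Set.piecewise_eq_of_notMem _ _ _ hi₂, Set.piecewise_eq_of_notMem _ _ _ hi₂]
      refine Set.piecewise_eq_of_notMem _ _ _ fun hi₁ => ?_
      exact Set.disjoint_left.1 h₁₀ hi₁ (hi.resolve_left hi₂)
  have e₀ (w₁ w₂ z : ι → Z) : F₀ (A₂.piecewise w₂ (A₁.piecewise w₁ z)) = F₀ z :=
    d₀ fun i hi => by
      rw [Set.piecewise_eq_of_notMem _ _ _ fun h => Set.disjoint_left.1 h₂₀ h hi,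
        Set.piecewise_eq_of_notMem _ _ _ fun h => Set.disjoint_left.1 h₁₀ h hi]
  have m (A : Set ι) (z : ι → Z) : Measurable fun w : ι → Z => A.piecewise w z :=
    (measurable_piecewise_prod A).comp (measurable_id.prodMk measurable_const)
  have mF : Measurable fun z => F₁ z * F₂ z * F₀ z := (hF₁.mul hF₂).mul hF₀
  have mi : Measurable fun z => ∫⁻ w, F₁ (A₂.piecewise w z) * F₂ (A₂.piecewise w z) *
      F₀ (A₂.piecewise w z) ∂(Measure.pi fun _ : ι => P) :=
    Measurable.lintegral_prod_left'
      (f := fun x : (ι → Z) × (ι → Z) => F₁ (A₂.piecewise x.1 x.2) * F₂ (A₂.piecewise x.1 x.2) *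
      F₀ (A₂.piecewise x.1 x.2)) (mF.comp (measurable_piecewise_prod A₂))
  -- Both private blocks are replaced by independent copies, which leaves the law of the sample
  -- unchanged.
  rw [lintegral_pi_eq_piecewise P A₂ mF, lintegral_pi_eq_piecewise P A₁ mi]
  refine lintegral_congr fun z => ?_
  simp_rw [e₁, e₂, e₀]
  have mF₂ : Measurable fun w => F₂ (A₂.piecewise w z) := hF₂.comp (m A₂ z)
  have mF₁ : Measurable fun w => F₁ (A₁.piecewise w z) := hF₁.comp (m A₁ z)
  calc _ = ∫⁻ w₁, F₁ (A₁.piecewise w₁ z) *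
        ((∫⁻ w, F₂ (A₂.piecewise w z) ∂(Measure.pi fun _ => P)) * F₀ z)
          ∂(Measure.pi fun _ => P) := by
        refine lintegral_congr fun w₁ => ?_
        simp_rw [mul_assoc]
        rw [lintegral_const_mul _ (mF₂.mul_const _)]
        congr 1
        exact lintegral_mul_const _ mF₂
    _ = _ := by
        rw [mul_assoc]
        exact lintegral_mul_const _ mF₁

end Resampling

/-! ### Comparison of product laws through the Hellinger distance. -/

section Hellinger

open scoped ENNReal

variable {Z ι : Type*} [MeasurableSpace Z] [Fintype ι]

theorem lintegral_pi_ofReal_prod {ν : ι → Measure Z} [∀ i, SigmaFinite (ν i)] {f : Z → ℝ}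
    (hf0 : ∀ z, 0 ≤ f z) (hf : ∀ i, Integrable f (ν i)) :
    ∫⁻ z, ENNReal.ofReal (∏ i, f (z i)) ∂(Measure.pi ν) =
      ∏ i, ∫⁻ z, ENNReal.ofReal (f z) ∂(ν i) := by
  have hi : Integrable (fun z : ι → Z => ∏ i, f (z i)) (Measure.pi ν) :=
    Integrable.fintype_prod (f := fun _ => f) hf
  rw [← ofReal_integral_eq_lintegral_ofReal hi
    (ae_of_all _ fun z => Finset.prod_nonneg fun i _ => hf0 _),
    integral_fintype_prod_eq_prod (f := fun _ => f),
    ENNReal.ofReal_prod_of_nonneg fun i _ => integral_nonneg hf0]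
  exact Finset.prod_congr rfl fun i _ =>
    ofReal_integral_eq_lintegral_ofReal (hf i) (ae_of_all _ hf0)

theorem pi_withDensity_ofReal {ν : Measure Z} [SigmaFinite ν] {f : Z → ℝ} (hfm : Measurable f)
    (hf0 : ∀ z, 0 ≤ f z) (hf : ∫⁻ z, ENNReal.ofReal (f z) ∂ν = 1) :
    (Measure.pi fun _ : ι => ν.withDensity fun z => ENNReal.ofReal (f z)) =
      (Measure.pi fun _ : ι => ν).withDensity fun z => ENNReal.ofReal (∏ i, f (z i)) := by
  have hfi : Integrable f ν := by
    refine ⟨hfm.aestronglyMeasurable, ?_⟩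
    rw [hasFiniteIntegral_iff_ofReal (ae_of_all _ hf0), hf]
    exact ENNReal.one_lt_top
  have : IsProbabilityMeasure (ν.withDensity fun z => ENNReal.ofReal (f z)) :=
    ⟨by rw [withDensity_apply _ MeasurableSet.univ, Measure.restrict_univ, hf]⟩
  refine Measure.pi_eq fun s hs => ?_
  rw [withDensity_apply _ (MeasurableSet.univ_pi hs), Measure.restrict_pi_pi,
    lintegral_pi_ofReal_prod hf0 fun i => hfi.mono_measure Measure.restrict_le_self]
  exact Finset.prod_congr rfl fun i _ => (withDensity_apply _ (hs i)).symm

theorem integrable_of_lintegral_ofReal_eq_one {ν : Measure Z} {f : Z → ℝ} (hfm : Measurable f)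
    (hf0 : ∀ z, 0 ≤ f z) (hf : ∫⁻ z, ENNReal.ofReal (f z) ∂ν = 1) :
    Integrable f ν ∧ ∫ z, f z ∂ν = 1 := by
  have hfi : Integrable f ν := by
    refine ⟨hfm.aestronglyMeasurable, ?_⟩
    rw [hasFiniteIntegral_iff_ofReal (ae_of_all _ hf0), hf]
    exact ENNReal.one_lt_top
  refine ⟨hfi, ?_⟩
  rw [integral_eq_lintegral_of_nonneg_ae (ae_of_all _ hf0) hfm.aestronglyMeasurable, hf]
  simp

/-- The squared Hellinger distance of `n`-fold products is at most `n` times that of the factors. -/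
theorem lintegral_pi_sq_prod_sub_prod_le {ν : Measure Z} [SigmaFinite ν] {a b : Z → ℝ}
    (ha : Measurable a) (hb : Measurable b) (ha0 : ∀ z, 0 ≤ a z) (hb0 : ∀ z, 0 ≤ b z)
    (ha1 : ∫⁻ z, ENNReal.ofReal (a z ^ 2) ∂ν = 1) (hb1 : ∫⁻ z, ENNReal.ofReal (b z ^ 2) ∂ν = 1) :
    ∫⁻ z, ENNReal.ofReal ((∏ i, a (z i) - ∏ i, b (z i)) ^ 2) ∂(Measure.pi fun _ : ι => ν) ≤
      Fintype.card ι * ∫⁻ z, ENNReal.ofReal ((a z - b z) ^ 2) ∂ν := by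
  obtain ⟨ia, ea⟩ := integrable_of_lintegral_ofReal_eq_one (by fun_prop) (fun z => sq_nonneg _) ha1
  obtain ⟨ib, eb⟩ := integrable_of_lintegral_ofReal_eq_one (by fun_prop) (fun z => sq_nonneg _) hb1
  have iab : Integrable (fun z => a z * b z) ν := by
    refine (ia.add ib).mono' (by fun_prop) (ae_of_all _ fun z => ?_)
    rw [Real.norm_of_nonneg (mul_nonneg (ha0 z) (hb0 z))]
    simp only [Pi.add_apply]
    nlinarith [sq_nonneg (a z - b z), sq_nonneg (a z + b z)]
  have isub : Integrable (fun z => (a z - b z) ^ 2) ν := by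
    have : (fun z => (a z - b z) ^ 2) = fun z => a z ^ 2 + b z ^ 2 - 2 * (a z * b z) := by
      funext z; ring
    rw [this]
    exact (ia.add ib).sub (iab.const_mul 2)
  have esub : ∫ z, (a z - b z) ^ 2 ∂ν = 2 - 2 * ∫ z, a z * b z ∂ν := by
    have : (fun z => (a z - b z) ^ 2) = fun z => a z ^ 2 + b z ^ 2 - 2 * (a z * b z) := by
      funext z; ring
    rw [this, integral_sub (f := fun z => a z ^ 2 + b z ^ 2) (ia.add ib) (iab.const_mul 2), integral_add ia ib, ea, eb,
      integral_const_mul]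
    ring
  have Ia : Integrable (fun z : ι → Z => ∏ i, a (z i) ^ 2) (Measure.pi fun _ => ν) :=
    Integrable.fintype_prod (f := fun _ z => a z ^ 2) fun _ => ia
  have Ib : Integrable (fun z : ι → Z => ∏ i, b (z i) ^ 2) (Measure.pi fun _ => ν) :=
    Integrable.fintype_prod (f := fun _ z => b z ^ 2) fun _ => ib
  have Iab : Integrable (fun z : ι → Z => ∏ i, (a (z i) * b (z i))) (Measure.pi fun _ => ν) :=
    Integrable.fintype_prod (f := fun _ z => a z * b z) fun _ => iab
  have Ea : ∫ z : ι → Z, ∏ i, a (z i) ^ 2 ∂(Measure.pi fun _ => ν) = 1 := by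
    rw [integral_fintype_prod_eq_prod (f := fun _ z => a z ^ 2)]
    simp [ea]
  have Eb : ∫ z : ι → Z, ∏ i, b (z i) ^ 2 ∂(Measure.pi fun _ => ν) = 1 := by
    rw [integral_fintype_prod_eq_prod (f := fun _ z => b z ^ 2)]
    simp [eb]
  have Eab : ∫ z : ι → Z, ∏ i, (a (z i) * b (z i)) ∂(Measure.pi fun _ => ν) =
      (∫ z, a z * b z ∂ν) ^ Fintype.card ι := by
    rw [integral_fintype_prod_eq_prod (f := fun _ z => a z * b z)]
    simp
  have hfun : (fun z : ι → Z => (∏ i, a (z i) - ∏ i, b (z i)) ^ 2) = fun z =>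
      ∏ i, a (z i) ^ 2 + ∏ i, b (z i) ^ 2 - 2 * ∏ i, (a (z i) * b (z i)) := by
    funext z
    simp only [Finset.prod_pow, Finset.prod_mul_distrib]
    ring
  have Isub : Integrable (fun z : ι → Z => (∏ i, a (z i) - ∏ i, b (z i)) ^ 2)
      (Measure.pi fun _ => ν) := by
    rw [hfun]
    exact (Ia.add Ib).sub (Iab.const_mul 2)
  have Esub : ∫ z : ι → Z, (∏ i, a (z i) - ∏ i, b (z i)) ^ 2 ∂(Measure.pi fun _ => ν) =
      2 - 2 * (∫ z, a z * b z ∂ν) ^ Fintype.card ι := by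
    rw [hfun, integral_sub (f := fun z : ι → Z => ∏ i, a (z i) ^ 2 + ∏ i, b (z i) ^ 2)
      (Ia.add Ib) (Iab.const_mul 2), integral_add Ia Ib, Ea, Eb,
      integral_const_mul, Eab]
    ring
  rw [← ofReal_integral_eq_lintegral_ofReal Isub (ae_of_all _ fun _ => sq_nonneg _),
    ← ofReal_integral_eq_lintegral_ofReal isub (ae_of_all _ fun _ => sq_nonneg _), Esub, esub,
    ← ENNReal.ofReal_natCast, ← ENNReal.ofReal_mul (Nat.cast_nonneg _)]
  apply ENNReal.ofReal_le_ofReal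
  have hρ : 0 ≤ ∫ z, a z * b z ∂ν := integral_nonneg fun z => mul_nonneg (ha0 z) (hb0 z)
  -- With affinity `ρ = ∫ a b` the squared distances are `2 - 2 ρ` and `2 - 2 ρ ^ n`; Bernoulli's
  -- inequality compares them.
  have := one_add_mul_le_pow (a := (∫ z, a z * b z ∂ν) - 1) (by linarith) (Fintype.card ι)
  rw [add_sub_cancel] at this
  linarith

/-- The difference `x ^ 2 - y ^ 2 = (x - y) (x + y)` of the product densities is split by the
weighted arithmetic-geometric mean inequality. The first part is a squared Hellinger distance
divided by `2 * t`; the second is `t` times a sum of two densities, of total mass two. -/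
theorem lintegral_pi_withDensity_sq_le {ν : Measure Z} [SigmaFinite ν] {a b : Z → ℝ}
    (ha : Measurable a) (hb : Measurable b) (ha0 : ∀ z, 0 ≤ a z) (hb0 : ∀ z, 0 ≤ b z)
    (ha1 : ∫⁻ z, ENNReal.ofReal (a z ^ 2) ∂ν = 1) (hb1 : ∫⁻ z, ENNReal.ofReal (b z ^ 2) ∂ν = 1)
    {η t : ℝ} (hη0 : 0 ≤ η) (hη : ∫⁻ z, ENNReal.ofReal ((a z - b z) ^ 2) ∂ν ≤ ENNReal.ofReal η)
    (ht : 0 < t) {F : (ι → Z) → ℝ≥0∞} (hF : Measurable F) {C : ℝ≥0∞} (hFC : ∀ z, F z ≤ C) :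
    ∫⁻ z, F z ∂(Measure.pi fun _ : ι => ν.withDensity fun z => ENNReal.ofReal (a z ^ 2)) ≤
      ∫⁻ z, F z ∂(Measure.pi fun _ : ι => ν.withDensity fun z => ENNReal.ofReal (b z ^ 2)) +
        C * ENNReal.ofReal (Fintype.card ι * η / (2 * t) + 2 * t) := by
  rw [pi_withDensity_ofReal (by fun_prop) (fun z => sq_nonneg _) ha1,
    pi_withDensity_ofReal (by fun_prop) (fun z => sq_nonneg _) hb1,
    lintegral_withDensity_eq_lintegral_mul _ (by fun_prop) hF,
    lintegral_withDensity_eq_lintegral_mul _ (by fun_prop) hF]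
  simp only [Pi.mul_apply, Finset.prod_pow]
  have hpt (x y : ℝ) : ENNReal.ofReal (x ^ 2) ≤ ENNReal.ofReal (y ^ 2) +
      (ENNReal.ofReal (1 / (2 * t)) * ENNReal.ofReal ((x - y) ^ 2) +
        ENNReal.ofReal t * (ENNReal.ofReal (x ^ 2) + ENNReal.ofReal (y ^ 2))) := by
    rw [← ENNReal.ofReal_mul (by positivity), ← ENNReal.ofReal_add (by positivity) (by positivity),
      ← ENNReal.ofReal_mul (by positivity), ← ENNReal.ofReal_add (by positivity) (by positivity),
      ← ENNReal.ofReal_add (by positivity) (by positivity)]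
    apply ENNReal.ofReal_le_ofReal
    have h1 : 0 ≤ ((x - y) / t - (x + y)) ^ 2 * t / 2 := by positivity
    have h2 : ((x - y) / t - (x + y)) ^ 2 * t / 2 =
        1 / (2 * t) * (x - y) ^ 2 - (x ^ 2 - y ^ 2) + t * (x + y) ^ 2 / 2 := by
      field_simp
      ring
    nlinarith [mul_nonneg ht.le (sq_nonneg (x - y))]
  have e1 : ∫⁻ z : ι → Z, ENNReal.ofReal ((∏ i, a (z i)) ^ 2) ∂(Measure.pi fun _ => ν) = 1 := by
    have := lintegral_pi_ofReal_prod (ι := ι) (ν := fun _ => ν) (f := fun z => a z ^ 2)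
      (fun z => sq_nonneg _)
      fun _ => (integrable_of_lintegral_ofReal_eq_one (by fun_prop) (fun z => sq_nonneg _) ha1).1
    simpa [Finset.prod_pow, ha1] using this
  have e2 : ∫⁻ z : ι → Z, ENNReal.ofReal ((∏ i, b (z i)) ^ 2) ∂(Measure.pi fun _ => ν) = 1 := by
    have := lintegral_pi_ofReal_prod (ι := ι) (ν := fun _ => ν) (f := fun z => b z ^ 2)
      (fun z => sq_nonneg _)
      fun _ => (integrable_of_lintegral_ofReal_eq_one (by fun_prop) (fun z => sq_nonneg _) hb1).1
    simpa [Finset.prod_pow, hb1] using this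
  have e3 := lintegral_pi_sq_prod_sub_prod_le (ι := ι) ha hb ha0 hb0 ha1 hb1
  set A : (ι → Z) → ℝ := fun z => ∏ i, a (z i) with hA
  set B : (ι → Z) → ℝ := fun z => ∏ i, b (z i) with hB
  have mA : Measurable A := by fun_prop
  have mB : Measurable B := by fun_prop
  calc ∫⁻ z, ENNReal.ofReal (A z ^ 2) * F z ∂(Measure.pi fun _ => ν)
      ≤ ∫⁻ z, (ENNReal.ofReal (B z ^ 2) * F z + C * (ENNReal.ofReal (1 / (2 * t)) *
          ENNReal.ofReal ((A z - B z) ^ 2) + ENNReal.ofReal t * (ENNReal.ofReal (A z ^ 2) +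
            ENNReal.ofReal (B z ^ 2)))) ∂(Measure.pi fun _ => ν) := by
        refine lintegral_mono fun z => ?_
        refine (mul_le_mul_left (hpt (A z) (B z)) (F z)).trans ?_
        rw [add_mul]
        refine add_le_add le_rfl ?_
        rw [mul_comm]
        exact mul_le_mul_left (hFC z) _
    _ = ∫⁻ z, ENNReal.ofReal (B z ^ 2) * F z ∂(Measure.pi fun _ => ν) +
        C * (ENNReal.ofReal (1 / (2 * t)) *
          ∫⁻ z, ENNReal.ofReal ((A z - B z) ^ 2) ∂(Measure.pi fun _ => ν) +
            ENNReal.ofReal t * (1 + 1)) := by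
        rw [lintegral_add_right _ (by fun_prop), lintegral_const_mul _ (by fun_prop),
          lintegral_add_right _ (by fun_prop), lintegral_const_mul _ (by fun_prop),
          lintegral_const_mul _ (by fun_prop), lintegral_add_right _ (by fun_prop), e1, e2]
    _ ≤ _ := by
        refine add_le_add le_rfl (mul_le_mul_right ?_ C)
        have : ENNReal.ofReal (Fintype.card ι * η / (2 * t) + 2 * t) =
            ENNReal.ofReal (1 / (2 * t)) * (Fintype.card ι * ENNReal.ofReal η) +
              ENNReal.ofReal t * (1 + 1) := by
          rw [← ENNReal.ofReal_natCast, ← ENNReal.ofReal_mul (Nat.cast_nonneg _),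
            ← ENNReal.ofReal_mul (by positivity), ← ENNReal.ofReal_one,
            ← ENNReal.ofReal_add zero_le_one zero_le_one, ← ENNReal.ofReal_mul ht.le,
            ← ENNReal.ofReal_add (by positivity) (by positivity)]
          congr 1
          field_simp
          ring
        rw [this]
        gcongr
        exact e3.trans (mul_le_mul_right hη _)

/-- Comparison of product laws through the Hellinger distance of the densities of the factors,
with respect to an arbitrary dominating measure. -/
theorem lintegral_pi_withDensity_le {μ : Measure Z} {f g : Z → ℝ}
    (hf : Measurable f) (hg : Measurable g) (hf0 : ∀ z, 0 ≤ f z) (hg0 : ∀ z, 0 ≤ g z)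
    (hf1 : ∫⁻ z, ENNReal.ofReal (f z) ∂μ = 1) (hg1 : ∫⁻ z, ENNReal.ofReal (g z) ∂μ = 1)
    {η t : ℝ} (hη0 : 0 ≤ η) (hη : ∫⁻ z, ENNReal.ofReal ((√(f z) - √(g z)) ^ 2) ∂μ ≤ ENNReal.ofReal η)
    (ht : 0 < t) {F : (ι → Z) → ℝ≥0∞} (hF : Measurable F) {C : ℝ≥0∞} (hFC : ∀ z, F z ≤ C) :
    ∫⁻ z, F z ∂(Measure.pi fun _ : ι => μ.withDensity fun z => ENNReal.ofReal (f z)) ≤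
      ∫⁻ z, F z ∂(Measure.pi fun _ : ι => μ.withDensity fun z => ENNReal.ofReal (g z)) +
        C * ENNReal.ofReal (Fintype.card ι * η / (2 * t) + 2 * t) := by
  -- `μ` need not be `σ`-finite, so its powers are avoided: `ν` is finite and dominates both laws,
  -- with densities `f / (f + g)` and `g / (f + g)`.
  set ν := μ.withDensity fun z => ENNReal.ofReal (f z + g z) with hν
  have hfin : IsFiniteMeasure ν := by
    refine ⟨?_⟩
    rw [hν, withDensity_apply _ MeasurableSet.univ, Measure.restrict_univ]
    simp_rw [ENNReal.ofReal_add (hf0 _) (hg0 _)]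
    rw [lintegral_add_right _ (by fun_prop), hf1, hg1]
    exact ENNReal.add_lt_top.2 ⟨ENNReal.one_lt_top, ENNReal.one_lt_top⟩
  have hsq (x : ℝ) (hx : 0 ≤ x) (y : ℝ) (hy : 0 ≤ y) : (x + y) * √(x / (x + y)) ^ 2 = x := by
    rw [Real.sq_sqrt (by positivity)]
    -- If `x + y = 0` then `x = 0`, and the junk value of the quotient is harmless.
    rcases eq_or_lt_of_le (add_nonneg hx hy) with h | h
    · rw [← h]
      linarith
    · field_simp
  have hH (k : Z → ℝ) (hk : Measurable k) :
      ∫⁻ z, ENNReal.ofReal (k z) ∂ν = ∫⁻ z, ENNReal.ofReal ((f z + g z) * k z) ∂μ := by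
    rw [hν, lintegral_withDensity_eq_lintegral_mul _ (by fun_prop) (by fun_prop)]
    refine lintegral_congr fun z => ?_
    rw [Pi.mul_apply, ← ENNReal.ofReal_mul (add_nonneg (hf0 z) (hg0 z))]
  have hd (k : Z → ℝ) (hk : Measurable k) : ν.withDensity (fun z => ENNReal.ofReal (k z)) =
      μ.withDensity fun z => ENNReal.ofReal ((f z + g z) * k z) := by
    rw [hν, ← withDensity_mul _ (by fun_prop) (by fun_prop)]
    congr 1
    funext z
    rw [Pi.mul_apply, ← ENNReal.ofReal_mul (add_nonneg (hf0 z) (hg0 z))]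
  have ef (z : Z) : (f z + g z) * √(f z / (f z + g z)) ^ 2 = f z := hsq _ (hf0 z) _ (hg0 z)
  have eg (z : Z) : (f z + g z) * √(g z / (f z + g z)) ^ 2 = g z := by
    rw [add_comm]; exact hsq _ (hg0 z) _ (hf0 z)
  have := lintegral_pi_withDensity_sq_le (ι := ι) (ν := ν) (a := fun z => √(f z / (f z + g z)))
    (b := fun z => √(g z / (f z + g z))) (by fun_prop) (by fun_prop) (fun z => Real.sqrt_nonneg _)
    (fun z => Real.sqrt_nonneg _) (by rw [hH _ (by fun_prop)]; simp_rw [ef, hf1])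
    (by rw [hH _ (by fun_prop)]; simp_rw [eg, hg1]) hη0 ?_ ht hF hFC
  · rw [hd _ (by fun_prop), hd _ (by fun_prop)] at this
    simp_rw [ef, eg] at this
    exact this
  · rw [hH _ (by fun_prop)]
    refine le_of_eq_of_le (lintegral_congr fun z => ?_) hη
    congr 1
    have hs := add_nonneg (hf0 z) (hg0 z)
    have hmul (x : ℝ) (hx : 0 ≤ x) (h : (f z + g z) * √(x / (f z + g z)) ^ 2 = x) :
        √x = √(f z + g z) * √(x / (f z + g z)) := by
      rw [Real.sq_sqrt (div_nonneg hx hs)] at h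
      rw [← Real.sqrt_mul hs, h]
    rw [hmul _ (hf0 z) (ef z), hmul _ (hg0 z) (eg z), ← mul_sub, mul_pow, Real.sq_sqrt hs]

end Hellinger

/-! ### Exponential tilts of Gaussian laws are Gaussian shifts. -/

section GaussianShift

open scoped ENNReal RealInnerProductSpace MatrixOrder
open Matrix WithLp

variable {ι : Type*} [Fintype ι]

/-- The coordinates are independent, so this is a product of one-dimensional moment generating
functions at `a i + t i * I`. It gives at once the characteristic function of the law tilted by `a`.
-/
theorem integral_cexp_mul_stdGaussian (a t : EuclideanSpace ℝ ι) :
    ∫ x, Complex.exp ((⟪x, a⟫ : ℝ) + (⟪x, t⟫ : ℝ) * Complex.I) ∂(stdGaussian (EuclideanSpace ℝ ι)) =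
      Complex.exp (∑ i, ((a i : ℂ) + t i * Complex.I) ^ 2 / 2) := by
  rw [← map_pi_eq_stdGaussian, integral_map (by fun_prop) (by fun_prop)]
  have (x : ι → ℝ) : Complex.exp ((⟪toLp 2 x, a⟫ : ℝ) + (⟪toLp 2 x, t⟫ : ℝ) * Complex.I) =
      ∏ i, Complex.exp (((a i : ℂ) + t i * Complex.I) * x i) := by
    rw [← Complex.exp_sum]
    congr 1
    simp only [PiLp.inner_apply, RCLike.inner_apply, conj_trivial, Complex.ofReal_sum,
      Complex.ofReal_mul, Finset.sum_mul, ← Finset.sum_add_distrib]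
    exact Finset.sum_congr rfl fun i _ => by ring
  simp_rw [this]
  rw [integral_fintype_prod_eq_prod
    (f := fun i (x : ℝ) => Complex.exp (((a i : ℂ) + t i * Complex.I) * x)), Complex.exp_sum]
  refine Finset.prod_congr rfl fun i _ => ?_
  have := complexMGF_id_gaussianReal (μ := 0) (v := 1) ((a i : ℂ) + t i * Complex.I)
  simpa [complexMGF] using this

/-- A nonintegrable function would have Bochner integral zero, while the formula at `t = 0` gives a
value of the exponential. -/
theorem integrable_exp_inner_stdGaussian (a : EuclideanSpace ℝ ι) :
    Integrable (fun x => Real.exp ⟪x, a⟫) (stdGaussian (EuclideanSpace ℝ ι)) := by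
  by_contra h
  have h1 := integral_cexp_mul_stdGaussian a 0
  have h2 : ∫ x : EuclideanSpace ℝ ι, Complex.exp ((⟪x, a⟫ : ℝ) + (⟪x, (0 : EuclideanSpace ℝ ι)⟫ : ℝ) * Complex.I)
      ∂(stdGaussian (EuclideanSpace ℝ ι)) = 0 := by
    refine integral_undef fun hi => h ?_
    have := hi.norm
    simpa [Complex.norm_exp] using this
  rw [h2] at h1
  exact Complex.exp_ne_zero _ h1.symm

/-- The Cameron–Martin formula for the standard Gaussian distribution. -/
theorem map_add_stdGaussian (a : EuclideanSpace ℝ ι) :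
    (stdGaussian (EuclideanSpace ℝ ι)).map (fun x => a + x) =
      (stdGaussian (EuclideanSpace ℝ ι)).withDensity
        fun x => ENNReal.ofReal (Real.exp (⟪x, a⟫ - ‖a‖ ^ 2 / 2)) := by
  have hint : Integrable (fun x => Real.exp (⟪x, a⟫ - ‖a‖ ^ 2 / 2))
      (stdGaussian (EuclideanSpace ℝ ι)) := by
    simp_rw [Real.exp_sub]
    exact (integrable_exp_inner_stdGaussian a).div_const _
  have : IsFiniteMeasure ((stdGaussian (EuclideanSpace ℝ ι)).withDensity
        fun x => ENNReal.ofReal (Real.exp (⟪x, a⟫ - ‖a‖ ^ 2 / 2))) :=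
    isFiniteMeasure_withDensity_ofReal hint.2
  have : IsProbabilityMeasure ((stdGaussian (EuclideanSpace ℝ ι)).map (fun x => a + x)) :=
    Measure.isProbabilityMeasure_map (by fun_prop)
  apply Measure.ext_of_charFun
  ext t
  rw [charFun_map_const_add, charFun_stdGaussian, charFun_apply,
    integral_withDensity_eq_integral_toReal_smul (by fun_prop) (ae_of_all _ fun _ => by simp)]
  have (x : EuclideanSpace ℝ ι) : (ENNReal.ofReal (Real.exp (⟪x, a⟫ - ‖a‖ ^ 2 / 2))).toReal •
      Complex.exp ((⟪x, t⟫ : ℝ) * Complex.I) = Complex.exp (-(‖a‖ ^ 2 / 2 : ℝ)) *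
        Complex.exp ((⟪x, a⟫ : ℝ) + (⟪x, t⟫ : ℝ) * Complex.I) := by
    rw [ENNReal.toReal_ofReal (Real.exp_nonneg _), Complex.real_smul, Complex.ofReal_exp,
      ← Complex.exp_add, ← Complex.exp_add]
    congr 1
    push_cast
    ring
  simp_rw [this]
  -- Both exponents equal `i⟨a, t⟩ - ‖t‖² / 2`: the normalising factor cancels the term `‖a‖² / 2`
  -- of the square.
  rw [integral_const_mul, integral_cexp_mul_stdGaussian, ← Complex.exp_add, ← Complex.exp_add]
  congr 1
  rw [EuclideanSpace.real_norm_sq_eq, ← Complex.ofReal_pow, EuclideanSpace.real_norm_sq_eq]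
  simp only [PiLp.inner_apply, RCLike.inner_apply, conj_trivial]
  push_cast
  simp only [Finset.sum_mul, Finset.sum_div, ← Finset.sum_neg_distrib, ← Finset.sum_add_distrib]
  refine Finset.sum_congr rfl fun i _ => ?_
  ring_nf
  simp only [Complex.I_sq]
  ring

variable [DecidableEq ι]

/-- Exponentially tilting a centred Gaussian distribution shifts its mean. -/
theorem lintegral_multivariateGaussian_tilt {S : Matrix ι ι ℝ} (hS : S.PosSemidef)
    (h : EuclideanSpace ℝ ι) {F : EuclideanSpace ℝ ι → ℝ≥0∞} (hF : Measurable F) :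
    ∫⁻ d, F d * ENNReal.ofReal (Real.exp ⟪h, d⟫) ∂(multivariateGaussian 0 S) =
      ENNReal.ofReal (Real.exp ((h ⬝ᵥ S *ᵥ h) / 2)) *
        ∫⁻ d, F d ∂(multivariateGaussian (toEuclideanCLM (𝕜 := ℝ) S h) S) := by
  -- The centred law is the image of the standard one under `A`. The tilt by `h` becomes a tilt by
  -- `A h`, hence a shift by `A h`, which `A` maps to `S h`.
  set A := toEuclideanCLM (𝕜 := ℝ) (CFC.sqrt S) with hA
  have hAA : A * A = toEuclideanCLM (𝕜 := ℝ) S := by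
    rw [hA, ← map_mul, CFC.sqrt_mul_sqrt_self _ hS.nonneg]
  have hAs : IsSelfAdjoint A := (CFC.sqrt_nonneg S).isSelfAdjoint.map _
  have hsym (x y : EuclideanSpace ℝ ι) : ⟪A x, y⟫ = ⟪x, A y⟫ := by
    rw [← ContinuousLinearMap.adjoint_inner_right, hAs.adjoint_eq]
  have hnorm : ‖A h‖ ^ 2 = h ⬝ᵥ S *ᵥ h := by
    rw [← real_inner_self_eq_norm_sq, hsym, ← inner_toEuclideanCLM, ← hAA]
    rfl
  have hmean (x : EuclideanSpace ℝ ι) : toEuclideanCLM (𝕜 := ℝ) S h + A x = A (A h + x) := by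
    rw [map_add, ← hAA]
    rfl
  rw [multivariateGaussian, multivariateGaussian, lintegral_map (by fun_prop) (by fun_prop),
    lintegral_map hF (by fun_prop)]
  simp_rw [← hA, hmean, zero_add]
  have e := lintegral_map (μ := stdGaussian (EuclideanSpace ℝ ι)) (f := fun y => F (A y))
    (g := fun x => A h + x) (by fun_prop) (by fun_prop)
  rw [← e, map_add_stdGaussian, lintegral_withDensity_eq_lintegral_mul _ (by fun_prop)
    (by fun_prop), ← lintegral_const_mul _ (by fun_prop)]
  refine lintegral_congr fun x => ?_
  rw [Pi.mul_apply, ← mul_assoc, ← ENNReal.ofReal_mul (Real.exp_nonneg _), ← Real.exp_add, hnorm,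
    mul_comm, ← hsym, real_inner_comm]
  congr 3
  ring

/-- A Gaussian distribution with covariance `S⁻¹`, mapped by `S`. -/
theorem map_toEuclideanCLM_multivariateGaussian_inv {S : Matrix ι ι ℝ} (hS : S.PosDef)
    (h : EuclideanSpace ℝ ι) :
    (multivariateGaussian h S⁻¹).map (toEuclideanCLM (𝕜 := ℝ) S) =
      multivariateGaussian (toEuclideanCLM (𝕜 := ℝ) S h) S := by
  have hinv : S⁻¹.PosSemidef := hS.inv.posSemidef
  have hdet : IsUnit S.det := (Matrix.isUnit_iff_isUnit_det S).1 hS.isUnit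
  have : IsProbabilityMeasure ((multivariateGaussian h S⁻¹).map (toEuclideanCLM (𝕜 := ℝ) S)) :=
    Measure.isProbabilityMeasure_map (by fun_prop)
  apply Measure.ext_of_charFun
  ext t
  have hSs : IsSelfAdjoint (toEuclideanCLM (𝕜 := ℝ) S) := by
    have : IsSelfAdjoint S := hS.isHermitian
    exact this.map _
  have hsym (x y : EuclideanSpace ℝ ι) :
      ⟪toEuclideanCLM (𝕜 := ℝ) S x, y⟫ = ⟪x, toEuclideanCLM (𝕜 := ℝ) S y⟫ := by
    rw [← ContinuousLinearMap.adjoint_inner_right, hSs.adjoint_eq]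
  have e1 : charFun ((multivariateGaussian h S⁻¹).map (toEuclideanCLM (𝕜 := ℝ) S)) t =
      charFun (multivariateGaussian h S⁻¹) (toEuclideanCLM (𝕜 := ℝ) S t) := by
    rw [charFun_apply, charFun_apply, integral_map (by fun_prop) (by fun_prop)]
    simp_rw [hsym]
  rw [e1, charFun_multivariateGaussian hinv, charFun_multivariateGaussian hS.posSemidef, hsym]
  congr 3
  rw [ofLp_toEuclideanCLM, mulVec_mulVec, Matrix.nonsing_inv_mul _ hdet, one_mulVec,
    dotProduct_comm]

theorem lintegral_multivariateGaussian_inv {S : Matrix ι ι ℝ} (hS : S.PosDef)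
    (h : EuclideanSpace ℝ ι) {F : EuclideanSpace ℝ ι → ℝ≥0∞} (hF : Measurable F) :
    ENNReal.ofReal (Real.exp ((h ⬝ᵥ S *ᵥ h) / 2)) *
      ∫⁻ z, F (toEuclideanCLM (𝕜 := ℝ) S z) ∂(multivariateGaussian h S⁻¹) =
      ∫⁻ d, F d * ENNReal.ofReal (Real.exp ⟪h, d⟫) ∂(multivariateGaussian 0 S) := by
  rw [lintegral_multivariateGaussian_tilt hS.posSemidef h hF,
    ← map_toEuclideanCLM_multivariateGaussian_inv hS, lintegral_map hF (by fun_prop)]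

end GaussianShift

/-! ### Square integrability and centring of the score. -/

section Score

open scoped ENNReal RealInnerProductSpace

variable {Z : Type*} [MeasurableSpace Z] {m : ℕ} {μ : Measure Z}
  {Θ : Set (EuclideanSpace ℝ (Fin m))} {p : EuclideanSpace ℝ (Fin m) → Z → ℝ}
  {θ₀ : EuclideanSpace ℝ (Fin m)} {s : Z → EuclideanSpace ℝ (Fin m)}

theorem IsDensityFamily.isProbabilityMeasure_obsLaw (hp : IsDensityFamily μ Θ p)
    {θ : EuclideanSpace ℝ (Fin m)} (hθ : θ ∈ Θ) : IsProbabilityMeasure (obsLaw μ p θ) :=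
  ⟨by rw [obsLaw, withDensity_apply _ MeasurableSet.univ, Measure.restrict_univ,
    hp.lintegral_eq_one θ hθ]⟩

theorem IsDensityFamily.integrable (hp : IsDensityFamily μ Θ p)
    {θ : EuclideanSpace ℝ (Fin m)} (hθ : θ ∈ Θ) :
    Integrable (p θ) μ ∧ ∫ z, p θ z ∂μ = 1 :=
  integrable_of_lintegral_ofReal_eq_one (hp.measurable θ hθ) (hp.nonneg θ hθ)
    (hp.lintegral_eq_one θ hθ)

theorem IsDensityFamily.integrable_obsLaw_iff (hp : IsDensityFamily μ Θ p)
    {θ : EuclideanSpace ℝ (Fin m)} (hθ : θ ∈ Θ) (F : Z → ℝ) :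
    Integrable F (obsLaw μ p θ) ↔ Integrable (fun z => F z * p θ z) μ := by
  rw [obsLaw, integrable_withDensity_iff (hp.measurable θ hθ).ennreal_ofReal
    (ae_of_all _ fun _ => ENNReal.ofReal_lt_top)]
  simp_rw [ENNReal.toReal_ofReal (hp.nonneg θ hθ _)]

theorem IsDensityFamily.integral_obsLaw (hp : IsDensityFamily μ Θ p)
    {θ : EuclideanSpace ℝ (Fin m)} (hθ : θ ∈ Θ) (F : Z → ℝ) :
    ∫ z, F z ∂(obsLaw μ p θ) = ∫ z, F z * p θ z ∂μ := by
  rw [obsLaw, integral_withDensity_eq_integral_toReal_smul (hp.measurable θ hθ).ennreal_ofReal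
    (ae_of_all _ fun _ => ENNReal.ofReal_lt_top)]
  simp_rw [ENNReal.toReal_ofReal (hp.nonneg θ hθ _), smul_eq_mul, mul_comm]

theorem eventually_add_mem_of_mem_interior (hθ₀ : θ₀ ∈ interior Θ) :
    ∀ᶠ h in 𝓝 (0 : EuclideanSpace ℝ (Fin m)), θ₀ + h ∈ Θ := by
  have h1 : Tendsto (fun h : EuclideanSpace ℝ (Fin m) => θ₀ + h) (𝓝 0) (𝓝 θ₀) := by
    have : Continuous fun h : EuclideanSpace ℝ (Fin m) => θ₀ + h := by fun_prop
    simpa using this.tendsto 0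
  exact h1 (mem_interior_iff_mem_nhds.1 hθ₀)

/-- The remainder in the definition of differentiability in quadratic mean. -/
def dqmRemainder (p : EuclideanSpace ℝ (Fin m) → Z → ℝ) (θ₀ : EuclideanSpace ℝ (Fin m))
    (s : Z → EuclideanSpace ℝ (Fin m)) (h : EuclideanSpace ℝ (Fin m)) (z : Z) : ℝ :=
  √(p (θ₀ + h) z) - √(p θ₀ z) - 1 / 2 * ⟪h, s z⟫ * √(p θ₀ z)

theorem measurable_dqmRemainder (hp : IsDensityFamily μ Θ p) (hθ : θ₀ ∈ Θ) (hs : Measurable s)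
    {h : EuclideanSpace ℝ (Fin m)} (hh : θ₀ + h ∈ Θ) : Measurable (dqmRemainder p θ₀ s h) := by
  have := hp.measurable _ hθ
  have := hp.measurable _ hh
  unfold dqmRemainder
  fun_prop

theorem IsDQM.integrable_remainder (hp : IsDensityFamily μ Θ p) (hθ₀ : θ₀ ∈ interior Θ)
    (hs : IsDQM μ p θ₀ s) {ε : ℝ} (hε : 0 < ε) :
    ∀ᶠ h in 𝓝 (0 : EuclideanSpace ℝ (Fin m)), θ₀ + h ∈ Θ ∧
      Integrable (fun z => dqmRemainder p θ₀ s h z ^ 2) μ ∧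
      ∫ z, dqmRemainder p θ₀ s h z ^ 2 ∂μ ≤ ε * ‖h‖ ^ 2 := by
  filter_upwards [eventually_add_mem_of_mem_interior hθ₀, hs.2 ε hε] with h hh hb
  have hm := measurable_dqmRemainder hp (interior_subset hθ₀) hs.1 hh
  have hi : Integrable (fun z => dqmRemainder p θ₀ s h z ^ 2) μ := by
    refine ⟨by fun_prop, ?_⟩
    rw [hasFiniteIntegral_iff_ofReal (ae_of_all _ fun _ => sq_nonneg _)]
    exact hb.trans_lt ENNReal.ofReal_lt_top
  refine ⟨hh, hi, ?_⟩
  rw [integral_eq_lintegral_of_nonneg_ae (ae_of_all _ fun _ => sq_nonneg _) (by fun_prop)]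
  exact ENNReal.toReal_le_of_le_ofReal (by positivity) hb

/-- Quadratic-mean differentiability along the ray of `h`; dividing by `‖h‖ ^ 2 + 1` removes `h`
from the bound and covers `h = 0`. -/
theorem IsDQM.exists_smul (hp : IsDensityFamily μ Θ p) (hθ₀ : θ₀ ∈ interior Θ)
    (hs : IsDQM μ p θ₀ s) (h : EuclideanSpace ℝ (Fin m)) {ε : ℝ} (hε : 0 < ε) :
    ∃ t : ℝ, 0 < t ∧ t < ε ∧ θ₀ + t • h ∈ Θ ∧
      Integrable (fun z => dqmRemainder p θ₀ s (t • h) z ^ 2) μ ∧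
      ∫ z, dqmRemainder p θ₀ s (t • h) z ^ 2 ∂μ ≤ (ε * t) ^ 2 := by
  have h1 : Tendsto (fun t : ℝ => t • h) (𝓝[>] 0) (𝓝 0) := by
    have : Continuous fun t : ℝ => t • h := by fun_prop
    simpa using (this.tendsto 0).mono_left nhdsWithin_le_nhds
  have h2 := h1.eventually (hs.integrable_remainder hp hθ₀
    (ε := ε ^ 2 / (‖h‖ ^ 2 + 1)) (by positivity))
  have h3 : ∀ᶠ t : ℝ in 𝓝[>] 0, t ∈ Set.Ioo 0 ε := Ioo_mem_nhdsGT hε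
  obtain ⟨t, ht, ht'⟩ := (h2.and h3).exists
  refine ⟨t, ht'.1, ht'.2, ht.1, ht.2.1, ht.2.2.trans ?_⟩
  rw [norm_smul, Real.norm_of_nonneg ht'.1.le, mul_pow, mul_pow]
  have : ‖h‖ ^ 2 / (‖h‖ ^ 2 + 1) ≤ 1 := div_le_one_of_le₀ (by linarith) (by positivity)
  calc ε ^ 2 / (‖h‖ ^ 2 + 1) * (t ^ 2 * ‖h‖ ^ 2)
      = ε ^ 2 * t ^ 2 * (‖h‖ ^ 2 / (‖h‖ ^ 2 + 1)) := by ring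
    _ ≤ ε ^ 2 * t ^ 2 * 1 := by gcongr
    _ = _ := by ring

/-- For one small `t`, the score times the root density is `2 / t` times a combination of two root
densities and the remainder, all square integrable. The square of three terms gives `4 * 3 = 12`. -/
theorem IsDQM.integrable_inner_sq_mul (hp : IsDensityFamily μ Θ p) (hθ₀ : θ₀ ∈ interior Θ)
    (hs : IsDQM μ p θ₀ s) (h : EuclideanSpace ℝ (Fin m)) :
    Integrable (fun z => ⟪h, s z⟫ ^ 2 * p θ₀ z) μ := by
  obtain ⟨t, ht, -, hmem, hi, -⟩ := hs.exists_smul hp hθ₀ h one_pos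
  have hθ := interior_subset hθ₀
  have hsm := hs.1
  have hm := hp.measurable _ hθ
  refine (((hi.add (hp.integrable hmem).1).add (hp.integrable hθ).1).const_mul (12 / t ^ 2)).mono'
    (by fun_prop) (ae_of_all _ fun z => ?_)
  have h0 := hp.nonneg _ hθ z
  have h1 := hp.nonneg _ hmem z
  rw [Real.norm_of_nonneg (by positivity)]
  simp only [Pi.add_apply]
  rw [div_mul_eq_mul_div, le_div_iff₀ (by positivity)]
  have e : t * ⟪h, s z⟫ * √(p θ₀ z) =
      2 * (√(p (θ₀ + t • h) z) - √(p θ₀ z) - dqmRemainder p θ₀ s (t • h) z) := by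
    rw [dqmRemainder, real_inner_smul_left]
    ring
  have e2 : ⟪h, s z⟫ ^ 2 * p θ₀ z * t ^ 2 = (t * ⟪h, s z⟫ * √(p θ₀ z)) ^ 2 := by
    rw [mul_pow, Real.sq_sqrt h0]
    ring
  rw [e2, e]
  have a := Real.sq_sqrt h0
  have b := Real.sq_sqrt h1
  nlinarith [sq_nonneg (√(p (θ₀ + t • h) z) + √(p θ₀ z)),
    sq_nonneg (√(p (θ₀ + t • h) z) + dqmRemainder p θ₀ s (t • h) z),
    sq_nonneg (√(p θ₀ z) - dqmRemainder p θ₀ s (t • h) z)]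

theorem IsDQM.integrable_inner_sq (hp : IsDensityFamily μ Θ p) (hθ₀ : θ₀ ∈ interior Θ)
    (hs : IsDQM μ p θ₀ s) (h : EuclideanSpace ℝ (Fin m)) :
    Integrable (fun z => ⟪h, s z⟫ ^ 2) (obsLaw μ p θ₀) :=
  (hp.integrable_obsLaw_iff (interior_subset hθ₀) _).2 (hs.integrable_inner_sq_mul hp hθ₀ h)

theorem IsDQM.memLp_score (hp : IsDensityFamily μ Θ p) (hθ₀ : θ₀ ∈ interior Θ)
    (hs : IsDQM μ p θ₀ s) : MemLp s 2 (obsLaw μ p θ₀) := by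
  have hsm := hs.1
  rw [memLp_two_iff_integrable_sq_norm (by fun_prop)]
  simp_rw [EuclideanSpace.real_norm_sq_eq]
  refine integrable_finsetSum _ fun i _ => ?_
  simpa [EuclideanSpace.inner_single_left] using!
    hs.integrable_inner_sq hp hθ₀ (EuclideanSpace.single i 1)

/-- Both densities integrate to one, so the first-order term `t * ∫ ⟪h, s⟫ p` equals the integral of
the error in the expansion of the density. Squaring the expansion of its root shows that this error
is `o(t)`. -/
theorem IsDQM.integral_inner_score (hp : IsDensityFamily μ Θ p) (hθ₀ : θ₀ ∈ interior Θ)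
    (hs : IsDQM μ p θ₀ s) (h : EuclideanSpace ℝ (Fin m)) :
    ∫ z, ⟪h, s z⟫ ∂(obsLaw μ p θ₀) = 0 := by
  have hθ := interior_subset hθ₀
  have hsm := hs.1
  have hm := hp.measurable _ hθ
  rw [hp.integral_obsLaw hθ]
  set V := ∫ z, ⟪h, s z⟫ ^ 2 * p θ₀ z ∂μ with hV
  have iV := hs.integrable_inner_sq_mul hp hθ₀ h
  obtain ⟨ip, ep⟩ := hp.integrable hθ
  have hV0 : 0 ≤ V := integral_nonneg fun z => mul_nonneg (sq_nonneg _) (hp.nonneg _ hθ z)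
  have ig : Integrable (fun z => ⟪h, s z⟫ * p θ₀ z) μ := by
    refine (iV.add ip).mono' (by fun_prop) (ae_of_all _ fun z => ?_)
    have h0 := hp.nonneg _ hθ z
    rw [Real.norm_eq_abs, abs_mul, abs_of_nonneg h0]
    simp only [Pi.add_apply]
    have : |⟪h, s z⟫| ≤ ⟪h, s z⟫ ^ 2 + 1 := by
      rw [← sq_abs]
      nlinarith [sq_nonneg (|⟪h, s z⟫| - 1), abs_nonneg (⟪h, s z⟫)]
    nlinarith
  have key : ∀ ε : ℝ, 0 < ε →
      |∫ z, ⟪h, s z⟫ * p θ₀ z ∂μ| ≤ 2 * ε + ε * V + 2 * ε ^ 2 * ε := by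
    intro ε hε
    obtain ⟨t, ht, htε, hmem, hi, hle⟩ := hs.exists_smul hp hθ₀ h hε
    obtain ⟨ip', ep'⟩ := hp.integrable hmem
    set r := dqmRemainder p θ₀ s (t • h) with hr
    have hpt (z : Z) : |t * (⟪h, s z⟫ * p θ₀ z) - (p (θ₀ + t • h) z - p θ₀ z)| ≤
        ε * t * p θ₀ z + r z ^ 2 / (ε * t) + t ^ 2 / 2 * (⟪h, s z⟫ ^ 2 * p θ₀ z) + 2 * r z ^ 2 := by
      have h0 := hp.nonneg _ hθ z
      have h1 := hp.nonneg _ hmem z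
      have e : √(p (θ₀ + t • h) z) =
          √(p θ₀ z) + t / 2 * ⟪h, s z⟫ * √(p θ₀ z) + r z := by
        rw [hr, dqmRemainder, real_inner_smul_left]
        ring
      have e1 : p (θ₀ + t • h) z =
          (√(p θ₀ z) + t / 2 * ⟪h, s z⟫ * √(p θ₀ z) + r z) ^ 2 := by
        rw [← e, Real.sq_sqrt h1]
      set q := √(p θ₀ z)
      have e0 : p θ₀ z = q ^ 2 := (Real.sq_sqrt h0).symm
      set g := ⟪h, s z⟫
      rw [e1, e0]
      -- The weight `ε * t` balances the two terms, as the integral of `r ^ 2` is at most `(ε * t) ^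
      -- 2`.
      have b1 : |2 * (q * r z)| ≤ ε * t * q ^ 2 + r z ^ 2 / (ε * t) := by
        have hc : 0 < ε * t := by positivity
        have : ε * t * q ^ 2 + r z ^ 2 / (ε * t) - 2 * (q * r z) =
            (ε * t * q - r z) ^ 2 / (ε * t) := by field_simp; ring
        have : ε * t * q ^ 2 + r z ^ 2 / (ε * t) + 2 * (q * r z) =
            (ε * t * q + r z) ^ 2 / (ε * t) := by field_simp; ring
        have := div_nonneg (sq_nonneg (ε * t * q - r z)) hc.le
        have := div_nonneg (sq_nonneg (ε * t * q + r z)) hc.le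
        rw [abs_le]
        constructor <;> linarith
      have b2 : (t / 2 * g * q + r z) ^ 2 ≤ t ^ 2 / 2 * (g ^ 2 * q ^ 2) + 2 * r z ^ 2 := by
        nlinarith [sq_nonneg (t / 2 * g * q - r z)]
      have b3 := sq_nonneg (t / 2 * g * q + r z)
      rw [abs_le] at b1 ⊢
      constructor <;> nlinarith [b1.1, b1.2]
    have i1 : Integrable (fun z => t * (⟪h, s z⟫ * p θ₀ z) - (p (θ₀ + t • h) z - p θ₀ z)) μ :=
      (ig.const_mul t).sub (ip'.sub ip)
    have j1 : Integrable (fun z => ε * t * p θ₀ z) μ := ip.const_mul _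
    have j2 : Integrable (fun z => r z ^ 2 / (ε * t)) μ := hi.div_const _
    have j3 : Integrable (fun z => t ^ 2 / 2 * (⟪h, s z⟫ ^ 2 * p θ₀ z)) μ := iV.const_mul _
    have j4 : Integrable (fun z => 2 * r z ^ 2) μ := hi.const_mul _
    have j12 : Integrable (fun z => ε * t * p θ₀ z + r z ^ 2 / (ε * t)) μ := j1.add j2
    have j123 : Integrable (fun z => ε * t * p θ₀ z + r z ^ 2 / (ε * t) +
        t ^ 2 / 2 * (⟪h, s z⟫ ^ 2 * p θ₀ z)) μ := j12.add j3
    have e1 : ∫ z, (t * (⟪h, s z⟫ * p θ₀ z) - (p (θ₀ + t • h) z - p θ₀ z)) ∂μ =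
        t * ∫ z, ⟪h, s z⟫ * p θ₀ z ∂μ := by
      rw [integral_sub (ig.const_mul t) (f := fun z => t * (⟪h, s z⟫ * p θ₀ z))
        (g := fun z => p (θ₀ + t • h) z - p θ₀ z) (ip'.sub ip), integral_sub ip' ip, ep, ep',
        integral_const_mul]
      ring
    have e2 : ∫ z, (ε * t * p θ₀ z + r z ^ 2 / (ε * t) + t ^ 2 / 2 * (⟪h, s z⟫ ^ 2 * p θ₀ z) +
        2 * r z ^ 2) ∂μ = ε * t + (∫ z, r z ^ 2 ∂μ) / (ε * t) + t ^ 2 / 2 * V +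
          2 * ∫ z, r z ^ 2 ∂μ := by
      rw [integral_add j123 j4, integral_add j12 j3, integral_add j1 j2,
        integral_const_mul, integral_const_mul, integral_const_mul, integral_div, ep, mul_one]
    have h4 := (norm_integral_le_integral_norm (μ := μ) (f := fun z =>
      t * (⟪h, s z⟫ * p θ₀ z) - (p (θ₀ + t • h) z - p θ₀ z))).trans
      (integral_mono i1.norm (j123.add j4) hpt)
    change _ ≤ ∫ z, (ε * t * p θ₀ z + r z ^ 2 / (ε * t) + t ^ 2 / 2 * (⟪h, s z⟫ ^ 2 * p θ₀ z) +
        2 * r z ^ 2) ∂μ at h4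
    rw [e1, e2, Real.norm_eq_abs, abs_mul, abs_of_pos ht] at h4
    have hc : 0 < ε * t := by positivity
    have h5 : (∫ z, r z ^ 2 ∂μ) / (ε * t) ≤ ε * t := by
      rw [div_le_iff₀ hc]
      linarith
    have h6 : t * |∫ z, ⟪h, s z⟫ * p θ₀ z ∂μ| ≤ t * (2 * ε + ε * V + 2 * ε ^ 2 * ε) := by
      have a1 : t ^ 2 / 2 * V ≤ t * (ε * V) := by
        have := mul_le_mul_of_nonneg_right htε.le (mul_nonneg ht.le hV0)
        nlinarith [mul_nonneg (sq_nonneg t) hV0]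
      have a2 : (ε * t) ^ 2 ≤ t * (ε ^ 2 * ε) := by
        have := mul_le_mul_of_nonneg_right htε.le (mul_nonneg ht.le (sq_nonneg ε))
        nlinarith
      linarith
    exact le_of_mul_le_mul_left h6 ht
  have hlim : Tendsto (fun ε : ℝ => 2 * ε + ε * V + 2 * ε ^ 2 * ε) (𝓝[>] 0) (𝓝 0) := by
    have : Continuous fun ε : ℝ => 2 * ε + ε * V + 2 * ε ^ 2 * ε := by fun_prop
    simpa using (this.tendsto 0).mono_left nhdsWithin_le_nhds
  have := ge_of_tendsto hlim (eventually_nhdsWithin_of_forall fun ε hε => key ε hε)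
  exact abs_eq_zero.1 (le_antisymm this (abs_nonneg _))

theorem IsDQM.integral_score (hp : IsDensityFamily μ Θ p) (hθ₀ : θ₀ ∈ interior Θ)
    (hs : IsDQM μ p θ₀ s) : ∫ z, s z ∂(obsLaw μ p θ₀) = 0 := by
  have := hp.isProbabilityMeasure_obsLaw (interior_subset hθ₀)
  refine ext_inner_left ℝ fun h => ?_
  rw [← integral_inner ((hs.memLp_score hp hθ₀).integrable (by norm_num)),
    hs.integral_inner_score hp hθ₀, inner_zero_right]

end Score

/-! ### Truncated scores and their exponential moments. -/

section ScoreApproximation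

open scoped ENNReal RealInnerProductSpace

variable {Z : Type*} [MeasurableSpace Z] {m : ℕ}

/-- A centred approximation of the score by functions which are `o(√n)` uniformly. -/
structure IsScoreApprox (P : Measure Z) (s : Z → EuclideanSpace ℝ (Fin m))
    (u : ℕ → Z → EuclideanSpace ℝ (Fin m)) (δ : ℕ → ℝ) : Prop where
  measurable : ∀ n, Measurable (u n)
  integral_eq_zero : ∀ n, ∫ z, u n z ∂P = 0
  bound : ∀ n z, ‖u n z‖ ≤ δ n * √n
  tendsto_bound : Tendsto δ atTop (𝓝 0)
  integrable_sub_sq : ∀ n, Integrable (fun z => ‖u n z - s z‖ ^ 2) P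
  tendsto_sub_sq : Tendsto (fun n => ∫ z, ‖u n z - s z‖ ^ 2 ∂P) atTop (𝓝 0)
  tendsto_inner_sq : ∀ h, Tendsto (fun n => ∫ z, ⟪h, u n z⟫ ^ 2 ∂P) atTop
    (𝓝 (∫ z, ⟪h, s z⟫ ^ 2 ∂P))

/-- The score is truncated and recentred; the limits follow by dominated convergence. Bounded scores
have all exponential moments, which the score itself may lack. -/
theorem exists_isScoreApprox (P : Measure Z) [IsProbabilityMeasure P]
    {s : Z → EuclideanSpace ℝ (Fin m)} (hsm : Measurable s) (hs : MemLp s 2 P)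
    (hs0 : ∫ z, s z ∂P = 0) : ∃ u δ, IsScoreApprox P s u δ := by
  -- Any level tending to infinity more slowly than `√n` would do.
  let τ : ℕ → ℝ := fun n => √√(n : ℝ)
  have hτ : Tendsto τ atTop atTop :=
    Real.tendsto_sqrt_atTop.comp (Real.tendsto_sqrt_atTop.comp tendsto_natCast_atTop_atTop)
  let r : ℕ → Z → EuclideanSpace ℝ (Fin m) := fun n => Set.indicator {z | ‖s z‖ ≤ τ n} s
  have hset (n : ℕ) : MeasurableSet {z | ‖s z‖ ≤ τ n} := measurableSet_le (by fun_prop) (by fun_prop)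
  have hrm (n : ℕ) : Measurable (r n) := hsm.indicator (hset n)
  have hrs (n : ℕ) (z : Z) : ‖r n z‖ ≤ ‖s z‖ := norm_indicator_le_norm_self _ _
  have hrτ (n : ℕ) (z : Z) : ‖r n z‖ ≤ τ n := by
    by_cases h : ‖s z‖ ≤ τ n
    · exact (hrs n z).trans h
    · have : r n z = 0 := Set.indicator_of_notMem (s := {z | ‖s z‖ ≤ τ n}) h s
      rw [this, norm_zero]
      exact Real.sqrt_nonneg _
  have hsi : Integrable s P := hs.integrable (by norm_num)
  have hri (n : ℕ) : Integrable (r n) P := hsi.mono (hrm n).aestronglyMeasurable (ae_of_all _ (hrs n))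
  have hlim (z : Z) : Tendsto (fun n => r n z) atTop (𝓝 (s z)) := by
    refine tendsto_const_nhds.congr' ?_
    filter_upwards [hτ.eventually_ge_atTop ‖s z‖] with n hn
    exact (Set.indicator_of_mem (by exact hn) _).symm
  let c : ℕ → EuclideanSpace ℝ (Fin m) := fun n => ∫ z, r n z ∂P
  have hc : Tendsto c atTop (𝓝 0) := by
    rw [← hs0]
    exact tendsto_integral_of_dominated_convergence (fun z => ‖s z‖)
      (fun n => (hrm n).aestronglyMeasurable) hsi.norm (fun n => ae_of_all _ (hrs n))
      (ae_of_all _ hlim)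
  set C := ∫ z, ‖s z‖ ∂P with hC
  have hcC (n : ℕ) : ‖c n‖ ≤ C :=
    (norm_integral_le_integral_norm _).trans (integral_mono (hri n).norm hsi.norm (hrs n))
  have hcτ (n : ℕ) : ‖c n‖ ≤ τ n := by
    simpa using norm_integral_le_of_norm_le_const (μ := P) (ae_of_all _ (hrτ n))
  have hulim (z : Z) : Tendsto (fun n => r n z - c n) atTop (𝓝 (s z)) := by
    simpa using (hlim z).sub hc
  have hsq : Integrable (fun z => ‖s z‖ ^ 2) P := (memLp_two_iff_integrable_sq_norm
    hsm.aestronglyMeasurable).1 hs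
  have hub (n : ℕ) (z : Z) : ‖r n z - c n‖ ≤ ‖s z‖ + C :=
    (norm_sub_le _ _).trans (add_le_add (hrs n z) (hcC n))
  have hub' (n : ℕ) (z : Z) : ‖r n z - c n - s z‖ ≤ 2 * ‖s z‖ + C :=
    (norm_sub_le _ _).trans (by linarith [hub n z])
  have hm1 (n : ℕ) : Measurable fun z => r n z - c n := (hrm n).sub_const _
  have hdom : Integrable (fun z => 8 * ‖s z‖ ^ 2 + 2 * C ^ 2) P :=
    (hsq.const_mul 8).add (integrable_const _)
  have hdle (n : ℕ) (z : Z) : ‖(‖r n z - c n - s z‖ ^ 2)‖ ≤ 8 * ‖s z‖ ^ 2 + 2 * C ^ 2 := by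
    rw [Real.norm_of_nonneg (sq_nonneg _)]
    have := pow_le_pow_left₀ (norm_nonneg _) (hub' n z) 2
    nlinarith [sq_nonneg (2 * ‖s z‖ - C)]
  refine ⟨fun n z => r n z - c n, fun n => 2 * τ n / √n, hm1, fun n => ?_, fun n z => ?_, ?_,
    fun n => ?_, ?_, fun h => ?_⟩
  · rw [integral_sub (hri n) (integrable_const _)]
    simp [c]
  · have h1 : ‖r n z - c n‖ ≤ 2 * τ n :=
      (norm_sub_le _ _).trans (by linarith [hrτ n z, hcτ n])
    -- For `n = 0` the level is zero, so both sides vanish.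
    rcases Nat.eq_zero_or_pos n with rfl | hn
    · simpa [τ] using h1
    · have : 0 < √(n : ℝ) := Real.sqrt_pos.2 (Nat.cast_pos.2 hn)
      rwa [div_mul_cancel₀ _ this.ne']
  · have h1 : Tendsto (fun n => 2 * (τ n)⁻¹) atTop (𝓝 0) := by
      simpa using (tendsto_inv_atTop_zero.comp hτ).const_mul 2
    refine h1.congr' ?_
    filter_upwards [hτ.eventually_gt_atTop 0] with n hn
    have : √(n : ℝ) = τ n ^ 2 := (Real.sq_sqrt (Real.sqrt_nonneg _)).symm
    rw [this]
    field_simp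
  · exact hdom.mono' (((hm1 n).sub hsm).norm.pow_const 2).aestronglyMeasurable
      (ae_of_all _ (hdle n))
  · have := tendsto_integral_of_dominated_convergence (F := fun n z => ‖r n z - c n - s z‖ ^ 2)
      (f := fun _ => (0 : ℝ)) (μ := P) _
      (fun n => (((hm1 n).sub hsm).norm.pow_const 2).aestronglyMeasurable) hdom
      (fun n => ae_of_all _ (hdle n)) (ae_of_all _ fun z => by
        simpa using (((hulim z).sub_const (s z)).norm.pow 2))
    simpa using this
  · refine tendsto_integral_of_dominated_convergence
      (fun z => ‖h‖ ^ 2 * (8 * ‖s z‖ ^ 2 + 2 * C ^ 2))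
      (fun n => by have := hm1 n; fun_prop) (hdom.const_mul _)
      (fun n => ae_of_all _ fun z => ?_) (ae_of_all _ fun z => ?_)
    · rw [Real.norm_of_nonneg (sq_nonneg _), ← sq_abs]
      have h1 := pow_le_pow_left₀ (abs_nonneg _) (abs_real_inner_le_norm h (r n z - c n)) 2
      have h2 := pow_le_pow_left₀ (norm_nonneg _) (hub n z) 2
      refine h1.trans ?_
      rw [mul_pow]
      gcongr
      nlinarith [sq_nonneg (‖s z‖ - C), sq_nonneg (‖s z‖)]
    · exact ((tendsto_const_nhds.inner (hulim z)).pow 2)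

namespace IsScoreApprox

variable {P : Measure Z} {s : Z → EuclideanSpace ℝ (Fin m)}
  {u : ℕ → Z → EuclideanSpace ℝ (Fin m)} {δ : ℕ → ℝ}

/-- The scaled linear statistic `h'u(z) / √n`. -/
def lin (u : ℕ → Z → EuclideanSpace ℝ (Fin m)) (h : EuclideanSpace ℝ (Fin m)) (n : ℕ) (z : Z) : ℝ :=
  ⟪h, u n z⟫ / √n

theorem measurable_lin (hu : IsScoreApprox P s u δ) (h : EuclideanSpace ℝ (Fin m)) (n : ℕ) :
    Measurable (lin u h n) := by
  have := hu.measurable n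
  unfold lin
  fun_prop

theorem abs_lin_le (hu : IsScoreApprox P s u δ) (h : EuclideanSpace ℝ (Fin m)) (n : ℕ) (z : Z) :
    |lin u h n z| ≤ ‖h‖ * |δ n| := by
  rcases Nat.eq_zero_or_pos n with rfl | hn
  · simp only [lin, CharP.cast_eq_zero, Real.sqrt_zero, div_zero, abs_zero]
    positivity
  · have h0 : 0 < √(n : ℝ) := Real.sqrt_pos.2 (Nat.cast_pos.2 hn)
    rw [lin, abs_div, abs_of_pos h0, div_le_iff₀ h0, mul_assoc]
    refine (abs_real_inner_le_norm _ _).trans (mul_le_mul_of_nonneg_left ?_ (norm_nonneg _))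
    refine (hu.bound n z).trans ?_
    gcongr
    exact le_abs_self _

theorem tendsto_abs_lin_bound (hu : IsScoreApprox P s u δ) (h : EuclideanSpace ℝ (Fin m)) :
    Tendsto (fun n => ‖h‖ * |δ n|) atTop (𝓝 0) := by
  simpa using hu.tendsto_bound.abs.const_mul ‖h‖

theorem natCast_mul_integral_lin_sq {n : ℕ} (hn : n ≠ 0) (h : EuclideanSpace ℝ (Fin m)) :
    (n : ℝ) * ∫ z, lin u h n z ^ 2 ∂P = ∫ z, ⟪h, u n z⟫ ^ 2 ∂P := by
  have h0 : (n : ℝ) ≠ 0 := Nat.cast_ne_zero.2 hn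
  simp only [lin, div_pow, Real.sq_sqrt (Nat.cast_nonneg n)]
  rw [integral_div]
  field_simp

theorem tendsto_natCast_mul_integral_lin_sq (hu : IsScoreApprox P s u δ)
    (h : EuclideanSpace ℝ (Fin m)) :
    Tendsto (fun n : ℕ => (n : ℝ) * ∫ z, lin u h n z ^ 2 ∂P) atTop
      (𝓝 (∫ z, ⟪h, s z⟫ ^ 2 ∂P)) := by
  refine (hu.tendsto_inner_sq h).congr' ?_
  filter_upwards [eventually_ne_atTop 0] with n hn
  exact (natCast_mul_integral_lin_sq hn h).symm

variable [IsProbabilityMeasure P]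

theorem integrable_of_continuous_lin (hu : IsScoreApprox P s u δ) (h : EuclideanSpace ℝ (Fin m))
    (n : ℕ) {E : Type*} [NormedAddCommGroup E] [SecondCountableTopology E] [MeasurableSpace E]
    [BorelSpace E] {f : ℝ → E} (hf : Continuous f) : Integrable (fun z => f (lin u h n z)) P := by
  obtain ⟨B, hB⟩ := (isCompact_Icc (a := -(‖h‖ * |δ n|)) (b := ‖h‖ * |δ n|)).exists_bound_of_continuousOn
    hf.continuousOn
  refine Integrable.of_bound (hf.measurable.comp (hu.measurable_lin h n)).aestronglyMeasurable B
    (ae_of_all _ fun z => hB _ (abs_le.1 (hu.abs_lin_le h n z)))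

theorem integral_lin (hu : IsScoreApprox P s u δ) (h : EuclideanSpace ℝ (Fin m)) (n : ℕ) :
    ∫ z, lin u h n z ∂P = 0 := by
  have hi : Integrable (u n) P := Integrable.of_bound (hu.measurable n).aestronglyMeasurable _
    (ae_of_all _ (hu.bound n))
  simp only [lin]
  rw [integral_div, integral_inner hi, hu.integral_eq_zero, inner_zero_right, zero_div]

/-- Second-order Taylor expansion: the linear term vanishes by centring, and the cubic remainder is
a uniformly small multiple of the quadratic term. The constant is complex because `c = I` yields the
central limit theorem and `c = 1` the exponential moments. -/
theorem tendsto_natCast_mul_cexp_sub_one (hu : IsScoreApprox P s u δ)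
    (h : EuclideanSpace ℝ (Fin m)) (c : ℂ) :
    Tendsto (fun n : ℕ => (n : ℂ) * (∫ z, Complex.exp (c * lin u h n z) ∂P - 1)) atTop
      (𝓝 (c ^ 2 * (∫ z, ⟪h, s z⟫ ^ 2 ∂P : ℝ) / 2)) := by
  have h1 : Tendsto (fun n : ℕ => c ^ 2 / 2 * ((n : ℝ) * ∫ z, lin u h n z ^ 2 ∂P : ℝ)) atTop
      (𝓝 (c ^ 2 * (∫ z, ⟪h, s z⟫ ^ 2 ∂P : ℝ) / 2)) := by
    have := ((Complex.continuous_ofReal.tendsto _).comp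
      (hu.tendsto_natCast_mul_integral_lin_sq h)).const_mul (c ^ 2 / 2)
    rw [mul_div_right_comm]
    exact this
  have h2 : Tendsto (fun n : ℕ => 3 * ‖c‖ ^ 3 * ((‖h‖ * |δ n|) *
      ((n : ℝ) * ∫ z, lin u h n z ^ 2 ∂P))) atTop (𝓝 0) := by
    simpa using ((hu.tendsto_abs_lin_bound h).mul
      (hu.tendsto_natCast_mul_integral_lin_sq h)).const_mul (3 * ‖c‖ ^ 3)
  rw [tendsto_iff_dist_tendsto_zero] at h1 ⊢
  have h3 : ∀ᶠ n in atTop, ‖c‖ * (‖h‖ * |δ n|) < 1 := by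
    have := (hu.tendsto_abs_lin_bound h).const_mul ‖c‖
    rw [mul_zero] at this
    exact this.eventually_lt_const one_pos
  refine squeeze_zero' (Eventually.of_forall fun _ => dist_nonneg) ?_
    (by simpa using h2.add h1)
  filter_upwards [h3] with n hn
  refine (dist_triangle _ _ _).trans (add_le_add_left ?_ _)
  have i1 : Integrable (fun z => Complex.exp (c * lin u h n z)) P :=
    hu.integrable_of_continuous_lin h n (f := fun x : ℝ => Complex.exp (c * x)) (by fun_prop)
  have i2 : Integrable (fun z => c * (lin u h n z : ℂ)) P :=
    hu.integrable_of_continuous_lin h n (f := fun x : ℝ => c * (x : ℂ)) (by fun_prop)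
  have i3 : Integrable (fun z => c ^ 2 / 2 * ((lin u h n z ^ 2 : ℝ) : ℂ)) P :=
    hu.integrable_of_continuous_lin h n (f := fun x : ℝ => c ^ 2 / 2 * ((x ^ 2 : ℝ) : ℂ))
      (by fun_prop)
  have i4 : Integrable (fun z => lin u h n z ^ 2) P :=
    hu.integrable_of_continuous_lin h n (f := fun x : ℝ => x ^ 2) (by fun_prop)
  have e2 : ∫ z, c * (lin u h n z : ℂ) ∂P = 0 := by
    rw [integral_const_mul, integral_complex_ofReal, hu.integral_lin]
    simp
  have e3 : ∫ z, c ^ 2 / 2 * ((lin u h n z ^ 2 : ℝ) : ℂ) ∂P =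
      c ^ 2 / 2 * (∫ z, lin u h n z ^ 2 ∂P : ℝ) := by
    rw [integral_const_mul, integral_complex_ofReal]
  have e : ∫ z, Complex.exp (c * lin u h n z) ∂P - 1 - c ^ 2 / 2 * (∫ z, lin u h n z ^ 2 ∂P : ℝ) =
      ∫ z, (Complex.exp (c * lin u h n z) - 1 - c * lin u h n z -
        c ^ 2 / 2 * ((lin u h n z ^ 2 : ℝ) : ℂ)) ∂P := by
    have i12 : Integrable (fun z => Complex.exp (c * lin u h n z) - 1) P :=
      i1.sub (integrable_const _)
    have i123 : Integrable (fun z => Complex.exp (c * lin u h n z) - 1 - c * lin u h n z) P :=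
      i12.sub i2
    rw [integral_sub i123 i3, integral_sub i12 i2, integral_sub i1 (integrable_const _), e2, e3]
    simp
  have hpt (z : Z) : ‖Complex.exp (c * lin u h n z) - 1 - c * lin u h n z -
        c ^ 2 / 2 * ((lin u h n z ^ 2 : ℝ) : ℂ)‖ ≤
      3 * ‖c‖ ^ 3 * (‖h‖ * |δ n|) * lin u h n z ^ 2 := by
    have hl := hu.abs_lin_le h n z
    set x := lin u h n z
    have hw : ‖c * (x : ℂ)‖ = ‖c‖ * |x| := by simp
    have hw1 : ‖c * (x : ℂ)‖ ≤ 1 := by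
      rw [hw]
      exact (mul_le_mul_of_nonneg_left hl (norm_nonneg _)).trans hn.le
    have := Complex.norm_exp_sub_sum_le_norm_mul_exp (c * (x : ℂ)) 3
    have hs : ∑ k ∈ Finset.range 3, (c * (x : ℂ)) ^ k / (k.factorial : ℂ) =
        1 + c * x + c ^ 2 / 2 * ((x ^ 2 : ℝ) : ℂ) := by
      simp [Finset.sum_range_succ, Nat.factorial]
      ring
    rw [hs] at this
    have he : Real.exp ‖c * (x : ℂ)‖ ≤ 3 :=
      (Real.exp_le_exp.2 hw1).trans (Real.exp_one_lt_d9.le.trans (by norm_num))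
    calc _ = ‖Complex.exp (c * x) - (1 + c * x + c ^ 2 / 2 * ((x ^ 2 : ℝ) : ℂ))‖ := by
          congr 1; ring
      _ ≤ ‖c * (x : ℂ)‖ ^ 3 * Real.exp ‖c * (x : ℂ)‖ := this
      _ ≤ ‖c * (x : ℂ)‖ ^ 3 * 3 := by gcongr
      _ = 3 * ‖c‖ ^ 3 * |x| * x ^ 2 := by rw [hw, ← sq_abs x]; ring
      _ ≤ _ := by gcongr
  have hn' := norm_integral_le_of_norm_le (i4.const_mul (3 * ‖c‖ ^ 3 * (‖h‖ * |δ n|)))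
    (ae_of_all _ hpt)
  rw [integral_const_mul, ← e] at hn'
  rw [dist_eq_norm]
  calc _ = ‖(n : ℂ) * (∫ z, Complex.exp (c * lin u h n z) ∂P - 1 -
        c ^ 2 / 2 * (∫ z, lin u h n z ^ 2 ∂P : ℝ))‖ := by
        congr 1
        ring
    _ = n * ‖∫ z, Complex.exp (c * lin u h n z) ∂P - 1 -
        c ^ 2 / 2 * (∫ z, lin u h n z ^ 2 ∂P : ℝ)‖ := by simp
    _ ≤ n * (3 * ‖c‖ ^ 3 * (‖h‖ * |δ n|) * ∫ z, lin u h n z ^ 2 ∂P) := by gcongr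
    _ = _ := by ring

/-- Powers of the exponential moments of the scaled statistic converge to the exponential moments
of a normal law. -/
theorem tendsto_pow_cexp (hu : IsScoreApprox P s u δ) (h : EuclideanSpace ℝ (Fin m)) (c : ℂ)
    {k : ℕ → ℕ} {lam : ℝ} (hk : Tendsto (fun n => (k n : ℝ) / n) atTop (𝓝 lam)) :
    Tendsto (fun n : ℕ => (∫ z, Complex.exp (c * lin u h n z) ∂P) ^ k n) atTop
      (𝓝 (Complex.exp (lam * (c ^ 2 * (∫ z, ⟪h, s z⟫ ^ 2 ∂P : ℝ) / 2)))) := by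
  have h0 := hu.tendsto_natCast_mul_cexp_sub_one h c
  have h1 := Complex.tendsto_nat_mul_log_one_add_of_tendsto h0
  have h2 : Tendsto (fun n : ℕ => ∫ z, Complex.exp (c * lin u h n z) ∂P - 1) atTop (𝓝 0) := by
    have h3 : Tendsto (fun n : ℕ => ((n : ℂ))⁻¹) atTop (𝓝 0) := tendsto_inv_atTop_nhds_zero_nat
    have := h3.mul h0
    rw [zero_mul] at this
    refine this.congr' ?_
    filter_upwards [eventually_ne_atTop 0] with n hn
    have : (n : ℂ) ≠ 0 := Nat.cast_ne_zero.2 hn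
    field_simp
  have h4 : ∀ᶠ n : ℕ in atTop, ∫ z, Complex.exp (c * lin u h n z) ∂P - 1 ≠ -1 :=
    h2.eventually_ne (by simp)
  have hk' : Tendsto (fun n => (((k n : ℝ) / n : ℝ) : ℂ)) atTop (𝓝 (lam : ℂ)) :=
    (Complex.continuous_ofReal.tendsto _).comp hk
  -- The power is `exp ((k n / n) * (n * log (1 + a n)))`, where `a n` is the mean minus one.
  refine ((Complex.continuous_exp.tendsto _).comp (hk'.mul h1)).congr' ?_
  filter_upwards [h4, eventually_ne_atTop 0] with n hn hn0
  have hne : ∫ z, Complex.exp (c * lin u h n z) ∂P ≠ 0 := by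
    intro h
    exact hn (by rw [h]; ring)
  have hn1 : (n : ℂ) ≠ 0 := Nat.cast_ne_zero.2 hn0
  simp only [Function.comp_apply, add_sub_cancel]
  conv_rhs => rw [← Complex.exp_log hne, ← Complex.exp_nat_mul]
  congr 1
  push_cast
  field_simp

theorem tendsto_pow_exp (hu : IsScoreApprox P s u δ) (h : EuclideanSpace ℝ (Fin m))
    {k : ℕ → ℕ} {lam : ℝ} (hk : Tendsto (fun n => (k n : ℝ) / n) atTop (𝓝 lam)) :
    Tendsto (fun n : ℕ => (∫ z, Real.exp (lin u h n z) ∂P) ^ k n) atTop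
      (𝓝 (Real.exp (lam * (∫ z, ⟪h, s z⟫ ^ 2 ∂P) / 2))) := by
  have h1 := (Complex.continuous_re.tendsto _).comp (hu.tendsto_pow_cexp h 1 hk)
  simp only [one_pow, one_mul] at h1
  convert h1 using 2
  · simp only [Function.comp_apply]
    norm_cast
  · rw [← mul_div_assoc]
    norm_cast

end IsScoreApprox

end ScoreApproximation

/-! ### Exponential tilts approximate the local densities in Hellinger distance. -/

section HellingerApproximation

open scoped ENNReal RealInnerProductSpace

variable {Z : Type*} [MeasurableSpace Z] {m : ℕ}

namespace IsScoreApprox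

variable {P : Measure Z} {s : Z → EuclideanSpace ℝ (Fin m)}
  {u : ℕ → Z → EuclideanSpace ℝ (Fin m)} {δ : ℕ → ℝ}

/-- This is `n` times the integrated bound of `IsDQM.eventually_hellinger_le`, apart from the
remainder of differentiability. -/
theorem tendsto_hellinger_bound (hu : IsScoreApprox P s u δ) (h : EuclideanSpace ℝ (Fin m)) :
    Tendsto (fun n : ℕ => 3 / 4 * ‖h‖ ^ 2 * (∫ z, ‖u n z - s z‖ ^ 2 ∂P) +
      3 * ((‖h‖ * |δ n|) ^ 2 / 8 * (n * ∫ z, lin u h n z ^ 2 ∂P) +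
        8 * (∫ z, lin u h n z ^ 2 ∂P) * (n * ∫ z, lin u h n z ^ 2 ∂P))) atTop (𝓝 0) := by
  have h1 := hu.tendsto_natCast_mul_integral_lin_sq h
  have h2 : Tendsto (fun n : ℕ => ∫ z, lin u h n z ^ 2 ∂P) atTop (𝓝 0) := by
    have h3 : Tendsto (fun n : ℕ => ((n : ℝ))⁻¹) atTop (𝓝 0) := tendsto_inv_atTop_nhds_zero_nat
    have := h3.mul h1
    rw [zero_mul] at this
    refine this.congr' ?_
    filter_upwards [eventually_ne_atTop 0] with n hn
    have : (n : ℝ) ≠ 0 := Nat.cast_ne_zero.2 hn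
    field_simp
  have h3 := (((hu.tendsto_abs_lin_bound h).pow 2).div_const 8).mul h1
  have h4 := (h2.const_mul 8).mul h1
  have h5 := hu.tendsto_sub_sq.const_mul (3 / 4 * ‖h‖ ^ 2)
  simpa using h5.add ((h3.add h4).const_mul 3)

variable [IsProbabilityMeasure P]

/-- The exponential moment of the scaled linear statistic. -/
def expMean (P : Measure Z) (u : ℕ → Z → EuclideanSpace ℝ (Fin m)) (h : EuclideanSpace ℝ (Fin m))
    (n : ℕ) : ℝ :=
  ∫ z, Real.exp (lin u h n z) ∂P

theorem integrable_exp_lin (hu : IsScoreApprox P s u δ) (h : EuclideanSpace ℝ (Fin m)) (n : ℕ) :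
    Integrable (fun z => Real.exp (lin u h n z)) P :=
  hu.integrable_of_continuous_lin h n Real.continuous_exp

theorem integrable_lin (hu : IsScoreApprox P s u δ) (h : EuclideanSpace ℝ (Fin m)) (n : ℕ) :
    Integrable (lin u h n) P :=
  hu.integrable_of_continuous_lin h n continuous_id

theorem integrable_lin_sq (hu : IsScoreApprox P s u δ) (h : EuclideanSpace ℝ (Fin m)) (n : ℕ) :
    Integrable (fun z => lin u h n z ^ 2) P :=
  hu.integrable_of_continuous_lin h n (f := fun x : ℝ => x ^ 2) (by fun_prop)

theorem one_le_expMean (hu : IsScoreApprox P s u δ) (h : EuclideanSpace ℝ (Fin m)) (n : ℕ) :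
    1 ≤ expMean P u h n := by
  have i : Integrable (fun z => lin u h n z + 1) P :=
    (hu.integrable_lin h n).add (integrable_const _)
  have := integral_mono i (hu.integrable_exp_lin h n) fun z => Real.add_one_le_exp (lin u h n z)
  rw [integral_add (hu.integrable_lin h n) (integrable_const _), hu.integral_lin] at this
  simpa [expMean] using this

theorem expMean_sub_one_le (hu : IsScoreApprox P s u δ) (h : EuclideanSpace ℝ (Fin m)) {n : ℕ}
    (hn : ‖h‖ * |δ n| ≤ 1) : expMean P u h n - 1 ≤ ∫ z, lin u h n z ^ 2 ∂P := by
  have hpt (z : Z) : Real.exp (lin u h n z) ≤ lin u h n z ^ 2 + (lin u h n z + 1) := by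
    have := (abs_le.1 (Real.abs_exp_sub_one_sub_id_le ((hu.abs_lin_le h n z).trans hn))).2
    linarith
  have i : Integrable (fun z => lin u h n z + 1) P :=
    (hu.integrable_lin h n).add (integrable_const _)
  have := integral_mono (hu.integrable_exp_lin h n) ((hu.integrable_lin_sq h n).add i) hpt
  change _ ≤ ∫ z, (lin u h n z ^ 2 + (lin u h n z + 1)) ∂P at this
  rw [integral_add (hu.integrable_lin_sq h n) i,
    integral_add (hu.integrable_lin h n) (integrable_const _), hu.integral_lin] at this
  simp only [integral_const, probReal_univ, smul_eq_mul, mul_one, zero_add] at this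
  rw [expMean]
  linarith

/-- With `y` the linear statistic and `v` its second moment, `exp (y / 2)` is `1 + y / 2` up to `y ^
2 / 4`, and the normaliser contributes at most `2 * v`. After squaring, one factor `y ^ 2` is
bounded uniformly, so that the mean is `o(1 / n)`. -/
theorem sq_one_add_sub_sqrt_le (hu : IsScoreApprox P s u δ) (h : EuclideanSpace ℝ (Fin m)) {n : ℕ}
    (hn : ‖h‖ * |δ n| ≤ 1) (z : Z) :
    (1 + lin u h n z / 2 - √(Real.exp (lin u h n z) / expMean P u h n)) ^ 2 ≤
      (‖h‖ * |δ n|) ^ 2 * lin u h n z ^ 2 / 8 + 8 * (∫ z, lin u h n z ^ 2 ∂P) ^ 2 := by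
  have hM1 := hu.one_le_expMean h n
  have hM2 := hu.expMean_sub_one_le h hn
  have hB := hu.abs_lin_le h n z
  set M := expMean P u h n
  set v := ∫ z, lin u h n z ^ 2 ∂P
  set y := lin u h n z
  have hy : |y| ≤ 1 := hB.trans hn
  have hexp : √(Real.exp y) = Real.exp (y / 2) := (Real.exp_half y).symm
  rw [Real.sqrt_div' _ (by linarith), hexp]
  have h1 : |Real.exp (y / 2) - 1 - y / 2| ≤ (y / 2) ^ 2 := by
    refine Real.abs_exp_sub_one_sub_id_le ?_
    rw [abs_div, abs_two]
    linarith
  have hs1 : 1 ≤ √M := Real.one_le_sqrt.2 hM1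
  have hsM : √M ≤ M := by
    conv_rhs => rw [← Real.sq_sqrt (show 0 ≤ M by linarith)]
    nlinarith
  have he2 : Real.exp (y / 2) ≤ 2 := by
    have := (abs_le.1 h1).2
    have := abs_le.1 hy
    nlinarith
  have h2 : Real.exp (y / 2) - Real.exp (y / 2) / √M ≤ 2 * v := by
    have : Real.exp (y / 2) - Real.exp (y / 2) / √M = Real.exp (y / 2) * ((√M - 1) / √M) := by
      field_simp
    rw [this]
    have h3 : (√M - 1) / √M ≤ v := (div_le_self (by linarith) hs1).trans (by linarith)
    exact mul_le_mul he2 h3 (div_nonneg (by linarith) (by linarith)) (by norm_num)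
  have h3 : 0 ≤ Real.exp (y / 2) - Real.exp (y / 2) / √M := by
    have := div_le_self (Real.exp_nonneg (y / 2)) hs1
    linarith
  have habs : |1 + y / 2 - Real.exp (y / 2) / √M| ≤ y ^ 2 / 4 + 2 * v := by
    rw [abs_le] at h1 ⊢
    constructor <;> nlinarith [h1.1, h1.2]
  calc _ = |1 + y / 2 - Real.exp (y / 2) / √M| ^ 2 := (sq_abs _).symm
    _ ≤ (y ^ 2 / 4 + 2 * v) ^ 2 := by gcongr
    _ ≤ y ^ 2 * y ^ 2 / 8 + 8 * v ^ 2 := by nlinarith [sq_nonneg (y ^ 2 / 4 - 2 * v)]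
    _ ≤ (‖h‖ * |δ n|) ^ 2 * y ^ 2 / 8 + 8 * v ^ 2 := by
      have : y ^ 2 ≤ (‖h‖ * |δ n|) ^ 2 := by
        rw [← sq_abs y]
        gcongr
      gcongr

end IsScoreApprox

open IsScoreApprox

variable {μ : Measure Z} {Θ : Set (EuclideanSpace ℝ (Fin m))}
  {p : EuclideanSpace ℝ (Fin m) → Z → ℝ} {θ₀ : EuclideanSpace ℝ (Fin m)}
  {s : Z → EuclideanSpace ℝ (Fin m)} {u : ℕ → Z → EuclideanSpace ℝ (Fin m)} {δ : ℕ → ℝ}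

/-- The exponential tilt of the density at `θ₀` which approximates the density at
`θ₀ + h / √n`. -/
def tiltDensity (μ : Measure Z) (p : EuclideanSpace ℝ (Fin m) → Z → ℝ)
    (θ₀ : EuclideanSpace ℝ (Fin m)) (u : ℕ → Z → EuclideanSpace ℝ (Fin m))
    (h : EuclideanSpace ℝ (Fin m)) (n : ℕ) (z : Z) : ℝ :=
  Real.exp (lin u h n z) / expMean (obsLaw μ p θ₀) u h n

/-- The densities at the local parameters are approximated by exponential tilts with an error of
order `o(n^{-1/2})` in Hellinger distance. -/
theorem IsDQM.eventually_hellinger_le (hp : IsDensityFamily μ Θ p) (hθ₀ : θ₀ ∈ interior Θ)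
    (hs : IsDQM μ p θ₀ s) (hu : IsScoreApprox (obsLaw μ p θ₀) s u δ)
    (h : EuclideanSpace ℝ (Fin m)) {η : ℝ} (hη : 0 < η) :
    ∀ᶠ n : ℕ in atTop, localParam θ₀ h n ∈ Θ ∧
      ∫⁻ z, ENNReal.ofReal ((√(p (localParam θ₀ h n) z) -
        √(p θ₀ z * tiltDensity μ p θ₀ u h n z)) ^ 2) ∂μ ≤ ENNReal.ofReal (η / n) := by
  have hθ := interior_subset hθ₀
  have hP := hp.isProbabilityMeasure_obsLaw hθ
  have hm := hp.measurable _ hθ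
  have hsm := hs.1
  have h0 : Tendsto (fun n : ℕ => (√(n : ℝ))⁻¹ • h) atTop (𝓝 0) := by
    have : Tendsto (fun n : ℕ => (√(n : ℝ))⁻¹) atTop (𝓝 0) :=
      tendsto_inv_atTop_zero.comp (Real.tendsto_sqrt_atTop.comp tendsto_natCast_atTop_atTop)
    simpa using this.smul_const h
  -- With this constant, `3 * n` times the integral of the squared remainder is at most `η / 2`; the
  -- other errors receive the other half.
  have h1 := h0.eventually (hs.integrable_remainder hp hθ₀
    (ε := η / (6 * (‖h‖ ^ 2 + 1))) (by positivity))
  have h2 := (hu.tendsto_hellinger_bound h).eventually_lt_const (half_pos hη)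
  have h3 := (hu.tendsto_abs_lin_bound h).eventually_le_const one_pos
  filter_upwards [h1, h2, h3, eventually_gt_atTop 0] with n ⟨hmem, hri, hrle⟩ hW hB hn
  have hn0 : (0 : ℝ) < n := Nat.cast_pos.2 hn
  refine ⟨hmem, ?_⟩
  set P := obsLaw μ p θ₀ with hPdef
  set r := dqmRemainder p θ₀ s ((√(n : ℝ))⁻¹ • h) with hr
  set v := ∫ z, lin u h n z ^ 2 ∂P with hv
  set D := ∫ z, ‖u n z - s z‖ ^ 2 ∂P with hD
  set B := ‖h‖ * |δ n| with hBdef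
  -- Three errors add up: the remainder of differentiability, the replacement of `s` by `u n`, and
  -- the linearisation of the root of the tilt.
  have hpt (z : Z) : (√(p (localParam θ₀ h n) z) - √(p θ₀ z * tiltDensity μ p θ₀ u h n z)) ^ 2 ≤
      3 * r z ^ 2 + (3 / (4 * n) * ‖h‖ ^ 2 * ‖u n z - s z‖ ^ 2 +
        3 * (B ^ 2 / 8 * lin u h n z ^ 2 + 8 * v ^ 2)) * p θ₀ z := by
    have hz := hp.nonneg _ hθ z
    rw [Real.sqrt_mul hz]
    have e1 : √(p (localParam θ₀ h n) z) = √(p θ₀ z) +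
        1 / 2 * ((√(n : ℝ))⁻¹ * ⟪h, s z⟫) * √(p θ₀ z) + r z := by
      rw [hr, dqmRemainder, real_inner_smul_left, localParam]
      ring
    have k1 := hu.sq_one_add_sub_sqrt_le h hB z
    change (1 + lin u h n z / 2 - √(tiltDensity μ p θ₀ u h n z)) ^ 2 ≤ _ at k1
    set q := √(p θ₀ z)
    have e0 : p θ₀ z = q ^ 2 := (Real.sq_sqrt hz).symm
    set w := √(tiltDensity μ p θ₀ u h n z)
    set b := 1 / 2 * (⟪h, s z - u n z⟫ / √(n : ℝ)) with hb
    have e2 : √(p (localParam θ₀ h n) z) - q * w =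
        r z + b * q + (1 + lin u h n z / 2 - w) * q := by
      rw [e1, hb, inner_sub_right, lin]
      ring
    have k2 : b ^ 2 ≤ 1 / (4 * n) * ‖h‖ ^ 2 * ‖u n z - s z‖ ^ 2 := by
      have := pow_le_pow_left₀ (abs_nonneg _) (abs_real_inner_le_norm h (s z - u n z)) 2
      rw [sq_abs, mul_pow, norm_sub_rev] at this
      rw [hb, mul_pow, div_pow ⟪h, s z - u n z⟫, Real.sq_sqrt hn0.le]
      calc (1 / 2 : ℝ) ^ 2 * (⟪h, s z - u n z⟫ ^ 2 / n) = 1 / (4 * n) * ⟪h, s z - u n z⟫ ^ 2 := by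
            field_simp; ring
        _ ≤ 1 / (4 * n) * (‖h‖ ^ 2 * ‖u n z - s z‖ ^ 2) := by gcongr
        _ = _ := by ring
    rw [e2, e0]
    set a := 1 + lin u h n z / 2 - w
    have k3 : (r z + b * q + a * q) ^ 2 ≤ 3 * r z ^ 2 + (3 * b ^ 2 + 3 * a ^ 2) * q ^ 2 := by
      nlinarith [sq_nonneg (r z - b * q), sq_nonneg (r z - a * q), sq_nonneg (b * q - a * q)]
    refine k3.trans ?_
    have : 3 * b ^ 2 + 3 * a ^ 2 ≤ 3 / (4 * n) * ‖h‖ ^ 2 * ‖u n z - s z‖ ^ 2 +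
        3 * (B ^ 2 / 8 * lin u h n z ^ 2 + 8 * v ^ 2) := by
      have e3 : 3 / (4 * n) * ‖h‖ ^ 2 * ‖u n z - s z‖ ^ 2 =
        3 * (1 / (4 * n) * ‖h‖ ^ 2 * ‖u n z - s z‖ ^ 2) := by ring
      rw [e3]
      linarith
    gcongr
  have j1 : Integrable (fun z => 3 / (4 * n) * ‖h‖ ^ 2 * ‖u n z - s z‖ ^ 2) P :=
    (hu.integrable_sub_sq n).const_mul _
  have j2 : Integrable (fun z => B ^ 2 / 8 * lin u h n z ^ 2) P :=
    (hu.integrable_lin_sq h n).const_mul _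
  have j3 : Integrable (fun z => B ^ 2 / 8 * lin u h n z ^ 2 + 8 * v ^ 2) P :=
    j2.add (integrable_const _)
  have j4 : Integrable (fun z => 3 * (B ^ 2 / 8 * lin u h n z ^ 2 + 8 * v ^ 2)) P :=
    j3.const_mul _
  have j5 : Integrable (fun z => 3 / (4 * n) * ‖h‖ ^ 2 * ‖u n z - s z‖ ^ 2 +
        3 * (B ^ 2 / 8 * lin u h n z ^ 2 + 8 * v ^ 2)) P := j1.add j4
  have j6 := (hp.integrable_obsLaw_iff hθ _).1 j5
  have j7 : Integrable (fun z => 3 * r z ^ 2) μ := hri.const_mul 3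
  have j8 : Integrable (fun z => 3 * r z ^ 2 + (3 / (4 * n) * ‖h‖ ^ 2 * ‖u n z - s z‖ ^ 2 +
        3 * (B ^ 2 / 8 * lin u h n z ^ 2 + 8 * v ^ 2)) * p θ₀ z) μ := j7.add j6
  refine (lintegral_mono fun z => ENNReal.ofReal_le_ofReal (hpt z)).trans ?_
  rw [← ofReal_integral_eq_lintegral_ofReal j8 (ae_of_all _ fun z =>
    (sq_nonneg _).trans (hpt z))]
  refine ENNReal.ofReal_le_ofReal ?_
  rw [integral_add j7 j6, ← hp.integral_obsLaw hθ, integral_add j1 j4, integral_const_mul,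
    integral_const_mul, integral_const_mul, integral_add j2 (integrable_const _),
    integral_const_mul]
  simp only [integral_const, probReal_univ, smul_eq_mul, one_mul]
  rw [← hv, ← hD]
  rw [norm_smul, mul_pow, norm_inv, Real.norm_of_nonneg (Real.sqrt_nonneg _), inv_pow,
    Real.sq_sqrt hn0.le] at hrle
  have k4 : n * ∫ z, r z ^ 2 ∂μ ≤ η / 6 := by
    calc n * ∫ z, r z ^ 2 ∂μ ≤ n * (η / (6 * (‖h‖ ^ 2 + 1)) * ((n : ℝ)⁻¹ * ‖h‖ ^ 2)) := by gcongr
      _ = η / 6 * (‖h‖ ^ 2 / (‖h‖ ^ 2 + 1)) := by field_simp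
      _ ≤ η / 6 * 1 := by
        gcongr
        exact div_le_one_of_le₀ (by linarith) (by positivity)
      _ = _ := mul_one _
  rw [le_div_iff₀ hn0]
  have e : (3 * ∫ z, r z ^ 2 ∂μ + (3 / (4 * n) * ‖h‖ ^ 2 * D +
      3 * (B ^ 2 / 8 * v + 8 * v ^ 2))) * n = 3 * (n * ∫ z, r z ^ 2 ∂μ) +
      (3 / 4 * ‖h‖ ^ 2 * D + 3 * (B ^ 2 / 8 * (n * v) + 8 * v * (n * v))) := by
    field_simp
  rw [e]
  linarith

end HellingerApproximation

/-! ### Replacing the local parameters by exponential tilts for the whole sample. -/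

section ProductApproximation

open scoped ENNReal NNReal RealInnerProductSpace
open IsScoreApprox

variable {Z : Type*} [MeasurableSpace Z] {m : ℕ} {μ : Measure Z}
  {Θ : Set (EuclideanSpace ℝ (Fin m))}
  {p : EuclideanSpace ℝ (Fin m) → Z → ℝ} {θ₀ : EuclideanSpace ℝ (Fin m)}
  {s : Z → EuclideanSpace ℝ (Fin m)} {u : ℕ → Z → EuclideanSpace ℝ (Fin m)} {δ : ℕ → ℝ}

theorem measurable_tiltDensity (hu : IsScoreApprox (obsLaw μ p θ₀) s u δ)
    (h : EuclideanSpace ℝ (Fin m)) (n : ℕ) : Measurable (tiltDensity μ p θ₀ u h n) := by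
  have := hu.measurable_lin h n
  unfold tiltDensity
  fun_prop

theorem tiltDensity_nonneg (h : EuclideanSpace ℝ (Fin m)) (n : ℕ) (z : Z) :
    0 ≤ tiltDensity μ p θ₀ u h n z :=
  div_nonneg (Real.exp_nonneg _) (integral_nonneg fun _ => Real.exp_nonneg _)

theorem lintegral_tiltDensity [IsProbabilityMeasure (obsLaw μ p θ₀)]
    (hu : IsScoreApprox (obsLaw μ p θ₀) s u δ) (h : EuclideanSpace ℝ (Fin m)) (n : ℕ) :
    ∫⁻ z, ENNReal.ofReal (tiltDensity μ p θ₀ u h n z) ∂(obsLaw μ p θ₀) = 1 := by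
  have hi : Integrable (tiltDensity μ p θ₀ u h n) (obsLaw μ p θ₀) :=
    (hu.integrable_exp_lin h n).div_const _
  rw [← ofReal_integral_eq_lintegral_ofReal hi (ae_of_all _ (tiltDensity_nonneg h n))]
  unfold tiltDensity
  rw [integral_div, ← expMean, div_self (by have := hu.one_le_expMean h n; linarith),
    ENNReal.ofReal_one]

theorem lintegral_pi_withDensity_mul_tiltDensity [IsProbabilityMeasure (obsLaw μ p θ₀)]
    (hp : IsDensityFamily μ Θ p) (hθ : θ₀ ∈ Θ)
    (hu : IsScoreApprox (obsLaw μ p θ₀) s u δ) (h : EuclideanSpace ℝ (Fin m)) (n : ℕ)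
    {F : (Fin n → Z) → ℝ≥0∞} (hF : Measurable F) :
    ∫⁻ z, F z ∂(Measure.pi fun _ : Fin n => μ.withDensity fun z =>
        ENNReal.ofReal (p θ₀ z * tiltDensity μ p θ₀ u h n z)) =
      ∫⁻ z, F z * ENNReal.ofReal (∏ i, tiltDensity μ p θ₀ u h n (z i))
        ∂(Measure.pi fun _ => obsLaw μ p θ₀) := by
  have hq := measurable_tiltDensity hu h n
  have e : (μ.withDensity fun z => ENNReal.ofReal (p θ₀ z * tiltDensity μ p θ₀ u h n z)) =
      (obsLaw μ p θ₀).withDensity fun z => ENNReal.ofReal (tiltDensity μ p θ₀ u h n z) := by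
    rw [obsLaw, ← withDensity_mul _ (hp.measurable _ hθ).ennreal_ofReal hq.ennreal_ofReal]
    congr 1
    funext z
    exact ENNReal.ofReal_mul (hp.nonneg _ hθ z)
  rw [e, pi_withDensity_ofReal hq (tiltDensity_nonneg h n) (lintegral_tiltDensity hu h n),
    lintegral_withDensity_eq_lintegral_mul _ (by fun_prop) hF]
  simp only [Pi.mul_apply, mul_comm]

/-- Bounded statistics have the same asymptotic means under the local parameters and under the
exponential tilts. -/
theorem IsDQM.tendsto_lintegral_tiltDensity (hp : IsDensityFamily μ Θ p) (hθ₀ : θ₀ ∈ interior Θ)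
    (hs : IsDQM μ p θ₀ s) (hu : IsScoreApprox (obsLaw μ p θ₀) s u δ)
    (h : EuclideanSpace ℝ (Fin m)) {F : ∀ n : ℕ, (Fin n → Z) → ℝ≥0∞}
    (hF : ∀ n, Measurable (F n)) {C : ℝ≥0} (hFC : ∀ n z, F n z ≤ C) {l : ℝ≥0∞} (hl0 : l ≠ ∞)
    (hl : Tendsto (fun n => ∫⁻ z, F n z ∂(sampleLaw μ p n (localParam θ₀ h n))) atTop (𝓝 l)) :
    Tendsto (fun n => ∫⁻ z, F n z * ENNReal.ofReal (∏ i, tiltDensity μ p θ₀ u h n (z i))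
      ∂(Measure.pi fun _ => obsLaw μ p θ₀)) atTop (𝓝 l) := by
  have hθ := interior_subset hθ₀
  have hP := hp.isProbabilityMeasure_obsLaw hθ
  rw [ENNReal.tendsto_nhds hl0] at hl ⊢
  intro ε hε
  obtain ⟨t, ht, htε⟩ : ∃ t : ℝ, 0 < t ∧ (C : ℝ≥0∞) * ENNReal.ofReal (4 * t) ≤ ε / 2 := by
    have h1 : Tendsto (fun t : ℝ => (C : ℝ≥0∞) * ENNReal.ofReal (4 * t)) (𝓝[>] 0) (𝓝 0) := by
      have h2 : Continuous fun t : ℝ => (C : ℝ≥0∞) * ENNReal.ofReal (4 * t) :=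
        (ENNReal.continuous_const_mul ENNReal.coe_ne_top).comp
          (ENNReal.continuous_ofReal.comp (by fun_prop))
      simpa using (h2.tendsto 0).mono_left nhdsWithin_le_nhds
    have h3 := (h1.eventually_le_const (ENNReal.half_pos hε.ne')).and self_mem_nhdsWithin
    obtain ⟨t, h4, h5⟩ := h3.exists
    exact ⟨t, h5, h4⟩
  -- This choice makes the error `n * (4 * t ^ 2 / n) / (2 * t) + 2 * t` of
  -- `lintegral_pi_withDensity_le` equal to `4 * t`.
  have hH := hs.eventually_hellinger_le hp hθ₀ hu h (η := 4 * t ^ 2) (by positivity)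
  filter_upwards [hl (ε / 2) (ENNReal.half_pos hε.ne'), hH, eventually_gt_atTop 0]
    with n ⟨hn1, hn2⟩ ⟨hmem, hle⟩ hn
  have hn0 : (n : ℝ) ≠ 0 := (Nat.cast_pos.2 hn).ne'
  set q := tiltDensity μ p θ₀ u h n with hq
  have hqm : Measurable q := measurable_tiltDensity hu h n
  have hpm := hp.measurable _ hθ
  have hq0 (z : Z) : 0 ≤ p θ₀ z * q z := mul_nonneg (hp.nonneg _ hθ z) (tiltDensity_nonneg h n z)
  have hq1 : ∫⁻ z, ENNReal.ofReal (p θ₀ z * q z) ∂μ = 1 := by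
    rw [← lintegral_tiltDensity hu h n, obsLaw,
      lintegral_withDensity_eq_lintegral_mul _ hpm.ennreal_ofReal hqm.ennreal_ofReal]
    exact lintegral_congr fun z => ENNReal.ofReal_mul (hp.nonneg _ hθ z)
  have he : (Fintype.card (Fin n) : ℝ) * (4 * t ^ 2 / n) / (2 * t) + 2 * t = 4 * t := by
    rw [Fintype.card_fin]
    field_simp
    ring
  have hle' : ∫⁻ z, ENNReal.ofReal ((√(p θ₀ z * q z) - √(p (localParam θ₀ h n) z)) ^ 2) ∂μ ≤
      ENNReal.ofReal (4 * t ^ 2 / n) := by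
    simpa only [sub_sq_comm] using hle
  have k1 := lintegral_pi_withDensity_le (ι := Fin n) (hp.measurable _ hmem) (hpm.mul hqm)
    (hp.nonneg _ hmem) hq0 (hp.lintegral_eq_one _ hmem) hq1 (by positivity) hle ht (hF n)
    (C := C) (hFC n)
  have k2 := lintegral_pi_withDensity_le (ι := Fin n) (hpm.mul hqm) (hp.measurable _ hmem)
    hq0 (hp.nonneg _ hmem) hq1 (hp.lintegral_eq_one _ hmem) (by positivity) hle' ht (hF n)
    (C := C) (hFC n)
  rw [he] at k1 k2
  have e := lintegral_pi_withDensity_mul_tiltDensity hp hθ hu h n (hF n)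
  simp only [Pi.mul_apply] at k1 k2
  rw [← hq] at e
  rw [e] at k1 k2
  change ∫⁻ z, F n z ∂(sampleLaw μ p n (localParam θ₀ h n)) ≤ _ at k1
  change _ ≤ ∫⁻ z, F n z ∂(sampleLaw μ p n (localParam θ₀ h n)) + _ at k2
  constructor
  · rw [tsub_le_iff_right] at hn1 ⊢
    refine hn1.trans ((add_le_add_left (k1.trans (add_le_add_right htε _)) _).trans ?_)
    rw [add_assoc, ENNReal.add_halves]
  · refine (k2.trans (add_le_add hn2 htε)).trans ?_
    rw [add_assoc, ENNReal.add_halves]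

end ProductApproximation

/-! ### Score sums over blocks of observations. -/

section ScoreSum

open scoped ENNReal NNReal RealInnerProductSpace
open IsScoreApprox

variable {Z : Type*} {m : ℕ}

/-- The scaled sum of the approximate scores of the observations with index in `A`. -/
def scoreSum (u : ℕ → Z → EuclideanSpace ℝ (Fin m)) {n : ℕ} (A : Set (Fin n)) (z : Fin n → Z) :
    EuclideanSpace ℝ (Fin m) :=
  (√(n : ℝ))⁻¹ • ∑ i, A.indicator (fun i => u n (z i)) i

theorem inner_scoreSum (u : ℕ → Z → EuclideanSpace ℝ (Fin m)) {n : ℕ} (A : Set (Fin n))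
    (h : EuclideanSpace ℝ (Fin m)) (z : Fin n → Z) :
    ⟪h, scoreSum u A z⟫ = ∑ i, A.indicator (fun i => lin u h n (z i)) i := by
  classical
  rw [scoreSum, inner_smul_right, inner_sum, Finset.mul_sum]
  refine Finset.sum_congr rfl fun i _ => ?_
  by_cases hi : i ∈ A
  · simp [hi, lin, div_eq_inv_mul]
  · simp [hi]

theorem dependsOn_scoreSum (u : ℕ → Z → EuclideanSpace ℝ (Fin m)) {n : ℕ} (A : Set (Fin n)) :
    DependsOn (scoreSum u A) A := by
  classical
  intro x y hxy
  unfold scoreSum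
  congr 1
  refine Finset.sum_congr rfl fun i _ => ?_
  by_cases hi : i ∈ A
  · simp [hi, hxy i hi]
  · simp [hi]

theorem scoreSum_union (u : ℕ → Z → EuclideanSpace ℝ (Fin m)) {n : ℕ} {A B : Set (Fin n)}
    (hAB : Disjoint A B) (z : Fin n → Z) :
    scoreSum u (A ∪ B) z = scoreSum u A z + scoreSum u B z := by
  simp only [scoreSum, Set.indicator_union_of_disjoint hAB, Finset.sum_add_distrib, smul_add]

variable [MeasurableSpace Z] {P : Measure Z} {s : Z → EuclideanSpace ℝ (Fin m)} {u : ℕ → Z → EuclideanSpace ℝ (Fin m)} {δ : ℕ → ℝ}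

theorem IsScoreApprox.measurable_scoreSum (hu : IsScoreApprox P s u δ) {n : ℕ} (A : Set (Fin n)) :
    Measurable (scoreSum u A) := by
  classical
  unfold scoreSum
  have : Measurable fun z : Fin n → Z => ∑ i, A.indicator (fun i => u n (z i)) i := by
    refine Finset.measurable_fun_sum _ fun i _ => ?_
    by_cases hi : i ∈ A
    · simpa [hi] using! (hu.measurable n).comp (measurable_pi_apply i)
    · simp [hi]
  fun_prop

theorem integral_cexp_inner_scoreSum (P : Measure Z) [IsProbabilityMeasure P]
    (u : ℕ → Z → EuclideanSpace ℝ (Fin m)) {n : ℕ} (A : Set (Fin n))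
    (h : EuclideanSpace ℝ (Fin m)) (c : ℂ) :
    ∫ z, Complex.exp (c * (⟪h, scoreSum u A z⟫ : ℝ)) ∂(Measure.pi fun _ => P) =
      (∫ z, Complex.exp (c * lin u h n z) ∂P) ^ A.ncard := by
  classical
  have e (z : Fin n → Z) : Complex.exp (c * (⟪h, scoreSum u A z⟫ : ℝ)) =
      ∏ i, (if i ∈ A then fun x => Complex.exp (c * lin u h n x) else fun _ => 1) (z i) := by
    rw [inner_scoreSum, Complex.ofReal_sum, Finset.mul_sum, Complex.exp_sum]
    refine Finset.prod_congr rfl fun i _ => ?_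
    by_cases hi : i ∈ A <;> simp [hi]
  simp_rw [e]
  rw [integral_fintype_prod_eq_prod
    (f := fun i => if i ∈ A then fun x => Complex.exp (c * lin u h n x) else fun _ => (1 : ℂ))]
  have e2 (i : Fin n) : ∫ x, (if i ∈ A then fun x => Complex.exp (c * lin u h n x)
      else fun _ => (1 : ℂ)) x ∂P = if i ∈ A then ∫ x, Complex.exp (c * lin u h n x) ∂P else 1 := by
    by_cases hi : i ∈ A <;> simp [hi]
  simp_rw [e2]
  rw [Finset.prod_ite, Finset.prod_const, Finset.prod_const_one, mul_one,
    Set.ncard_eq_toFinset_card']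
  congr 2
  ext i
  simp

variable [IsProbabilityMeasure P]

theorem IsScoreApprox.lintegral_exp_inner_scoreSum (hu : IsScoreApprox P s u δ) {n : ℕ}
    (A : Set (Fin n)) (h : EuclideanSpace ℝ (Fin m)) :
    ∫⁻ z, ENNReal.ofReal (Real.exp ⟪h, scoreSum u A z⟫) ∂(Measure.pi fun _ => P) =
      ENNReal.ofReal (expMean P u h n ^ A.ncard) := by
  have hm := hu.measurable_scoreSum A
  have hi : Integrable (fun z => Real.exp ⟪h, scoreSum u A z⟫) (Measure.pi fun _ : Fin n => P) := by
    refine Integrable.of_bound (by fun_prop) (Real.exp (∑ _ : Fin n, ‖h‖ * |δ n|))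
      (ae_of_all _ fun z => ?_)
    rw [Real.norm_of_nonneg (Real.exp_nonneg _), inner_scoreSum]
    refine Real.exp_le_exp.2 (Finset.sum_le_sum fun i _ => ?_)
    exact Set.indicator_apply_le' (fun _ => (le_abs_self _).trans (hu.abs_lin_le h n _))
      fun _ => by positivity
  rw [← ofReal_integral_eq_lintegral_ofReal hi (ae_of_all _ fun _ => Real.exp_nonneg _)]
  congr 1
  have := integral_cexp_inner_scoreSum P u A h 1
  simp only [one_mul, ← Complex.ofReal_exp, integral_complex_ofReal] at this
  exact_mod_cast this

/-- Replacing the tilt of all the observations by the tilt of those on which `F` depends. -/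
theorem lintegral_mul_exp_inner_scoreSum {μ : Measure Z} {p : EuclideanSpace ℝ (Fin m) → Z → ℝ}
    {θ₀ : EuclideanSpace ℝ (Fin m)} [IsProbabilityMeasure (obsLaw μ p θ₀)]
    (hu : IsScoreApprox (obsLaw μ p θ₀) s u δ) {n : ℕ} {A : Set (Fin n)}
    (h : EuclideanSpace ℝ (Fin m)) {F : (Fin n → Z) → ℝ≥0∞} (hF : Measurable F)
    (hFA : DependsOn F A) :
    ∫⁻ z, F z * ENNReal.ofReal (Real.exp ⟪h, scoreSum u A z⟫)
        ∂(Measure.pi fun _ => obsLaw μ p θ₀) =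
      ENNReal.ofReal (expMean (obsLaw μ p θ₀) u h n ^ A.ncard) *
        ∫⁻ z, F z * ENNReal.ofReal (∏ i, tiltDensity μ p θ₀ u h n (z i))
          ∂(Measure.pi fun _ => obsLaw μ p θ₀) := by
  have hM : 0 < expMean (obsLaw μ p θ₀) u h n := one_pos.trans_le (hu.one_le_expMean h n)
  set M := expMean (obsLaw μ p θ₀) u h n with hMdef
  have hmA := hu.measurable_scoreSum A
  have hmA' := hu.measurable_scoreSum Aᶜ
  have hq := measurable_tiltDensity hu h n
  have key := lintegral_pi_mul_of_dependsOn (obsLaw μ p θ₀) (A := A)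
    (F := fun z => F z * ENNReal.ofReal (Real.exp ⟪h, scoreSum u A z⟫))
    (G := fun z => ENNReal.ofReal (Real.exp ⟪h, scoreSum u Aᶜ z⟫)) (by fun_prop) (by fun_prop)
    (fun x y hxy => by simp only [hFA hxy, dependsOn_scoreSum u A hxy])
    (fun x y hxy => by simp only [dependsOn_scoreSum u Aᶜ hxy])
  rw [hu.lintegral_exp_inner_scoreSum] at key
  have e (z : Fin n → Z) : F z * ENNReal.ofReal (Real.exp ⟪h, scoreSum u A z⟫) *
      ENNReal.ofReal (Real.exp ⟪h, scoreSum u Aᶜ z⟫) =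
      ENNReal.ofReal (M ^ n) * (F z * ENNReal.ofReal (∏ i, tiltDensity μ p θ₀ u h n (z i))) := by
    rw [mul_assoc, ← ENNReal.ofReal_mul (Real.exp_nonneg _), ← Real.exp_add, ← inner_add_right,
      ← scoreSum_union u disjoint_compl_right, Set.union_compl_self, inner_scoreSum]
    simp only [Set.indicator_univ, Real.exp_sum, tiltDensity, Finset.prod_div_distrib,
      Finset.prod_const, Finset.card_univ, Fintype.card_fin]
    rw [mul_left_comm, ← ENNReal.ofReal_mul (by positivity), ← hMdef,
      mul_div_cancel₀ _ (by positivity)]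
  simp_rw [e] at key
  rw [lintegral_const_mul _ (by fun_prop)] at key
  -- The observations outside `A` integrate to `M ^ Aᶜ.ncard`, which cancels against the same power
  -- in the normaliser.
  have hn : M ^ n = M ^ A.ncard * M ^ Aᶜ.ncard := by
    rw [← pow_add, Set.ncard_add_ncard_compl, Nat.card_fin]
  rw [hn, ENNReal.ofReal_mul (by positivity), mul_right_comm] at key
  exact ((ENNReal.mul_left_inj (by simpa using by positivity) ENNReal.ofReal_ne_top).1 key).symm

end ScoreSum

/-! ### The Fisher information as a positive definite quadratic form. -/

section FisherInformation

open scoped ENNReal RealInnerProductSpace MatrixOrder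
open Matrix

variable {Z : Type*} [MeasurableSpace Z] {m : ℕ} {μ : Measure Z}
  {Θ : Set (EuclideanSpace ℝ (Fin m))} {p : EuclideanSpace ℝ (Fin m) → Z → ℝ}
  {θ₀ : EuclideanSpace ℝ (Fin m)} {s : Z → EuclideanSpace ℝ (Fin m)}

theorem integral_inner_sq_eq_fisherInfo (hs : MemLp s 2 (obsLaw μ p θ₀))
    (h : EuclideanSpace ℝ (Fin m)) :
    ∫ z, ⟪h, s z⟫ ^ 2 ∂(obsLaw μ p θ₀) = h ⬝ᵥ fisherInfo μ p θ₀ s *ᵥ h := by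
  have hc (i : Fin m) : MemLp (fun z => s z i) 2 (obsLaw μ p θ₀) :=
    hs.mono ((EuclideanSpace.proj (𝕜 := ℝ) i).continuous.comp_aestronglyMeasurable hs.1)
      (ae_of_all _ fun z => PiLp.norm_apply_le (s z) i)
  have hij (i j : Fin m) : Integrable (fun z => s z i * s z j) (obsLaw μ p θ₀) :=
    (hc i).integrable_mul (hc j)
  have e (z : Z) : ⟪h, s z⟫ ^ 2 = ∑ i, ∑ j, h i * h j * (s z i * s z j) := by
    simp only [PiLp.inner_apply, RCLike.inner_apply, conj_trivial, sq, Finset.sum_mul_sum]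
    exact Finset.sum_congr rfl fun i _ => Finset.sum_congr rfl fun j _ => by ring
  simp_rw [e]
  rw [integral_finsetSum _ fun i _ => integrable_finsetSum _ fun j _ => (hij i j).const_mul _]
  simp only [dotProduct, mulVec, Finset.mul_sum]
  refine Finset.sum_congr rfl fun i _ => ?_
  rw [integral_finsetSum _ fun j _ => (hij i j).const_mul _]
  refine Finset.sum_congr rfl fun j _ => ?_
  rw [integral_const_mul, fisherInfo, Matrix.of_apply]
  ring

theorem posDef_fisherInfo (hs : MemLp s 2 (obsLaw μ p θ₀))
    (hJ : IsUnit (fisherInfo μ p θ₀ s).det) : (fisherInfo μ p θ₀ s).PosDef := by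
  have hsymm : (fisherInfo μ p θ₀ s).IsHermitian := by
    ext i j
    simp [fisherInfo, mul_comm]
  have hpsd : (fisherInfo μ p θ₀ s).PosSemidef := by
    refine .of_dotProduct_mulVec_nonneg hsymm fun x => ?_
    have := integral_inner_sq_eq_fisherInfo hs (WithLp.toLp 2 x)
    rw [star_trivial, ← this]
    exact integral_nonneg fun _ => sq_nonneg _
  exact hpsd.posDef_iff_isUnit.2 ((Matrix.isUnit_iff_isUnit_det _).2 hJ)

end FisherInformation

/-! ### Central limit theorem for the score sums. -/

section ScoreSumLimit

open scoped ENNReal RealInnerProductSpace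
open Matrix IsScoreApprox

variable {Z : Type*} [MeasurableSpace Z] {m : ℕ}

/-- The law of the scaled sum of the approximate scores. -/
def scoreSumLaw (P : Measure Z) (u : ℕ → Z → EuclideanSpace ℝ (Fin m)) {n : ℕ} (A : Set (Fin n)) :
    Measure (EuclideanSpace ℝ (Fin m)) :=
  (Measure.pi fun _ : Fin n => P).map (scoreSum u A)

variable {P : Measure Z} [IsProbabilityMeasure P] {s : Z → EuclideanSpace ℝ (Fin m)}
  {u : ℕ → Z → EuclideanSpace ℝ (Fin m)} {δ : ℕ → ℝ}

theorem IsScoreApprox.isProbabilityMeasure_scoreSumLaw (hu : IsScoreApprox P s u δ) {n : ℕ}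
    (A : Set (Fin n)) : IsProbabilityMeasure (scoreSumLaw P u A) :=
  Measure.isProbabilityMeasure_map (hu.measurable_scoreSum A).aemeasurable

/-- The central limit theorem for the scaled sums of the approximate scores, with convergence of
the exponential moments. -/
theorem IsScoreApprox.tiltConvergence (hu : IsScoreApprox P s u δ) {S : Matrix (Fin m) (Fin m) ℝ}
    (hS : S.PosSemidef) {lam : ℝ} (hlam : ∀ h, lam * ∫ z, ⟪h, s z⟫ ^ 2 ∂P = h ⬝ᵥ S *ᵥ h)
    {A : ∀ n : ℕ, Set (Fin n)}
    (hA : Tendsto (fun n : ℕ => ((A n).ncard : ℝ) / n) atTop (𝓝 lam)) :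
    TiltConvergence (fun n => ⟨scoreSumLaw P u (A n), hu.isProbabilityMeasure_scoreSumLaw (A n)⟩)
      ⟨multivariateGaussian 0 S, inferInstance⟩ := by
  refine ⟨ProbabilityMeasure.tendsto_of_tendsto_charFun fun t => ?_, fun h => ?_⟩
  · have h1 := hu.tendsto_pow_cexp t Complex.I hA
    simp only [ProbabilityMeasure.coe_mk]
    rw [charFun_multivariateGaussian hS, ← hlam]
    have e (n : ℕ) : charFun (scoreSumLaw P u (A n)) t =
        (∫ z, Complex.exp (Complex.I * lin u t n z) ∂P) ^ (A n).ncard := by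
      rw [charFun_apply, scoreSumLaw, integral_map (hu.measurable_scoreSum _).aemeasurable
        (by fun_prop), ← integral_cexp_inner_scoreSum]
      simp_rw [real_inner_comm, mul_comm]
    simp_rw [e]
    convert h1 using 3
    rw [Complex.I_sq, inner_zero_right]
    push_cast
    ring
  -- The limit of the exponential moments, plus one as slack for the convergence.
  · refine ⟨ENNReal.ofReal (Real.exp ((h ⬝ᵥ S *ᵥ h) / 2) + 1), ENNReal.ofReal_ne_top, ?_, ?_⟩
    · have h1 := hu.tendsto_pow_exp h hA
      rw [hlam] at h1
      filter_upwards [h1.eventually_le_const (lt_add_one _)] with n hn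
      simp only [ProbabilityMeasure.coe_mk]
      rw [scoreSumLaw, lintegral_map (by fun_prop) (hu.measurable_scoreSum _),
        hu.lintegral_exp_inner_scoreSum]
      exact ENNReal.ofReal_le_ofReal hn
    · have h1 := lintegral_multivariateGaussian_tilt hS h (F := fun _ => 1) measurable_const
      simp only [one_mul, lintegral_one, measure_univ, mul_one] at h1
      simp only [ProbabilityMeasure.coe_mk]
      rw [h1]
      exact ENNReal.ofReal_le_ofReal (by linarith)

end ScoreSumLimit

/-! ### Conditional laws given the common block, as random measures. -/

section RandomLaws

open scoped ENNReal Classical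

variable {Z ι : Type*} [MeasurableSpace Z] [Fintype ι] {K S : Type*} [MeasurableSpace K]
  [MeasurableSpace S]

/-- The law of `(D, T)` given the coordinates of the sample outside `A`. -/
def lawGivenCompl (P : Measure Z) [IsProbabilityMeasure P] (A : Set ι) {D : (ι → Z) → K}
    (hD : Measurable D) {T : (ι → Z) → S} (hT : Measurable T) (z : ι → Z) :
    ProbabilityMeasure (K × S) :=
  ⟨(Measure.pi fun _ => P).map fun w => (D w, T (A.piecewise w z)),
    Measure.isProbabilityMeasure_map (hD.prodMk (hT.comp
      ((measurable_piecewise_prod A).comp (measurable_id.prodMk measurable_const)))).aemeasurable⟩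

variable (P : Measure Z) [IsProbabilityMeasure P]

theorem measurable_pair_piecewise (A : Set ι) {D : (ι → Z) → K}
    (hD : Measurable D) {T : (ι → Z) → S} (hT : Measurable T) (z : ι → Z) :
    Measurable fun w => (D w, T (A.piecewise w z)) :=
  hD.prodMk (hT.comp ((measurable_piecewise_prod A).comp (measurable_id.prodMk measurable_const)))

theorem measurable_lawGivenCompl (A : Set ι) {D : (ι → Z) → K} (hD : Measurable D)
    {T : (ι → Z) → S} (hT : Measurable T) : Measurable (lawGivenCompl P A hD hT) := by
  refine Measurable.subtype_mk (Measure.measurable_of_measurable_coe _ fun B hB => ?_)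
  have hm : Measurable fun x : (ι → Z) × (ι → Z) => (D x.2, T (A.piecewise x.2 x.1)) :=
    (hD.comp measurable_snd).prodMk (hT.comp ((measurable_piecewise_prod A).comp measurable_swap))
  have := measurable_measure_prodMk_left (ν := Measure.pi fun _ : ι => P) (hm hB)
  convert! this using 2 with z
  rw [Measure.map_apply (measurable_pair_piecewise A hD hT z) hB]
  rfl

/-- Transfer to the image measure needs a measurable event. It is the preimage of a singleton,
closed in the space of laws and hence measurable because the Giry `σ`-algebra is the Borel one. -/
theorem ae_map_eq_of_forall {Ω X : Type*} [MeasurableSpace Ω] [MeasurableSpace X]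
    {K : Type*} [TopologicalSpace K] [CompactSpace K] [TopologicalSpace.MetrizableSpace K]
    [MeasurableSpace K] [BorelSpace K] {S : Type*} [MeasurableSpace S]
    {ρ : Measure Ω} {Φ : Ω → X} (hΦ : Measurable Φ)
    {κ : X → ProbabilityMeasure (K × S)} (hκ : Measurable κ) {c : Measure K}
    [hc : IsProbabilityMeasure c]
    (h : ∀ z, (κ (Φ z) : Measure (K × S)).map Prod.fst = c) :
    ∀ᵐ x ∂(ρ.map Φ), (κ x : Measure (K × S)).map Prod.fst = c := by
  let marg : ProbabilityMeasure (K × S) → ProbabilityMeasure K := fun ν =>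
    ⟨(ν : Measure (K × S)).map Prod.fst,
      Measure.isProbabilityMeasure_map measurable_fst.aemeasurable⟩
  let c' : ProbabilityMeasure K := ⟨c, hc⟩
  have hm : Measurable marg :=
    Measurable.subtype_mk ((Measure.measurable_map _ measurable_fst).comp measurable_subtype_coe)
  have hs := (hm.comp hκ) (isClosed_singleton (x := c')).measurableSet
  have hs' : MeasurableSet {x | (κ x : Measure (K × S)).map Prod.fst = c} := by
    convert hs using 1
    ext x
    exact (Subtype.ext_iff (a1 := marg (κ x)) (a2 := c')).symm
  exact (ae_map_iff hΦ.aemeasurable hs').2 (ae_of_all _ h)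

/-- The random conditional laws of two statistics which share only the coordinates in `A₀`. -/
theorem exists_law_of_pairs {K : Type*} [TopologicalSpace K] [CompactSpace K]
    [TopologicalSpace.MetrizableSpace K] [MeasurableSpace K] [BorelSpace K] {A₁ A₂ A₀ : Set ι} (h₁₂ : Disjoint A₁ A₂) (h₁₀ : Disjoint A₁ A₀)
    (h₂₀ : Disjoint A₂ A₀) {D₁ D₂ D₀ : (ι → Z) → K} (hD₁ : Measurable D₁) (hD₂ : Measurable D₂)
    (hD₀ : Measurable D₀) (dD₁ : DependsOn D₁ A₁) (dD₂ : DependsOn D₂ A₂) (dD₀ : DependsOn D₀ A₀)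
    {T₁ T₂ : (ι → Z) → S} (hT₁ : Measurable T₁) (hT₂ : Measurable T₂)
    (dT₁ : DependsOn T₁ (A₁ ∪ A₀)) (dT₂ : DependsOn T₂ (A₂ ∪ A₀)) :
    ∃ G : ProbabilityMeasure (LawSpace K S),
      (∀ᵐ x ∂(G : Measure (LawSpace K S)),
        (x.1 : Measure (K × S)).map Prod.fst = (Measure.pi fun _ => P).map D₁) ∧
      (∀ᵐ x ∂(G : Measure (LawSpace K S)),
        (x.2.1 : Measure (K × S)).map Prod.fst = (Measure.pi fun _ => P).map D₂) ∧
      (G : Measure (LawSpace K S)).map (fun x => x.2.2) = (Measure.pi fun _ => P).map D₀ ∧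
      ∀ (w : K → ℝ≥0∞) (f₁ f₂ : S → ℝ≥0∞), Measurable w → Measurable f₁ → Measurable f₂ →
        tiltedMean (G : Measure (LawSpace K S)) w f₁ f₂ =
          ∫⁻ z, f₁ (T₁ z) * f₂ (T₂ z) * (w (D₁ z) * w (D₂ z) * w (D₀ z))
            ∂(Measure.pi fun _ => P) := by
  set Φ : (ι → Z) → LawSpace K S := fun z =>
    (lawGivenCompl P A₁ hD₁ hT₁ z, lawGivenCompl P A₂ hD₂ hT₂ z, D₀ z) with hΦdef
  have hΦ : Measurable Φ := (measurable_lawGivenCompl P A₁ hD₁ hT₁).prodMk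
    ((measurable_lawGivenCompl P A₂ hD₂ hT₂).prodMk hD₀)
  -- `D` is evaluated at the resampled point alone, so the first marginal does not involve `z`.
  have hfst {A : Set ι} {D : (ι → Z) → K} (hD : Measurable D) {T : (ι → Z) → S}
      (hT : Measurable T) (z : ι → Z) :
      (lawGivenCompl P A hD hT z : Measure (K × S)).map Prod.fst =
        (Measure.pi fun _ => P).map D := by
    rw [lawGivenCompl, ProbabilityMeasure.coe_mk,
      Measure.map_map measurable_fst (measurable_pair_piecewise A hD hT z)]
    rfl
  have hp₁ := Measure.isProbabilityMeasure_map (μ := Measure.pi fun _ : ι => P) hD₁.aemeasurable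
  have hp₂ := Measure.isProbabilityMeasure_map (μ := Measure.pi fun _ : ι => P) hD₂.aemeasurable
  refine ⟨⟨(Measure.pi fun _ => P).map Φ, Measure.isProbabilityMeasure_map hΦ.aemeasurable⟩,
    ?_, ?_, ?_, fun w f₁ f₂ hw hf₁ hf₂ => ?_⟩
  · exact ae_map_eq_of_forall hΦ measurable_fst fun z => hfst hD₁ hT₁ z
  · exact ae_map_eq_of_forall hΦ (measurable_fst.comp measurable_snd) fun z => hfst hD₂ hT₂ z
  · rw [ProbabilityMeasure.coe_mk, Measure.map_map (by fun_prop) hΦ]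
    rfl
  · have mk {f : S → ℝ≥0∞} (hf : Measurable f) : Measurable fun κ : ProbabilityMeasure (K × S) =>
        ∫⁻ y, f y.2 * w y.1 ∂(κ : Measure (K × S)) :=
      Measurable.lintegral_kernel (κ := lawKernel (K × S)) (by fun_prop)
    have mk₁ := mk hf₁
    have mk₂ := mk hf₂
    have hlaw {A : Set ι} {D : (ι → Z) → K} (hD : Measurable D) {T : (ι → Z) → S}
        (hT : Measurable T) (dD : DependsOn D A) {f : S → ℝ≥0∞} (hf : Measurable f) (z : ι → Z) :
        ∫⁻ y, f y.2 * w y.1 ∂(lawGivenCompl P A hD hT z : Measure (K × S)) =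
          ∫⁻ v, f (T (A.piecewise v z)) * w (D (A.piecewise v z)) ∂(Measure.pi fun _ => P) := by
      rw [lawGivenCompl, ProbabilityMeasure.coe_mk,
        lintegral_map (by fun_prop) (measurable_pair_piecewise A hD hT z)]
      refine lintegral_congr fun v => ?_
      have : D (A.piecewise v z) = D v := dD fun i hi => Set.piecewise_eq_of_mem _ _ _ hi
      rw [this]
    have d {A : Set ι} {D : (ι → Z) → K} {T : (ι → Z) → S} (dD : DependsOn D A)
        (dT : DependsOn T (A ∪ A₀)) (f : S → ℝ≥0∞) :
        DependsOn (fun z => f (T z) * w (D z)) (A ∪ A₀) := fun x y hxy => by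
      simp only [dT hxy, dD fun i hi => hxy i (Or.inl hi)]
    have mt : Measurable fun x : LawSpace K S => (∫⁻ y, f₁ y.2 * w y.1 ∂(x.1 : Measure (K × S))) *
        (∫⁻ y, f₂ y.2 * w y.1 ∂(x.2.1 : Measure (K × S))) * w x.2.2 :=
      ((mk₁.comp measurable_fst).mul (mk₂.comp (measurable_fst.comp measurable_snd))).mul
        (hw.comp (measurable_snd.comp measurable_snd))
    rw [tiltedMean, ProbabilityMeasure.coe_mk, lintegral_map mt hΦ]
    simp only [hΦdef, hlaw hD₁ hT₁ dD₁ hf₁, hlaw hD₂ hT₂ dD₂ hf₂]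
    have := lintegral_pi_mul_mul_eq P h₁₂ h₁₀ h₂₀ (F₁ := fun z => f₁ (T₁ z) * w (D₁ z))
      (F₂ := fun z => f₂ (T₂ z) * w (D₂ z)) (F₀ := fun z => w (D₀ z)) (by fun_prop) (by fun_prop)
      (by fun_prop) (d dD₁ dT₁ f₁) (d dD₂ dT₂ f₂) (fun x y hxy => by simp only [dD₀ hxy])
    rw [← this]
    exact lintegral_congr fun z => by ring

end RandomLaws

/-! ### Limits of the tilted means along the sample. -/

section LimitOfTiltedMeans

open scoped ENNReal NNReal RealInnerProductSpace
open IsScoreApprox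

variable {Z : Type*} [MeasurableSpace Z] {m : ℕ} {μ : Measure Z}
  {Θ : Set (EuclideanSpace ℝ (Fin m))} {p : EuclideanSpace ℝ (Fin m) → Z → ℝ}
  {θ₀ : EuclideanSpace ℝ (Fin m)} {s : Z → EuclideanSpace ℝ (Fin m)}
  {u : ℕ → Z → EuclideanSpace ℝ (Fin m)} {δ : ℕ → ℝ}

theorem exists_forall_le_of_continuousMap (f : C(EReal, ℝ≥0)) : ∃ C : ℝ≥0, ∀ x, f x ≤ C := by
  obtain ⟨C, hC⟩ := (isCompact_range f.continuous).bddAbove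
  exact ⟨C, fun x => hC ⟨x, rfl⟩⟩

/-- Convergence in law of a pair, tested against products of continuous functions on the extended
reals. -/
theorem PairConvergesInLaw.tendsto_lintegral {ν : ∀ n : ℕ, Measure (Fin n → Z)}
    {S₁ S₂ : ∀ n : ℕ, (Fin n → Z) → ℝ} {L : Measure (ℝ × ℝ)} [IsProbabilityMeasure L]
    (hν : ∀ᶠ n in atTop, IsProbabilityMeasure (ν n))
    (hS₁ : ∀ n, Measurable (S₁ n)) (hS₂ : ∀ n, Measurable (S₂ n))
    (hconv : PairConvergesInLaw ν S₁ S₂ L) (f₁ f₂ : C(EReal, ℝ≥0)) :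
    Tendsto (fun n => ∫⁻ z, (f₁ (S₁ n z) : ℝ≥0∞) * f₂ (S₂ n z) ∂(ν n)) atTop
      (𝓝 (∫⁻ y, (f₁ (y.1 : EReal) : ℝ≥0∞) * f₂ (y.2 : EReal) ∂L)) := by
  obtain ⟨C₁, hC₁⟩ := exists_forall_le_of_continuousMap f₁
  obtain ⟨C₂, hC₂⟩ := exists_forall_le_of_continuousMap f₂
  let g : ℝ × ℝ → ℝ≥0 := fun y => f₁ (y.1 : EReal) * f₂ (y.2 : EReal)
  have hg : Continuous g :=
    (f₁.continuous.comp (continuous_coe_real_ereal.comp continuous_fst)).mul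
      (f₂.continuous.comp (continuous_coe_real_ereal.comp continuous_snd))
  have hgC (y : ℝ × ℝ) : ‖(g y : ℝ)‖ ≤ C₁ * C₂ := by
    rw [Real.norm_of_nonneg (NNReal.coe_nonneg _)]
    exact_mod_cast mul_le_mul' (hC₁ _) (hC₂ _)
  let G : BoundedContinuousFunction (ℝ × ℝ) ℝ :=
    BoundedContinuousFunction.ofNormedAddCommGroup (fun y => (g y : ℝ))
      (NNReal.continuous_coe.comp hg) _ hgC
  have hGm : Measurable fun y => (g y : ℝ) := (NNReal.continuous_coe.comp hg).measurable
  have e (ρ : Measure (ℝ × ℝ)) [IsProbabilityMeasure ρ] :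
      ∫⁻ y, (f₁ (y.1 : EReal) : ℝ≥0∞) * f₂ (y.2 : EReal) ∂ρ = ENNReal.ofReal (∫ y, G y ∂ρ) := by
    have := lintegral_coe_eq_integral g
      (Integrable.of_bound (μ := ρ) hGm.aestronglyMeasurable _ (ae_of_all _ hgC))
    simp only [g, ENNReal.coe_mul] at this
    exact this
  have h := (ENNReal.continuous_ofReal.tendsto _).comp (hconv G)
  rw [← e L] at h
  refine h.congr' ?_
  filter_upwards [hν] with n hn
  have hm := (hS₁ n).prodMk (hS₂ n)
  have := Measure.isProbabilityMeasure_map (μ := ν n) hm.aemeasurable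
  have h1 := e ((ν n).map fun z => (S₁ n z, S₂ n z))
  have hgm : Measurable fun y : ℝ × ℝ => (f₁ (y.1 : EReal) : ℝ≥0∞) * f₂ (y.2 : EReal) := by
    simp only [← ENNReal.coe_mul]
    exact (ENNReal.continuous_coe.comp hg).measurable
  rw [integral_map hm.aemeasurable G.continuous.aestronglyMeasurable, lintegral_map hgm hm] at h1
  exact h1.symm

theorem ncard_union_div {n : ℕ} {A B : Set (Fin n)} (h : Disjoint A B) :
    (((A ∪ B).ncard : ℝ) / n) = (A.ncard : ℝ) / n + (B.ncard : ℝ) / n := by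
  rw [Set.ncard_union_eq h, Nat.cast_add, add_div]

/-- The convergence in law at `θ₀ + h / √n` is rewritten under `θ₀`. The normalised tilt of the
whole sample reduces to the unnormalised tilt of the three blocks, and the power of the exponential
moment thus released converges to the exponential factor of the limit. -/
theorem tendsto_tilted_pair (hp : IsDensityFamily μ Θ p) (hθ₀ : θ₀ ∈ interior Θ)
    (hs : IsDQM μ p θ₀ s) (hu : IsScoreApprox (obsLaw μ p θ₀) s u δ)
    {A₁ A₂ A₀ : ∀ n : ℕ, Set (Fin n)} (h₁₂ : ∀ n, Disjoint (A₁ n) (A₂ n))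
    (h₁₀ : ∀ n, Disjoint (A₁ n) (A₀ n)) (h₂₀ : ∀ n, Disjoint (A₂ n) (A₀ n)) {lam₁ lam₂ lam₀ : ℝ}
    (hA₁ : Tendsto (fun n : ℕ => ((A₁ n).ncard : ℝ) / n) atTop (𝓝 lam₁))
    (hA₂ : Tendsto (fun n : ℕ => ((A₂ n).ncard : ℝ) / n) atTop (𝓝 lam₂))
    (hA₀ : Tendsto (fun n : ℕ => ((A₀ n).ncard : ℝ) / n) atTop (𝓝 lam₀))
    {S₁ S₂ : ∀ n : ℕ, (Fin n → Z) → ℝ}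
    (hS₁ : ∀ n, Measurable (S₁ n)) (hS₂ : ∀ n, Measurable (S₂ n))
    (dS₁ : ∀ n, DependsOn (S₁ n) (A₁ n ∪ A₀ n)) (dS₂ : ∀ n, DependsOn (S₂ n) (A₂ n ∪ A₀ n))
    {L : Measure (ℝ × ℝ)} [IsProbabilityMeasure L] (h : EuclideanSpace ℝ (Fin m))
    (hconv : PairConvergesInLaw (fun n => sampleLaw μ p n (localParam θ₀ h n)) S₁ S₂ L)
    (f₁ f₂ : C(EReal, ℝ≥0)) :
    Tendsto (fun n => ∫⁻ z, (f₁ (S₁ n z) : ℝ≥0∞) * f₂ (S₂ n z) *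
      (tilt h (embEReal (scoreSum u (A₁ n) z)) * tilt h (embEReal (scoreSum u (A₂ n) z)) *
        tilt h (embEReal (scoreSum u (A₀ n) z))) ∂(Measure.pi fun _ => obsLaw μ p θ₀)) atTop
      (𝓝 (ENNReal.ofReal (Real.exp ((lam₁ + lam₂ + lam₀) *
        (∫ z, ⟪h, s z⟫ ^ 2 ∂(obsLaw μ p θ₀)) / 2)) *
          ∫⁻ y, (f₁ (y.1 : EReal) : ℝ≥0∞) * f₂ (y.2 : EReal) ∂L)) := by
  have hP := hp.isProbabilityMeasure_obsLaw (interior_subset hθ₀)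
  obtain ⟨C₁, hC₁⟩ := exists_forall_le_of_continuousMap f₁
  obtain ⟨C₂, hC₂⟩ := exists_forall_le_of_continuousMap f₂
  have hν : ∀ᶠ n in atTop, IsProbabilityMeasure (sampleLaw μ p n (localParam θ₀ h n)) := by
    filter_upwards [hs.eventually_hellinger_le hp hθ₀ hu h one_pos] with n hn
    have := hp.isProbabilityMeasure_obsLaw hn.1
    unfold sampleLaw
    infer_instance
  have mf (f : C(EReal, ℝ≥0)) : Measurable fun x : ℝ => (f (x : EReal) : ℝ≥0∞) :=
    (ENNReal.continuous_coe.comp (f.continuous.comp continuous_coe_real_ereal)).measurable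
  have hF (n : ℕ) : Measurable fun z => (f₁ (S₁ n z) : ℝ≥0∞) * f₂ (S₂ n z) :=
    ((mf f₁).comp (hS₁ n)).mul ((mf f₂).comp (hS₂ n))
  have hFC (n : ℕ) (z : Fin n → Z) :
      (f₁ (S₁ n z) : ℝ≥0∞) * f₂ (S₂ n z) ≤ ((C₁ * C₂ : ℝ≥0) : ℝ≥0∞) := by
    rw [← ENNReal.coe_mul, ENNReal.coe_le_coe]
    exact mul_le_mul' (hC₁ _) (hC₂ _)
  have hl0 : ∫⁻ y, (f₁ (y.1 : EReal) : ℝ≥0∞) * f₂ (y.2 : EReal) ∂L ≠ ∞ := by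
    refine ne_top_of_le_ne_top (b := ((C₁ * C₂ : ℝ≥0) : ℝ≥0∞)) ENNReal.coe_ne_top ?_
    refine (lintegral_mono (g := fun _ => ((C₁ * C₂ : ℝ≥0) : ℝ≥0∞)) fun y => ?_).trans (by simp)
    rw [← ENNReal.coe_mul, ENNReal.coe_le_coe]
    exact mul_le_mul' (hC₁ _) (hC₂ _)
  have h1 := hs.tendsto_lintegral_tiltDensity hp hθ₀ hu h hF hFC hl0
    (hconv.tendsto_lintegral hν hS₁ hS₂ f₁ f₂)
  have hA (n : ℕ) : Disjoint (A₁ n ∪ A₂ n) (A₀ n) := (h₁₀ n).union_left (h₂₀ n)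
  have h2 : Tendsto (fun n : ℕ => ((A₁ n ∪ A₂ n ∪ A₀ n).ncard : ℝ) / n) atTop
      (𝓝 (lam₁ + lam₂ + lam₀)) := by
    simp_rw [ncard_union_div (hA _), ncard_union_div (h₁₂ _)]
    exact (hA₁.add hA₂).add hA₀
  have h3 := ENNReal.tendsto_ofReal (hu.tendsto_pow_exp h h2)
  refine (ENNReal.Tendsto.mul h3 (Or.inr hl0) h1 (Or.inr ENNReal.ofReal_ne_top)).congr fun n => ?_
  have dF : DependsOn (fun z => (f₁ (S₁ n z) : ℝ≥0∞) * f₂ (S₂ n z)) (A₁ n ∪ A₂ n ∪ A₀ n) :=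
    fun x y hxy => by
      have e₁ := dS₁ n (x := x) (y := y) fun i hi => hxy i (by
        rcases hi with hi | hi <;> simp [hi])
      have e₂ := dS₂ n (x := x) (y := y) fun i hi => hxy i (by
        rcases hi with hi | hi <;> simp [hi])
      simp only [e₁, e₂]
  rw [← expMean, ← lintegral_mul_exp_inner_scoreSum hu h (hF n) dF]
  refine lintegral_congr fun z => ?_
  simp only [tilt_embEReal]
  rw [scoreSum_union u (hA n), scoreSum_union u (h₁₂ n), inner_add_right, inner_add_right,
    Real.exp_add, Real.exp_add, ENNReal.ofReal_mul (by positivity),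
    ENNReal.ofReal_mul (by positivity)]

end LimitOfTiltedMeans

/-! ### Tilting products of Gaussian laws. -/

section GaussianLimit

open scoped ENNReal NNReal RealInnerProductSpace unitInterval
open Matrix

theorem ext_of_lintegral_mul_continuousMap {X Y : Type*} [TopologicalSpace X] [CompactSpace X]
    [MeasurableSpace X] [BorelSpace X] [TopologicalSpace.MetrizableSpace X] [TopologicalSpace Y]
    [CompactSpace Y] [MeasurableSpace Y] [BorelSpace Y] [TopologicalSpace.MetrizableSpace Y]
    {ρ ρ' : Measure (X × Y)} [IsFiniteMeasure ρ] (h : ∀ (f : C(X, ℝ≥0)) (g : C(Y, ℝ≥0)),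
      ∫⁻ y, (f y.1 : ℝ≥0∞) * g y.2 ∂ρ = ∫⁻ y, (f y.1 : ℝ≥0∞) * g y.2 ∂ρ') : ρ = ρ' := by
  -- Each factor is viewed as a family over `Unit`, the form in which products of test functions
  -- determine a measure.
  let e : (X × Y) ≃ᵐ ((Unit → X) × (Unit → Y)) :=
    .symm <| .prodCongr (.funUnique ..) (.funUnique ..)
  rw [← e.map_measurableEquiv_injective.eq_iff]
  have : IsFiniteMeasure (ρ.map e) := inferInstance
  refine Measure.ext_of_lintegral_prod_mul_prod_boundedContinuousFunction fun f g => ?_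
  rw [lintegral_map_equiv, lintegral_map_equiv]
  simpa [e] using! h (f ()).toContinuousMap (g ()).toContinuousMap

variable {ι : Type*} [Fintype ι] [DecidableEq ι]

theorem withDensity_exp_multivariateGaussian {S : Matrix ι ι ℝ} (hS : S.PosDef)
    (h : EuclideanSpace ℝ ι) :
    (multivariateGaussian 0 S).withDensity (fun d => ENNReal.ofReal (Real.exp ⟪h, d⟫)) =
      ENNReal.ofReal (Real.exp ((h ⬝ᵥ S *ᵥ h) / 2)) •
        (multivariateGaussian h S⁻¹).map (toEuclideanCLM (𝕜 := ℝ) S) := by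
  refine Measure.ext_of_lintegral _ fun F hF => ?_
  rw [lintegral_smul_measure, lintegral_map hF (by fun_prop), smul_eq_mul,
    lintegral_multivariateGaussian_inv hS h hF,
    lintegral_withDensity_eq_lintegral_mul _ (by fun_prop) hF]
  simp only [Pi.mul_apply, mul_comm]

/-- The weight is a product over the independent coordinates, so each Gaussian factor is tilted
separately and `ν` is untouched. -/
theorem lintegral_prod_multivariateGaussian {S₁ S₂ S₀ : Matrix ι ι ℝ} (hS₁ : S₁.PosDef)
    (hS₂ : S₂.PosDef) (hS₀ : S₀.PosDef) (h : EuclideanSpace ℝ ι) {Y : Type*} [MeasurableSpace Y]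
    (ν : Measure Y) [IsProbabilityMeasure ν]
    {F : EuclideanSpace ℝ ι × EuclideanSpace ℝ ι × EuclideanSpace ℝ ι × Y → ℝ≥0∞}
    (hF : Measurable F) :
    ∫⁻ ω, F ω * (ENNReal.ofReal (Real.exp ⟪h, ω.1⟫) * ENNReal.ofReal (Real.exp ⟪h, ω.2.1⟫) *
        ENNReal.ofReal (Real.exp ⟪h, ω.2.2.1⟫))
      ∂((multivariateGaussian 0 S₁).prod ((multivariateGaussian 0 S₂).prod
        ((multivariateGaussian 0 S₀).prod ν))) =
      ENNReal.ofReal (Real.exp ((h ⬝ᵥ S₁ *ᵥ h) / 2)) *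
        (ENNReal.ofReal (Real.exp ((h ⬝ᵥ S₂ *ᵥ h) / 2)) *
          (ENNReal.ofReal (Real.exp ((h ⬝ᵥ S₀ *ᵥ h) / 2)) *
            ∫⁻ ω, F (toEuclideanCLM (𝕜 := ℝ) S₁ ω.1, toEuclideanCLM (𝕜 := ℝ) S₂ ω.2.1,
              toEuclideanCLM (𝕜 := ℝ) S₀ ω.2.2.1, ω.2.2.2)
            ∂((multivariateGaussian h S₁⁻¹).prod ((multivariateGaussian h S₂⁻¹).prod
              ((multivariateGaussian h S₀⁻¹).prod ν))))) := by
  have he : Measurable fun d : EuclideanSpace ℝ ι => ENNReal.ofReal (Real.exp ⟪h, d⟫) := by fun_prop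
  have e₀ := prod_withDensity_left (ν := ν) (μ := multivariateGaussian 0 S₀) he
  have he₀ : Measurable fun z : EuclideanSpace ℝ ι × Y => ENNReal.ofReal (Real.exp ⟪h, z.1⟫) := by
    fun_prop
  have e₂ := prod_withDensity (μ := multivariateGaussian 0 S₂) he he₀
    (ν := (multivariateGaussian 0 S₀).prod ν)
  have he₂ : Measurable fun z : EuclideanSpace ℝ ι × EuclideanSpace ℝ ι × Y =>
      ENNReal.ofReal (Real.exp ⟪h, z.1⟫) * ENNReal.ofReal (Real.exp ⟪h, z.2.1⟫) := by fun_prop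
  have e₁ := prod_withDensity (μ := multivariateGaussian 0 S₁) he he₂
    (ν := (multivariateGaussian 0 S₂).prod ((multivariateGaussian 0 S₀).prod ν))
  rw [← e₂, ← e₀, withDensity_exp_multivariateGaussian hS₁ h,
    withDensity_exp_multivariateGaussian hS₂ h, withDensity_exp_multivariateGaussian hS₀ h] at e₁
  have mA (S : Matrix ι ι ℝ) : Measurable (toEuclideanCLM (𝕜 := ℝ) S) := by fun_prop
  have hm : Measurable fun ω : EuclideanSpace ℝ ι × EuclideanSpace ℝ ι × EuclideanSpace ℝ ι × Y =>
      ENNReal.ofReal (Real.exp ⟪h, ω.1⟫) * (ENNReal.ofReal (Real.exp ⟪h, ω.2.1⟫) *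
        ENNReal.ofReal (Real.exp ⟪h, ω.2.2.1⟫)) := by fun_prop
  have k₀ := Measure.map_prod_map (multivariateGaussian h S₀⁻¹) ν (mA S₀) measurable_id
  have k₂ := Measure.map_prod_map (multivariateGaussian h S₂⁻¹)
    ((multivariateGaussian h S₀⁻¹).prod ν) (mA S₂) ((mA S₀).prodMap measurable_id)
  have k₁ := Measure.map_prod_map (multivariateGaussian h S₁⁻¹)
    ((multivariateGaussian h S₂⁻¹).prod ((multivariateGaussian h S₀⁻¹).prod ν)) (mA S₁)
    ((mA S₂).prodMap ((mA S₀).prodMap measurable_id))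
  rw [Measure.map_id] at k₀
  rw [← k₀] at k₂
  rw [← k₂] at k₁
  have i (S : Matrix ι ι ℝ) : IsProbabilityMeasure
      ((multivariateGaussian h S⁻¹).map (toEuclideanCLM (𝕜 := ℝ) S)) :=
    Measure.isProbabilityMeasure_map (mA S).aemeasurable
  have k := congrArg (fun ρ => ∫⁻ ω, F ω ∂ρ) e₁
  simp only [Measure.prod_smul_left, Measure.prod_smul_right, lintegral_smul_measure,
    smul_eq_mul, k₁, mul_left_comm (ENNReal.ofReal (Real.exp ((h ⬝ᵥ S₀ *ᵥ h) / 2)))] at k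
  rw [lintegral_map hF ((mA S₁).prodMap ((mA S₂).prodMap ((mA S₀).prodMap measurable_id))),
    lintegral_withDensity_eq_lintegral_mul _ hm hF] at k
  refine Eq.trans (lintegral_congr fun ω => ?_) (k.symm.trans (mul_left_comm _ _ _))
  simp only [Pi.mul_apply]
  ring

end GaussianLimit

/-! ### Statistics in the Gaussian shift experiment. -/

section Main

open scoped ENNReal NNReal RealInnerProductSpace unitInterval
open Matrix

theorem limitExperiment_eq_map {m : ℕ} (J : Matrix (Fin m) (Fin m) ℝ) (lam₁ lam₂ lam₁₂ : ℝ)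
    (h : EuclideanSpace ℝ (Fin m)) :
    limitExperiment J lam₁ lam₂ lam₁₂ h =
      ((multivariateGaussian h (lam₁ • J)⁻¹).prod ((multivariateGaussian h (lam₂ • J)⁻¹).prod
        ((multivariateGaussian h (lam₁₂ • J)⁻¹).prod (volume : Measure I)))).map
        (Prod.map id (Prod.map id (Prod.map id Subtype.val))) := by
  have hI := unitInterval.measurePreserving_coe.map_eq
  have : IsProbabilityMeasure ((volume : Measure I).map ((↑) : I → ℝ)) :=
    Measure.isProbabilityMeasure_map measurable_subtype_coe.aemeasurable
  rw [limitExperiment, ← hI, ← Measure.map_prod_map _ _ measurable_id (by fun_prop),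
    ← Measure.map_prod_map _ _ measurable_id (by fun_prop),
    ← Measure.map_prod_map _ _ measurable_id (by fun_prop), Measure.map_id, Measure.map_id,
    Measure.map_id]

/-- Passing from the tilted centred Gaussian limit to statistics in the Gaussian shift
experiment. -/
theorem exists_statistics_of_tilted_limit {m : ℕ} {J : Matrix (Fin m) (Fin m) ℝ} (hJ : J.PosDef)
    {lam₁ lam₂ lam₁₂ : ℝ} (hlam₁ : 0 < lam₁) (hlam₂ : 0 < lam₂) (hlam₁₂ : 0 < lam₁₂)
    {L : EuclideanSpace ℝ (Fin m) → Measure (ℝ × ℝ)} (hL : ∀ h, IsProbabilityMeasure (L h))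
    {T₁ T₂ : EuclideanSpace ℝ (Fin m) → EuclideanSpace ℝ (Fin m) → I → EReal}
    (hT₁ : Measurable (fun x : EuclideanSpace ℝ (Fin m) × EuclideanSpace ℝ (Fin m) × I =>
      T₁ x.1 x.2.1 x.2.2))
    (hT₂ : Measurable (fun x : EuclideanSpace ℝ (Fin m) × EuclideanSpace ℝ (Fin m) × I =>
      T₂ x.1 x.2.1 x.2.2))
    (hT : ∀ h, ∀ f₁ f₂ : C(EReal, ℝ≥0),
      ∫⁻ ω, (f₁ (T₁ ω.1 ω.2.2.1 ω.2.2.2) : ℝ≥0∞) * f₂ (T₂ ω.2.1 ω.2.2.1 ω.2.2.2) *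
          (ENNReal.ofReal (Real.exp ⟪h, ω.1⟫) * ENNReal.ofReal (Real.exp ⟪h, ω.2.1⟫) *
            ENNReal.ofReal (Real.exp ⟪h, ω.2.2.1⟫))
        ∂((multivariateGaussian 0 (lam₁ • J)).prod ((multivariateGaussian 0 (lam₂ • J)).prod
          ((multivariateGaussian 0 (lam₁₂ • J)).prod (volume : Measure I)))) =
        ENNReal.ofReal (Real.exp ((lam₁ + lam₂ + lam₁₂) * (h ⬝ᵥ J *ᵥ h) / 2)) *
          ∫⁻ y, (f₁ (y.1 : EReal) : ℝ≥0∞) * f₂ (y.2 : EReal) ∂(L h)) :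
    ∃ T₁ T₂ : EuclideanSpace ℝ (Fin m) → EuclideanSpace ℝ (Fin m) → ℝ → ℝ,
      Measurable (fun x : EuclideanSpace ℝ (Fin m) × EuclideanSpace ℝ (Fin m) × ℝ =>
        T₁ x.1 x.2.1 x.2.2) ∧
      Measurable (fun x : EuclideanSpace ℝ (Fin m) × EuclideanSpace ℝ (Fin m) × ℝ =>
        T₂ x.1 x.2.1 x.2.2) ∧
      ∀ h : EuclideanSpace ℝ (Fin m), (limitExperiment J lam₁ lam₂ lam₁₂ h).map
          (fun ω => (T₁ ω.1 ω.2.2.1 ω.2.2.2, T₂ ω.2.1 ω.2.2.1 ω.2.2.2)) = L h := by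
  have hpd {lam : ℝ} (hlam : 0 < lam) : (lam • J).PosDef := hJ.smul hlam
  have cE : Measurable ((↑) : ℝ → EReal) := measurable_coe_real_ereal
  have mf (f : C(EReal, ℝ≥0)) : Measurable fun x : EReal => (f x : ℝ≥0∞) :=
    (ENNReal.continuous_coe.comp f.continuous).measurable
  let A (lam : ℝ) := toEuclideanCLM (𝕜 := ℝ) (lam • J)
  have mA (lam : ℝ) : Measurable (A lam) := (A lam).continuous.measurable
  -- The sampler expects score sums; an observation `z` with covariance `(lam • J)⁻¹` is turned into
  -- one by applying `lam • J`.
  let W₁ : EuclideanSpace ℝ (Fin m) × EuclideanSpace ℝ (Fin m) × I → EReal :=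
    fun x => T₁ (A lam₁ x.1) (A lam₁₂ x.2.1) x.2.2
  let W₂ : EuclideanSpace ℝ (Fin m) × EuclideanSpace ℝ (Fin m) × I → EReal :=
    fun x => T₂ (A lam₂ x.1) (A lam₁₂ x.2.1) x.2.2
  have mW₁ : Measurable W₁ := hT₁.comp ((mA lam₁).prodMap ((mA lam₁₂).prodMap measurable_id))
  have mW₂ : Measurable W₂ := hT₂.comp ((mA lam₂).prodMap ((mA lam₁₂).prodMap measurable_id))
  have hproj : Measurable (Set.projIcc (0 : ℝ) 1 zero_le_one) := continuous_projIcc.measurable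
  have mT {W : EuclideanSpace ℝ (Fin m) × EuclideanSpace ℝ (Fin m) × I → EReal}
      (mW : Measurable W) :
      Measurable fun x : EuclideanSpace ℝ (Fin m) × EuclideanSpace ℝ (Fin m) × ℝ =>
        (W (x.1, x.2.1, Set.projIcc 0 1 zero_le_one x.2.2)).toReal :=
    measurable_ereal_toReal.comp (mW.comp
      (measurable_id.prodMap (measurable_id.prodMap hproj)))
  refine ⟨fun z₁ z₀ v => (W₁ (z₁, z₀, Set.projIcc 0 1 zero_le_one v)).toReal,
    fun z₂ z₀ v => (W₂ (z₂, z₀, Set.projIcc 0 1 zero_le_one v)).toReal, mT mW₁, mT mW₂,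
    fun h => ?_⟩
  set R := (multivariateGaussian h (lam₁ • J)⁻¹).prod ((multivariateGaussian h (lam₂ • J)⁻¹).prod
        ((multivariateGaussian h (lam₁₂ • J)⁻¹).prod (volume : Measure I))) with hR
  have hLh := hL h
  have mW : Measurable fun ω : EuclideanSpace ℝ (Fin m) × EuclideanSpace ℝ (Fin m) ×
      EuclideanSpace ℝ (Fin m) × I =>
        (W₁ (ω.1, ω.2.2.1, ω.2.2.2), W₂ (ω.2.1, ω.2.2.1, ω.2.2.2)) := by fun_prop
  have mcoe : Measurable (Prod.map ((↑) : ℝ → EReal) ((↑) : ℝ → EReal)) := cE.prodMap cE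
  have hlaw : R.map (fun ω => (W₁ (ω.1, ω.2.2.1, ω.2.2.2), W₂ (ω.2.1, ω.2.2.1, ω.2.2.2))) =
      (L h).map (Prod.map (↑) (↑)) := by
    have := Measure.isProbabilityMeasure_map (μ := R) mW.aemeasurable
    refine ext_of_lintegral_mul_continuousMap fun f₁ f₂ => ?_
    have mff : Measurable fun y : EReal × EReal => (f₁ y.1 : ℝ≥0∞) * f₂ y.2 :=
      ((mf f₁).comp measurable_fst).mul ((mf f₂).comp measurable_snd)
    rw [lintegral_map mff mW, lintegral_map mff mcoe]
    have k := hT h f₁ f₂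
    have mF : Measurable fun ω : EuclideanSpace ℝ (Fin m) × EuclideanSpace ℝ (Fin m) ×
      EuclideanSpace ℝ (Fin m) × I => (f₁ (T₁ ω.1 ω.2.2.1 ω.2.2.2) : ℝ≥0∞) *
        f₂ (T₂ ω.2.1 ω.2.2.1 ω.2.2.2) := by
      have m₁ : Measurable fun ω : EuclideanSpace ℝ (Fin m) × EuclideanSpace ℝ (Fin m) ×
        EuclideanSpace ℝ (Fin m) × I => T₁ ω.1 ω.2.2.1 ω.2.2.2 :=
        hT₁.comp (measurable_fst.prodMk (measurable_snd.comp measurable_snd))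
      have m₂ : Measurable fun ω : EuclideanSpace ℝ (Fin m) × EuclideanSpace ℝ (Fin m) ×
        EuclideanSpace ℝ (Fin m) × I => T₂ ω.2.1 ω.2.2.1 ω.2.2.2 := hT₂.comp measurable_snd
      exact mff.comp (m₁.prodMk m₂)
    have k' := lintegral_prod_multivariateGaussian (hpd hlam₁) (hpd hlam₂) (hpd hlam₁₂) h
      (volume : Measure I) mF
    rw [k] at k'
    have hc : ENNReal.ofReal (Real.exp ((lam₁ + lam₂ + lam₁₂) * (h ⬝ᵥ J *ᵥ h) / 2)) =
        ENNReal.ofReal (Real.exp ((h ⬝ᵥ (lam₁ • J) *ᵥ h) / 2)) *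
          (ENNReal.ofReal (Real.exp ((h ⬝ᵥ (lam₂ • J) *ᵥ h) / 2)) *
            ENNReal.ofReal (Real.exp ((h ⬝ᵥ (lam₁₂ • J) *ᵥ h) / 2))) := by
      simp only [Matrix.smul_mulVec, dotProduct_smul, smul_eq_mul]
      rw [← ENNReal.ofReal_mul (by positivity),
        ← ENNReal.ofReal_mul (by positivity), ← Real.exp_add, ← Real.exp_add]
      congr 2
      ring
    rw [← mul_assoc (ENNReal.ofReal (Real.exp ((h ⬝ᵥ (lam₂ • J) *ᵥ h) / 2))), ← mul_assoc,
      ← hc] at k'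
    -- The normalising constants of the three tilts multiply to the one in the hypothesis and
    -- cancel.
    exact ((ENNReal.mul_right_inj (by simpa using Real.exp_pos _) ENNReal.ofReal_ne_top).1 k').symm
  have mto : Measurable (Prod.map EReal.toReal EReal.toReal) :=
    measurable_ereal_toReal.prodMap measurable_ereal_toReal
  have mpair : Measurable fun ω : EuclideanSpace ℝ (Fin m) × EuclideanSpace ℝ (Fin m) ×
      EuclideanSpace ℝ (Fin m) × ℝ =>
      ((W₁ (ω.1, ω.2.2.1, Set.projIcc 0 1 zero_le_one ω.2.2.2)).toReal,
        (W₂ (ω.2.1, ω.2.2.1, Set.projIcc 0 1 zero_le_one ω.2.2.2)).toReal) :=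
    ((mT mW₁).comp (measurable_fst.prodMk (measurable_snd.comp measurable_snd))).prodMk
      ((mT mW₂).comp measurable_snd)
  rw [limitExperiment_eq_map, ← hR, Measure.map_map mpair (by fun_prop)]
  -- By `hlaw` infinite values have probability zero, so the value of `EReal.toReal` there is
  -- irrelevant.
  have k := congrArg (fun ρ => ρ.map (Prod.map EReal.toReal EReal.toReal)) hlaw
  rw [Measure.map_map mto mW, Measure.map_map mto mcoe] at k
  have e : Prod.map EReal.toReal EReal.toReal ∘ Prod.map ((↑) : ℝ → EReal) ((↑) : ℝ → EReal) =
      id := by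
    funext y
    exact Prod.ext (EReal.toReal_coe _) (EReal.toReal_coe _)
  rw [e, Measure.map_id] at k
  rw [← k]
  congr 1
  funext ω
  simp [Set.projIcc_val]

end Main

end

theorem theorem1 {Z : Type*} [MeasurableSpace Z] {m : ℕ} (μ : Measure Z)
    (Θ : Set (EuclideanSpace ℝ (Fin m))) (p : EuclideanSpace ℝ (Fin m) → Z → ℝ)
    (hp : IsDensityFamily μ Θ p)
    (θ₀ : EuclideanSpace ℝ (Fin m)) (hθ₀ : θ₀ ∈ interior Θ)
    (s : Z → EuclideanSpace ℝ (Fin m)) (hs : IsDQM μ p θ₀ s)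
    (hJ : IsUnit (fisherInfo μ p θ₀ s).det)
    (I₁ I₂ : Set ℝ) (hI₁ : I₁ ⊆ Set.Icc 0 1) (hI₂ : I₂ ⊆ Set.Icc 0 1)
    (lam₁ lam₂ lam₁₂ : ℝ)
    (hlam₁ : 0 < lam₁) (hlam₂ : 0 < lam₂) (hlam₁₂ : 0 < lam₁₂)
    (hN₁ : HasAsymptoticShare (I₁ ∩ I₂ᶜ) lam₁)
    (hN₂ : HasAsymptoticShare (I₂ ∩ I₁ᶜ) lam₂)
    (hN₁₂ : HasAsymptoticShare (I₁ ∩ I₂) lam₁₂)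
    (S₁ S₂ : ∀ n : ℕ, (Fin n → Z) → ℝ)
    (hS₁ : ∀ n, Measurable (S₁ n)) (hS₂ : ∀ n, Measurable (S₂ n))
    (hS₁I : ∀ n, DependsOn (S₁ n) (infoIndices I₁ n))
    (hS₂I : ∀ n, DependsOn (S₂ n) (infoIndices I₂ n))
    (L : EuclideanSpace ℝ (Fin m) → Measure (ℝ × ℝ)) (hL : ∀ h, IsProbabilityMeasure (L h))
    (hconv : ∀ h, PairConvergesInLaw (fun n => sampleLaw μ p n (localParam θ₀ h n)) S₁ S₂ (L h)) :
    ∃ T₁ T₂ : EuclideanSpace ℝ (Fin m) → EuclideanSpace ℝ (Fin m) → ℝ → ℝ,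
      Measurable (fun x : EuclideanSpace ℝ (Fin m) × EuclideanSpace ℝ (Fin m) × ℝ =>
        T₁ x.1 x.2.1 x.2.2) ∧
      Measurable (fun x : EuclideanSpace ℝ (Fin m) × EuclideanSpace ℝ (Fin m) × ℝ =>
        T₂ x.1 x.2.1 x.2.2) ∧
      ∀ h : EuclideanSpace ℝ (Fin m),
        (limitExperiment (fisherInfo μ p θ₀ s) lam₁ lam₂ lam₁₂ h).map
          (fun ω => (T₁ ω.1 ω.2.2.1 ω.2.2.2, T₂ ω.2.1 ω.2.2.1 ω.2.2.2)) = L h := by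
  have hP := hp.isProbabilityMeasure_obsLaw (interior_subset hθ₀)
  have hs2 := hs.memLp_score hp hθ₀
  obtain ⟨u, δ, hu⟩ := exists_isScoreApprox (obsLaw μ p θ₀) hs.1 hs2 (hs.integral_score hp hθ₀)
  set P := obsLaw μ p θ₀ with hPdef
  have hJp := posDef_fisherInfo hs2 hJ
  have hV := integral_inner_sq_eq_fisherInfo hs2
  set J := fisherInfo μ p θ₀ s with hJdef
  -- The private and common blocks. They need not exhaust the sample: observations in neither `I₁`
  -- nor `I₂` are integrated out.
  set A₁ : ∀ n : ℕ, Set (Fin n) := infoIndices (I₁ ∩ I₂ᶜ) with hA₁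
  set A₂ : ∀ n : ℕ, Set (Fin n) := infoIndices (I₂ ∩ I₁ᶜ) with hA₂
  set A₀ : ∀ n : ℕ, Set (Fin n) := infoIndices (I₁ ∩ I₂) with hA₀
  have h₁₂ (n : ℕ) : Disjoint (A₁ n) (A₂ n) := Set.disjoint_left.2 fun i h h' => h.2 h'.1
  have h₁₀ (n : ℕ) : Disjoint (A₁ n) (A₀ n) := Set.disjoint_left.2 fun i h h' => h.2 h'.2
  have h₂₀ (n : ℕ) : Disjoint (A₂ n) (A₀ n) := Set.disjoint_left.2 fun i h h' => h.2 h'.1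
  have dS₁ (n : ℕ) : DependsOn (S₁ n) (A₁ n ∪ A₀ n) := fun x y hxy => hS₁I n fun i hi => hxy i (by
    by_cases h : i ∈ infoIndices I₂ n
    · exact Or.inr ⟨hi, h⟩
    · exact Or.inl ⟨hi, h⟩)
  have dS₂ (n : ℕ) : DependsOn (S₂ n) (A₂ n ∪ A₀ n) := fun x y hxy => hS₂I n fun i hi => hxy i (by
    by_cases h : i ∈ infoIndices I₁ n
    · exact Or.inr ⟨h, hi⟩
    · exact Or.inl ⟨hi, h⟩)
  have mD (n : ℕ) (A : Set (Fin n)) : Measurable fun z => embEReal (scoreSum u A z) :=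
    continuous_embEReal.measurable.comp (hu.measurable_scoreSum A)
  have dD (n : ℕ) (A : Set (Fin n)) : DependsOn (fun z => embEReal (scoreSum u A z)) A :=
    fun x y hxy => by simp only [dependsOn_scoreSum u A hxy]
  have cE : Measurable ((↑) : ℝ → EReal) := measurable_coe_real_ereal
  -- `G n` is built under `θ₀` only; `h` will enter through the weight `tilt h`, so the limiting
  -- functions cannot depend on it.
  choose G hG₁ hG₂ hG₀ hG using fun n => exists_law_of_pairs P (h₁₂ n) (h₁₀ n) (h₂₀ n)
    (mD n (A₁ n)) (mD n (A₂ n)) (mD n (A₀ n)) (dD n (A₁ n)) (dD n (A₂ n)) (dD n (A₀ n))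
    (cE.comp (hS₁ n)) (cE.comp (hS₂ n))
    (fun x y hxy => by simp only [Function.comp_apply, dS₁ n hxy])
    (fun x y hxy => by simp only [Function.comp_apply, dS₂ n hxy])
  have hpd {lam : ℝ} (hlam : 0 < lam) : (lam • J).PosDef := hJp.smul hlam
  have hquad (lam : ℝ) (h : EuclideanSpace ℝ (Fin m)) :
      lam * ∫ z, inner ℝ h (s z) ^ 2 ∂P = dotProduct h ((lam • J).mulVec h) := by
    rw [hV, Matrix.smul_mulVec, dotProduct_smul, smul_eq_mul]
  have tc₁ := hu.tiltConvergence (hpd hlam₁).posSemidef (hquad lam₁) hN₁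
  have tc₂ := hu.tiltConvergence (hpd hlam₂).posSemidef (hquad lam₂) hN₂
  have tc₀ := hu.tiltConvergence (hpd hlam₁₂).posSemidef (hquad lam₁₂) hN₁₂
  have hmap (n : ℕ) (A : Set (Fin n)) : (scoreSumLaw P u A).map embEReal =
      (Measure.pi fun _ => P).map fun z => embEReal (scoreSum u A z) := by
    rw [scoreSumLaw, Measure.map_map continuous_embEReal.measurable (hu.measurable_scoreSum A)]
    rfl
  have mf (f : C(EReal, NNReal)) : Measurable fun x : EReal => (f x : ENNReal) :=
    (ENNReal.continuous_coe.comp f.continuous).measurable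
  obtain ⟨T₁, T₂, hT₁, hT₂, hT⟩ := exists_limit_sampler tc₁ tc₂ tc₀ G
    (fun n => by simpa only [ProbabilityMeasure.coe_mk, hmap] using hG₁ n)
    (fun n => by simpa only [ProbabilityMeasure.coe_mk, hmap] using hG₂ n)
    (fun n => by simpa only [ProbabilityMeasure.coe_mk, hmap] using hG₀ n)
    (fun h f₁ f₂ => ENNReal.ofReal (Real.exp ((lam₁ + lam₂ + lam₁₂) *
      dotProduct h (J.mulVec h) / 2)) *
        ∫⁻ y, (f₁ (y.1 : EReal) : ENNReal) * f₂ (y.2 : EReal) ∂(L h))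
    (fun h f₁ f₂ => by
      simp only [hG _ _ _ _ (measurable_tilt h) (mf f₁) (mf f₂)]
      rw [← hV]
      exact tendsto_tilted_pair hp hθ₀ hs hu h₁₂ h₁₀ h₂₀ hN₁ hN₂ hN₁₂ hS₁ hS₂ dS₁ dS₂ h
        (hconv h) f₁ f₂)
  exact exists_statistics_of_tilted_limit hJp hlam₁ hlam₂ hlam₁₂ hL hT₁ hT₂ hT
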